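/- **Setting.** Let $(X_s)_{s\ge 0}$ be a real-valued stochastic process on a probability space $(\Omega,\mathcal F,\mathbb P)$, fix $t\ge 0$, and put $X^{(t)}_\tau:=X_{t+\tau}-X_t$. The measure $\mathbb P$ is risk-neutral (no interest rates, no dividends): $\mathbb E[e^{X^{(t)}_\tau}]=1$ for all $\tau>0$. The Black–Scholes–Merton call price is $C_{BS}(\tau,x,s)=\mathcal N(d_+)-e^{x}\mathcal N(d_-)$ with $d_\pm=-\frac{x}{s\sqrt\tau}\pm\frac{s\sqrt\tau}{2}$, $\mathcal N$ the standard Gaussian distribution function, and the forward implied volatility $\sigma_{t,\tau}(x)$ is the unique $s>0$ such that $C_{BS}(\tau,x,s)=\mathbb E[(e^{X^{(t)}_\tau}-e^x)^+]$. **Assumption.** For $\varepsilon>0$ let $Y_\varepsilon:=\varepsilon X^{(t)}_{1/\varepsilon}$ (that is $\tau^{-1}X^{(t)}_\tau$ with $\varepsilon=\tau^{-1}$), $\mathcal D_\varepsilon:=\{u\in\mathbb R:\mathbb E[e^{uY_\varepsilon/\varepsilon}]<\infty\}$ and $\Lambda_\varepsilon(u):=\varepsilon\log\mathbb E[e^{uY_\varepsilon/\varepsilon}]$;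 for $z\in\mathbb C$ with $\Re z\in \mathcal D_\varepsilon$ put $\Re\Lambda_\varepsilon(z):=\varepsilon\log|\mathbb E[e^{zY_\varepsilon/\varepsilon}]|\in[-\infty,\infty)$. Assume that $\mathcal D_0:=\bigcup_{\varepsilon>0}\bigcap_{0<s\le\varepsilon}\mathcal D_s=\bigcap_{\varepsilon>0}\bigcup_{0<s\le\varepsilon}\mathcal D_s$, with interior $\mathcal D_0^o$, and that there are functions $\Lambda_0,\Lambda_1,\Lambda_2$ such that: 1. for each $u\in\mathcal D_0^o$, $\Lambda_\varepsilon(u)=\Lambda_0(u)+\Lambda_1(u)\varepsilon+\Lambda_2(u)\varepsilon^2+O(\varepsilon^3)$ as $\varepsilon\downarrow0$; 2. for some $\varepsilon_0>0$, $(\varepsilon,u)\mapsto\Lambda_\varepsilon(u)$ is finite and of class $C^\infty$ on $(0,\varepsilon_0)\times\mathcal D_0^o$; 3. $0\in\mathcal D_0^o$; 4. $\Lambda_0$ is strictly convex and essentially smooth on $\mathcal D_0^o$: it is differentiable there and $|\Lambda_0'(u)|\to\infty$ as $u\in\mathcal D_0^o$ tends to any boundary point of $\mathcal D_0^o$; 5.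 $\Lambda_0$ has an analytic continuation, still denoted $\Lambda_0$, to $\{z\in\mathbb C:\Re z\in\mathcal D_0^o\setminus\{0\}\}$ such that for every fixed $p\in\mathcal D_0^o\setminus\{0\}$: (a) $\Re\Lambda_\varepsilon(p+iq)=\Re\Lambda_0(p+iq)+O(\varepsilon)$ as $\varepsilon\downarrow0$, uniformly for $q$ in bounded subsets of $\mathbb R$; (b) $q\mapsto\Re\Lambda_0(p+iq)$ has a unique maximum at $q=0$ and stays bounded away from $\Lambda_0(p)$ as $|q|\to\infty$; (c) there are $\varepsilon_1,q^*>0$ and $M$ with $\Re\Lambda_\varepsilon(p+iq)-\Re\Lambda_0(p+iq)\le M\varepsilon$ for all $|q|\ge q^*$ and $0<\varepsilon\le\varepsilon_1$. Assume in addition that $1\in\mathcal D_0^o$ and $\Lambda_0(1)=0$. **Notation.** $\Lambda^*(k):=\sup_{u\in\mathcal D_0^o}\{uk-\Lambda_0(u)\}$; $u^*(k)$ is the solution in $\mathcal D_0^o$ of $\Lambda_0'(u^*(k))=k$; $\Lambda_{i,l}$ is the $l$-th derivative of $\Lambda_i$. Writing $u=u^*(k)$ and evaluating all $\Lambda_i,\Lambda_{i,l}$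 at $u$, put $$\Upsilon(k):=\Lambda_2-\frac{5\Lambda_{0,3}^2}{24\Lambda_{0,2}^3}+\frac{4\Lambda_{1,1}\Lambda_{0,3}+\Lambda_{0,4}}{8\Lambda_{0,2}^2}-\frac{\Lambda_{1,1}^2+\Lambda_{1,2}}{2\Lambda_{0,2}}-\frac{\Lambda_{0,3}}{2u\Lambda_{0,2}^2}-\frac{\Lambda_{0,3}}{2(u-1)\Lambda_{0,2}^2}-\frac{\Lambda_{1,1}(1-2u)+3}{u(u-1)\Lambda_{0,2}}-\frac{1}{u^2(u-1)^2\Lambda_{0,2}},$$ $$v_0^\infty(k):=2\Big(2\Lambda^*(k)-k\mp2\sqrt{\Lambda^*(k)(\Lambda^*(k)-k)}\Big),$$ with the sign $+$ if $\Lambda_0'(0)<k<\Lambda_0'(1)$ and $-$ if $k\notin[\Lambda_0'(0),\Lambda_0'(1)]$, $$v_1^\infty:=\frac{8(v_0^\infty)^2}{4k^2-(v_0^\infty)^2}\left(\Lambda_1+\log\frac{4k^2-(v_0^\infty)^2}{4(u-1)u\,(v_0^\infty)^{3/2}\sqrt{\Lambda_{0,2}}}\right),$$ and, abbreviating $v_i=v_i^\infty$,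 $$v_2^\infty:=\frac{4}{v_0(v_0^2-4k^2)^3}\Big[8k^4v_1v_0^2(v_1+6)-16k^6v_1^2-2\Upsilon(k)v_0^3(v_0^2-4k^2)^2-k^2v_0^4(96+v_1^2+8v_1)-v_0^6(v_1+8)\Big].$$ **Claim.** For every $k\in\Lambda_0'(\mathcal D_0^o)\setminus\{\Lambda_0'(0),\Lambda_0'(1)\}$ (that is, every real $k\notin\{\Lambda_0'(0),\Lambda_0'(1)\}$ when $\Lambda_0'$ maps $\mathcal D_0^o$ onto $\mathbb R$), the forward implied volatility $\sigma_{t,\tau}(k\tau)$ exists and is unique for all sufficiently large $\tau$, and $$\sigma_{t,\tau}^2(k\tau)=v_0^\infty(k)+\frac{v_1^\infty(k)}{\tau}+\frac{v_2^\infty(k)}{\tau^2}+O\Big(\frac1{\tau^3}\Big)\qquad\text{as }\tau\to\infty .$$ -/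

import Mathlib

open MeasureTheory ProbabilityTheory Filter Topology Asymptotics
open scoped ContDiff

noncomputable section

namespace FwdSmile

/-! ### Renormalised logarithmic moment generating functions -/

section Family

variable {Ω : Type*} [MeasurableSpace Ω]

/-- The effective domain `D_ε = {u : E[exp (u Y_ε / ε)] < ∞}`. -/
def effDomain (μ : Measure Ω) (Y : ℝ → Ω → ℝ) (ε : ℝ) : Set ℝ :=
  {u : ℝ | u / ε ∈ integrableExpSet (Y ε) μ}

/-- `Λ_ε(u) = ε log E[exp (u Y_ε / ε)]`. -/
def lmgf (μ : Measure Ω) (Y : ℝ → Ω → ℝ) (ε u : ℝ) : ℝ :=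
  ε * cgf (Y ε) μ (u / ε)

/-- `liminf_{ε ↓ 0} D_ε = ⋃_{ε > 0} ⋂_{0 < s ≤ ε} D_s`. -/
def domainLiminf (D : ℝ → Set ℝ) : Set ℝ :=
  {u : ℝ | ∃ ε : ℝ, 0 < ε ∧ ∀ s : ℝ, 0 < s → s ≤ ε → u ∈ D s}

/-- `limsup_{ε ↓ 0} D_ε = ⋂_{ε > 0} ⋃_{0 < s ≤ ε} D_s`. -/
def domainLimsup (D : ℝ → Set ℝ) : Set ℝ :=
  {u : ℝ | ∀ ε : ℝ, 0 < ε → ∃ s : ℝ, 0 < s ∧ s ≤ ε ∧ u ∈ D s}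

/-- The moment generating function `E[exp (z Y_ε / ε)]` at a complex argument `z`. -/
def complexMgf (μ : Measure Ω) (Y : ℝ → Ω → ℝ) (ε : ℝ) (z : ℂ) : ℂ :=
  complexMGF (Y ε) μ (z / (ε : ℂ))

/-- `Re Λ_ε(z) = ε log |E[exp (z Y_ε / ε)]|`, meaningful where the expectation does not vanish. -/
def reLmgf (μ : Measure Ω) (Y : ℝ → Ω → ℝ) (ε : ℝ) (z : ℂ) : ℝ :=
  ε * Real.log ‖complexMgf μ Y ε z‖

/-- Essential smoothness of `h` on the open set `S`: `S` is non-empty, `h` is differentiable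
on `S`, and `|h'|` tends to infinity at every boundary point of `S`. -/
structure IsEssentiallySmoothOn (h : ℝ → ℝ) (S : Set ℝ) : Prop where
  nonempty : S.Nonempty
  differentiable : ∀ u ∈ S, DifferentiableAt ℝ h u
  steep : ∀ b ∈ frontier S, Tendsto (fun u => |deriv h u|) (𝓝[S] b) atTop

/-- Control of the tails on the vertical lines `Re z = p`, `p ∈ S`, `p ≠ 0`. The function `G` is
the (unique) analytic continuation of `Λ₀` off the real axis. -/
def TailErrorControl (μ : Measure Ω) (Y : ℝ → Ω → ℝ) (S : Set ℝ) (Λ₀ : ℝ → ℝ) : Prop :=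
  ∃ G : ℂ → ℂ,
    DifferentiableOn ℂ G {z : ℂ | z.re ∈ S ∧ z.re ≠ 0} ∧
    (∀ u ∈ S, u ≠ 0 → G (u : ℂ) = (Λ₀ u : ℂ)) ∧
    ∀ p ∈ S, p ≠ 0 →
      -- `Re Λ_ε = Re Λ₀ + O(ε)` on the vertical line, uniformly on bounded segments
      (∀ R : ℝ, 0 < R → ∃ C : ℝ, ∀ᶠ ε in 𝓝[>] (0 : ℝ), ∀ q : ℝ, |q| ≤ R →
        complexMgf μ Y ε ⟨p, q⟩ ≠ 0 ∧ |reLmgf μ Y ε ⟨p, q⟩ - (G ⟨p, q⟩).re| ≤ C * ε) ∧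
      -- `q ↦ Re Λ₀(p + iq)` has a unique maximum at zero and stays away from it at infinity
      (∀ q : ℝ, q ≠ 0 → (G ⟨p, q⟩).re < (G ⟨p, 0⟩).re) ∧
      (∃ δ R : ℝ, 0 < δ ∧ ∀ q : ℝ, R ≤ |q| → (G ⟨p, q⟩).re ≤ (G ⟨p, 0⟩).re - δ) ∧
      -- uniform upper bound far from the real axis (`Re Λ_ε = -∞` where the expectation vanishes)
      (∃ ε₁ R M : ℝ, 0 < ε₁ ∧ 0 < R ∧ ∀ ε : ℝ, 0 < ε → ε ≤ ε₁ → p ∈ effDomain μ Y ε ∧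
        ∀ q : ℝ, R ≤ |q| → complexMgf μ Y ε ⟨p, q⟩ = 0 ∨
          reLmgf μ Y ε ⟨p, q⟩ - (G ⟨p, q⟩).re ≤ M * ε)

/-- The standing assumption on a family `(Y_ε)_{ε > 0}`: `D₀` is the limit of the effective
domains and `Λ₀, Λ₁, Λ₂` are the coefficients of the expansion of `Λ_ε` on the interior of `D₀`. -/
structure StandingAssumption (μ : Measure Ω) (Y : ℝ → Ω → ℝ) (D₀ : Set ℝ)
    (Λ₀ Λ₁ Λ₂ : ℝ → ℝ) : Prop where
  liminf_eq : domainLiminf (effDomain μ Y) = D₀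
  limsup_eq : domainLimsup (effDomain μ Y) = D₀
  expansion : ∀ u ∈ interior D₀,
    (fun ε : ℝ => lmgf μ Y ε u - (Λ₀ u + Λ₁ u * ε + Λ₂ u * ε ^ 2))
      =O[𝓝[>] (0 : ℝ)] (fun ε : ℝ => ε ^ 3)
  smooth : ∃ ε₀ : ℝ, 0 < ε₀ ∧
    (∀ ε ∈ Set.Ioo 0 ε₀, interior D₀ ⊆ effDomain μ Y ε) ∧
    ContDiffOn ℝ ∞ (fun x : ℝ × ℝ => lmgf μ Y x.1 x.2) (Set.Ioo 0 ε₀ ×ˢ interior D₀)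
  zero_mem : (0 : ℝ) ∈ interior D₀
  strictConvex : StrictConvexOn ℝ (interior D₀) Λ₀
  essentiallySmooth : IsEssentiallySmoothOn Λ₀ (interior D₀)
  tail : TailErrorControl μ Y (interior D₀) Λ₀

end Family

/-! ### Forward-start options and the forward smile -/

section Smile

variable {Ω : Type*}

/-- `X^{(t)}_τ = X_{t+τ} - X_t`. -/
def fwd (X : ℝ → Ω → ℝ) (t τ : ℝ) (a : Ω) : ℝ := X (t + τ) a - X t a

/-- The family `Y_ε = τ⁻¹ X^{(t)}_τ` with `ε = τ⁻¹`. -/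
def largeMaturityFamily (X : ℝ → Ω → ℝ) (t ε : ℝ) (a : Ω) : ℝ := ε * fwd X t (1 / ε) a

/-- The Gaussian distribution function. -/
def gaussCdf (x : ℝ) : ℝ := cdf (gaussianReal 0 1) x

/-- The Black-Scholes-Merton price of the call with maturity `τ`, strike `e^k`, volatility `s`. -/
def bsCall (τ k s : ℝ) : ℝ :=
  gaussCdf (-k / (s * √τ) + s * √τ / 2)
    - Real.exp k * gaussCdf (-k / (s * √τ) - s * √τ / 2)

/-- The price of the (Type-I) forward-start call option `E[(exp X^{(t)}_τ - e^k)⁺]`. -/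
def fwdCall [MeasurableSpace Ω] (μ : Measure Ω) (X : ℝ → Ω → ℝ) (t τ k : ℝ) : ℝ :=
  ∫ a, max (Real.exp (fwd X t τ a) - Real.exp k) 0 ∂μ

/-- `s` is a forward implied volatility `σ_{t,τ}(k)`. -/
def IsFwdImpliedVol [MeasurableSpace Ω] (μ : Measure Ω) (X : ℝ → Ω → ℝ) (t τ k s : ℝ) : Prop :=
  0 < s ∧ bsCall τ k s = fwdCall μ X t τ k

end Smile

/-! ### The coefficients of the expansion -/

/-- The Fenchel-Legendre transform `Λ*(k) = sup_{u ∈ S} (u k - Λ₀(u))`. -/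
def legendre (S : Set ℝ) (Λ₀ : ℝ → ℝ) (k : ℝ) : ℝ :=
  sSup ((fun u : ℝ => u * k - Λ₀ u) '' S)

/-- `u` is the saddlepoint `u*(k)`: the solution in `S` of `Λ₀'(u) = k`. -/
def IsSaddlePoint (S : Set ℝ) (Λ₀ : ℝ → ℝ) (k u : ℝ) : Prop :=
  u ∈ S ∧ deriv Λ₀ u = k

/-- The function `Υ(b, k)`, with `u = u*(k)`. -/
def Upsilon (Λ₀ Λ₁ Λ₂ : ℝ → ℝ) (b u : ℝ) : ℝ :=
  let L02 := iteratedDeriv 2 Λ₀ u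
  let L03 := iteratedDeriv 3 Λ₀ u
  let L04 := iteratedDeriv 4 Λ₀ u
  let L11 := deriv Λ₁ u
  let L12 := iteratedDeriv 2 Λ₁ u
  Λ₂ u - 5 * L03 ^ 2 / (24 * L02 ^ 3) + (4 * L11 * L03 + L04) / (8 * L02 ^ 2)
    - (L11 ^ 2 + L12) / (2 * L02) - L03 / (2 * u * L02 ^ 2) - L03 / (2 * (u - b) * L02 ^ 2)
    - (L11 * (b - 2 * u) + 3) / (u * (u - b) * L02)
    - b ^ 2 / (u ^ 2 * (u - b) ^ 2 * L02)

open Classical in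
/-- `v₀^∞(k)`: the sign of the square root is `+` for `Λ₀'(0) < k < Λ₀'(1)` and `-` otherwise. -/
def v0 (S : Set ℝ) (Λ₀ : ℝ → ℝ) (k : ℝ) : ℝ :=
  let L := legendre S Λ₀ k
  if deriv Λ₀ 0 < k ∧ k < deriv Λ₀ 1 then
    2 * (2 * L - k + 2 * √(L * (L - k)))
  else
    2 * (2 * L - k - 2 * √(L * (L - k)))

/-- `v₁^∞(k)`, with `u = u*(k)`. -/
def v1 (S : Set ℝ) (Λ₀ Λ₁ : ℝ → ℝ) (k u : ℝ) : ℝ :=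
  let v := v0 S Λ₀ k
  8 * v ^ 2 / (4 * k ^ 2 - v ^ 2) *
    (Λ₁ u + Real.log ((4 * k ^ 2 - v ^ 2) /
      (4 * (u - 1) * u * v ^ (3 / 2 : ℝ) * √(iteratedDeriv 2 Λ₀ u))))

/-- `v₂^∞(k)`, with `u = u*(k)`. -/
def v2 (S : Set ℝ) (Λ₀ Λ₁ Λ₂ : ℝ → ℝ) (k u : ℝ) : ℝ :=
  let v := v0 S Λ₀ k
  let w := v1 S Λ₀ Λ₁ k u
  4 / (v * (v ^ 2 - 4 * k ^ 2) ^ 3) *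
    (8 * k ^ 4 * w * v ^ 2 * (w + 6) - 16 * k ^ 6 * w ^ 2
      - 2 * Upsilon Λ₀ Λ₁ Λ₂ 1 u * v ^ 3 * (v ^ 2 - 4 * k ^ 2) ^ 2
      - k ^ 2 * v ^ 4 * (96 + w ^ 2 + 8 * w) - v ^ 6 * (w + 8))

end FwdSmile

end

/-! Put ε = 1/τ, let M_ε(z) = E[exp (z X_τ)] for the forward increment X_τ, and let G be the
analytic continuation of Λ₀. Up to the parity terms collected in `otmPrice`, the call price is a
Mellin–Fourier integral of exp (k(1 - z)/ε) M_ε(z) / (z(z - 1)) over the line Re z = u, for any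
admissible u other than the poles 0 and 1 (`price_eq_integral`). Writing M_ε = F_ε exp (G/ε) and
taking u = u*(k), the exponent has a saddle at u. Laplace's method gives a price of size exp (-(Λ* -
k)/ε) √ε with relative correction 1 + Υ ε + O(ε²) (`laplace_expansion`,
`AmplitudeControl.price_expansion`).

The difficulty is that Laplace's method needs F_ε and its derivatives near u uniformly in ε, whereas
the expansion of Λ_ε is only pointwise on the real axis and the bounds on vertical lines have
constants depending on the line. Two remedies combine in `exists_amplitudeControl`. Re G is bounded
above on a strip, so by Borel–Carathéodory G grows at most exponentially there. Phragmén–Lindelöf on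
a narrow strip then carries the bounds on its two boundary lines to the interior
(`exists_strip_width`). A bounded holomorphic family with pointwise second order expansions on an
interval converges at rate ε on a complex disc (`exists_holomorphic_limit`). This follows from an
Egorov-type choice of good real nodes, Lagrange interpolation and the maximum principle. The limit
equals exp Λ₁ on the real axis, which also supplies the smoothness of Λ₁. Strict convexity alone
does not give Λ₀''(u) > 0; the maximum of Re G on vertical lines does (`second_deriv_pos`).

On the Black–Scholes side, the Mills ratio shows that with variance w the same parity-adjusted price
is exp (-ρ(w)/ε) √(ε/2π) B(w) (1 - c(w) ε + O(ε²)), where ρ, B, c are `bsRate`, `bsLead`, `bsCorr`.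
Equating logarithms turns the implied variance into an approximate root of `smileDefect`. The value
v₀ solves ρ(v₀) = Λ* - k on the branch with the right position relative to ±2k; v₁ and v₂ cancel the
orders ε and ε². Since ρ'(v₀) ≠ 0, the defect controls the error (`isBigO_sub_of_smileDefect`).
Existence follows by bracketing between variances on both sides of v₀, uniqueness from positivity of
the vega. -/

noncomputable section

namespace FwdSmile

/-! ### Bounded holomorphic families: from pointwise real expansions to complex rates -/

section

/-- A set of reals bounded below, of measure larger than `N * h`, contains `N + 1` points with
consecutive distances at least `h`. -/
lemma exists_separated_points {h : ℝ} (hh : 0 < h) (N : ℕ) :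
    ∀ S : Set ℝ, BddBelow S → ENNReal.ofReal (N * h) < volume S →
      ∃ x : ℕ → ℝ, (∀ i ≤ N, x i ∈ S) ∧ ∀ i j, i < j → j ≤ N → x i + ((j : ℝ) - i) * h ≤ x j := by
  induction N with
  | zero =>
    intro S _ hS
    have : S.Nonempty := by
      rw [Set.nonempty_iff_ne_empty]; rintro rfl; simp at hS
    obtain ⟨p, hp⟩ := this
    exact ⟨fun _ => p, fun _ _ => hp, fun i j hij hj => by omega⟩
  | succ N ih =>
    intro S hb hS
    -- Greedy choice of the leftmost point. The slack r - (N + 1) h pays for p not being the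
    -- infimum: cutting S at p + h removes measure less than h + r - (N + 1) h, so more than N h
    -- remains.
    obtain ⟨r, hr1, hr2⟩ := ENNReal.lt_iff_exists_nnreal_btwn.1 hS
    rw [ENNReal.ofReal, ENNReal.coe_lt_coe, Real.toNNReal_lt_iff_lt_coe (by positivity)] at hr1
    push_cast at hr1
    have hne : S.Nonempty := by
      rw [Set.nonempty_iff_ne_empty]; rintro rfl; simp at hS
    obtain ⟨p, hp, hp'⟩ := exists_lt_of_csInf_lt hne
      (show sInf S < sInf S + ((r : ℝ) - (N + 1) * h) by linarith)
    set S' := S ∩ Set.Ici (p + h) with hS'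
    have hsub : S ⊆ Set.Icc (sInf S) (p + h) ∪ S' := by
      intro y hy
      rcases le_total y (p + h) with h1 | h1
      · exact Or.inl ⟨csInf_le hb hy, h1⟩
      · exact Or.inr ⟨hy, h1⟩
    have hvol : ENNReal.ofReal (N * h) < volume S' := by
      by_contra hcon
      push Not at hcon
      have h1 : volume S ≤ ENNReal.ofReal (p + h - sInf S) + ENNReal.ofReal (N * h) := by
        calc volume S ≤ volume (Set.Icc (sInf S) (p + h) ∪ S') := measure_mono hsub
          _ ≤ volume (Set.Icc (sInf S) (p + h)) + volume S' := measure_union_le _ _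
          _ ≤ _ := by rw [Real.volume_Icc]; gcongr
      have h0 : sInf S ≤ p := csInf_le hb hp
      rw [← ENNReal.ofReal_add (by linarith) (by positivity)] at h1
      have h2 : volume S ≤ (r : ENNReal) := by
        refine h1.trans ?_
        rw [← ENNReal.ofReal_coe_nnreal]
        exact ENNReal.ofReal_le_ofReal (by linarith)
      exact absurd hr2 (not_lt.2 h2)
    obtain ⟨x, hx1, hx2⟩ := ih S' (hb.mono Set.inter_subset_left) hvol
    refine ⟨fun i => Nat.casesOn i p x, ?_, ?_⟩
    · rintro (_ | i) hi
      · exact hp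
      · exact (hx1 i (by omega)).1
    · rintro (_ | i) (_ | j) hij hj
      · omega
      · have h0 : p + h ≤ x 0 := (hx1 0 (by omega)).2
        have h1 : x 0 + (j : ℝ) * h ≤ x j := by
          rcases Nat.eq_zero_or_pos j with rfl | hj0
          · simp
          · simpa using hx2 0 j hj0 (by omega)
        simp only [Nat.cast_zero, Nat.cast_add, Nat.cast_one, sub_zero]
        change p + ((j : ℝ) + 1) * h ≤ x j
        linarith
      · omega
      · have := hx2 i j (by omega) (by omega)
        push_cast
        simpa using this

lemma prod_erase_sub_eq (N j : ℕ) (hj : j ≤ N) :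
    ∏ i ∈ (Finset.range (N + 1)).erase j, |(j : ℝ) - i| = (j.factorial : ℝ) * (N - j).factorial := by
  have hset : (Finset.range (N + 1)).erase j = Finset.range j ∪ Finset.Ico (j + 1) (N + 1) := by
    ext i; simp only [Finset.mem_erase, Finset.mem_range, Finset.mem_union, Finset.mem_Ico]; omega
  rw [hset, Finset.prod_union]
  · congr 1
    · rw [← Finset.prod_range_reflect, ← Finset.prod_range_add_one_eq_factorial]
      push_cast
      refine Finset.prod_congr rfl fun i hi => ?_
      have hi' := Finset.mem_range.1 hi
      rw [Nat.cast_sub (by omega), Nat.cast_sub (by omega)]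
      push_cast
      rw [abs_of_nonneg] <;> linarith [show (0 : ℝ) ≤ i from Nat.cast_nonneg i]
    · rw [Finset.prod_Ico_eq_prod_range, ← Finset.prod_range_add_one_eq_factorial]
      push_cast
      refine Finset.prod_congr rfl fun i hi => ?_
      rw [abs_of_nonpos] <;> linarith [show (0 : ℝ) ≤ i from Nat.cast_nonneg i]
  · rw [Finset.disjoint_left]; intro i; simp only [Finset.mem_range, Finset.mem_Ico]; omega

/-- The constant is 6 = 3 * 2, from N^N / N! ≤ e^N ≤ 3^N and binomial coefficients at most 2^N. An
exponential loss in N is affordable because N will be of order log (1/ε). -/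
lemma div_pow_le_factorial_mul (N j : ℕ) (hj : j ≤ N) :
    ((N : ℝ) / 6) ^ N ≤ (j.factorial : ℝ) * (N - j).factorial := by
  have h1 : (N : ℝ) ^ N / N.factorial ≤ Real.exp N := Real.pow_div_factorial_le_exp N (by positivity) N
  have h2 : Real.exp N ≤ 3 ^ N := by
    rw [show (N : ℝ) = N * 1 by ring, Real.exp_nat_mul]
    exact pow_le_pow_left₀ (Real.exp_pos _).le Real.exp_one_lt_three.le N
  have h3 : (N.choose j : ℝ) ≤ 2 ^ N := by exact_mod_cast Nat.choose_le_two_pow N j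
  have h4 : (N.choose j : ℝ) * (j.factorial * (N - j).factorial) = N.factorial := by
    rw [← mul_assoc]; exact_mod_cast Nat.choose_mul_factorial_mul_factorial hj
  have h5 : (0 : ℝ) < (j.factorial : ℝ) * (N - j).factorial := by positivity
  have h6 : (0 : ℝ) < N.factorial := by positivity
  rw [div_pow, div_le_iff₀ (by positivity)]
  rw [div_le_iff₀ h6] at h1
  calc (N : ℝ) ^ N ≤ Real.exp N * N.factorial := h1
    _ ≤ 3 ^ N * (2 ^ N * (j.factorial * (N - j).factorial)) := by
        rw [← h4]; gcongr
    _ = _ := by rw [show (6 : ℝ) = 3 * 2 by norm_num, mul_pow]; ring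

/-- Equal spacing a / N is the worst case and gives (a / N)^N j! (N - j)!. This bounds the
denominators of the Lagrange basis from below. -/
lemma le_prod_erase_of_separated {x : ℕ → ℝ} {N : ℕ} (hN : 1 ≤ N) {a : ℝ} (ha : 0 < a)
    (hsep : ∀ i j, i < j → j ≤ N → x i + ((j : ℝ) - i) * (a / N) ≤ x j) (j : ℕ) (hj : j ≤ N) :
    (a / 6) ^ N ≤ ∏ i ∈ (Finset.range (N + 1)).erase j, |x j - x i| := by
  have hN' : (0 : ℝ) < N := by exact_mod_cast hN
  have h1 : ∀ i ∈ (Finset.range (N + 1)).erase j, (a / N) * |(j : ℝ) - i| ≤ |x j - x i| := by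
    intro i hi
    simp only [Finset.mem_erase, Finset.mem_range] at hi
    rcases lt_or_gt_of_ne hi.1 with h | h
    · have := hsep i j h hj
      have h' : (i : ℝ) < j := by exact_mod_cast h
      rw [abs_of_pos (by linarith)]
      exact le_trans (by linarith) (le_abs_self _)
    · have := hsep j i h (by omega)
      have h' : (j : ℝ) < i := by exact_mod_cast h
      rw [abs_of_neg (by linarith), abs_sub_comm]
      exact le_trans (by linarith) (le_abs_self _)
  calc (a / 6) ^ N = (a / N) ^ N * ((N : ℝ) / 6) ^ N := by rw [← mul_pow]; congr 1; field_simp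
    _ ≤ (a / N) ^ N * ((j.factorial : ℝ) * (N - j).factorial) := by
        gcongr; exact div_pow_le_factorial_mul N j hj
    _ = ∏ i ∈ (Finset.range (N + 1)).erase j, (a / N) * |(j : ℝ) - i| := by
        rw [Finset.prod_mul_distrib, prod_erase_sub_eq N j hj, Finset.prod_const,
          Finset.card_erase_of_mem (by simp; omega)]
        simp
    _ ≤ _ := Finset.prod_le_prod (fun i _ => by positivity) h1

/-- Division of a holomorphic function by finitely many of its zeros. -/
lemma exists_eq_prod_sub_mul {c : ℂ} {R : ℝ} (s : Finset ℂ) :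
    ∀ f : ℂ → ℂ, DifferentiableOn ℂ f (Metric.ball c R) → (↑s ⊆ Metric.ball c R) →
      (∀ p ∈ s, f p = 0) → ∃ q : ℂ → ℂ, DifferentiableOn ℂ q (Metric.ball c R) ∧
        ∀ z, f z = (∏ p ∈ s, (z - p)) * q z := by
  classical
  induction s using Finset.induction_on with
  | empty => intro f hf _ _; exact ⟨f, hf, fun z => by simp⟩
  | insert p s hps ih =>
    intro f hf hs h0
    have hpb : p ∈ Metric.ball c R := hs (by simp)
    have hfp : f p = 0 := h0 p (by simp)
    have hd : DifferentiableOn ℂ (dslope f p) (Metric.ball c R) :=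
      (Complex.differentiableOn_dslope (Metric.isOpen_ball.mem_nhds hpb)).2 hf
    have hmul : ∀ z, f z = (z - p) * dslope f p z := by
      intro z
      have := sub_smul_dslope f p z
      simp only [smul_eq_mul, hfp, sub_zero] at this
      exact this.symm
    obtain ⟨q, hq1, hq2⟩ := ih (dslope f p) hd (fun y hy => hs (by simp [Finset.mem_coe.1 hy]))
      (fun y hy => by
        have h1 := h0 y (by simp [hy])
        rw [hmul y] at h1
        rcases mul_eq_zero.1 h1 with h2 | h2
        · rw [sub_eq_zero] at h2; subst h2; exact absurd hy hps
        · exact h2)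
    refine ⟨q, hq1, fun z => ?_⟩
    rw [Finset.prod_insert hps, mul_assoc, ← hq2 z, hmul z]

lemma norm_eval_basis_le {x : ℕ → ℝ} {N : ℕ} (hN : 1 ≤ N) {a c ρ : ℝ} (ha : 0 < a)
    (hx : ∀ i ≤ N, |x i - c| ≤ a)
    (hsep : ∀ i j, i < j → j ≤ N → x i + ((j : ℝ) - i) * (a / N) ≤ x j) (j : ℕ) (hj : j ≤ N)
    (z : ℂ) (hz : ‖z - c‖ ≤ ρ) :
    ‖(Lagrange.basis (Finset.range (N + 1)) (fun i => (x i : ℂ)) j).eval z‖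
      ≤ (6 * (ρ + a) / a) ^ N := by
  have h1 := le_prod_erase_of_separated hN ha hsep j hj
  have hcard : ((Finset.range (N + 1)).erase j).card = N := by
    rw [Finset.card_erase_of_mem (by simp; omega)]; simp
  have hρ : 0 ≤ ρ := (norm_nonneg _).trans hz
  have h2 : ∏ i ∈ (Finset.range (N + 1)).erase j, ‖z - (x i : ℂ)‖ ≤ (ρ + a) ^ N := by
    calc _ ≤ ∏ i ∈ (Finset.range (N + 1)).erase j, (ρ + a) := by
          refine Finset.prod_le_prod (fun _ _ => norm_nonneg _) fun i hi => ?_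
          simp only [Finset.mem_erase, Finset.mem_range] at hi
          have h3 : z - (x i : ℂ) = (z - c) - ((x i - c : ℝ) : ℂ) := by push_cast; ring
          rw [h3]
          refine (norm_sub_le _ _).trans (add_le_add hz ?_)
          rw [Complex.norm_real]; exact hx i (by omega)
      _ = _ := by rw [Finset.prod_const, hcard]
  have h4 : ‖(Lagrange.basis (Finset.range (N + 1)) (fun i => (x i : ℂ)) j).eval z‖ =
      (∏ i ∈ (Finset.range (N + 1)).erase j, |x j - x i|)⁻¹ *
      ∏ i ∈ (Finset.range (N + 1)).erase j, ‖z - (x i : ℂ)‖ := by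
    rw [Lagrange.basis, Polynomial.eval_prod, norm_prod, ← Finset.prod_inv_distrib,
      ← Finset.prod_mul_distrib]
    refine Finset.prod_congr rfl fun i _ => ?_
    simp only [Lagrange.basisDivisor, Polynomial.eval_mul, Polynomial.eval_C, Polynomial.eval_sub,
      Polynomial.eval_X, norm_mul, norm_inv]
    congr 2
    rw [← Complex.ofReal_sub, Complex.norm_real]; rfl
  rw [h4]
  calc _ ≤ ((a / 6) ^ N)⁻¹ * (ρ + a) ^ N := by gcongr
    _ = _ := by rw [← inv_pow, ← mul_pow]; congr 1; field_simp

/-- A bounded holomorphic function which is small at separated real nodes is small nearby. -/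
lemma norm_le_of_small_at_separated {g : ℂ → ℂ} {c a R R' K e : ℝ} {N : ℕ} (hN : 1 ≤ N)
    (ha : 0 < a) (h3 : 3 * a ≤ R') (hR : R' < R)
    (hg : DifferentiableOn ℂ g (Metric.ball (c : ℂ) R))
    (hK : ∀ z ∈ Metric.ball (c : ℂ) R, ‖g z‖ ≤ K) {x : ℕ → ℝ} (hx : ∀ i ≤ N, |x i - c| ≤ a)
    (hsep : ∀ i j, i < j → j ≤ N → x i + ((j : ℝ) - i) * (a / N) ≤ x j)
    (he : ∀ i ≤ N, ‖g (x i)‖ ≤ e) (z : ℂ) (hz : ‖z - c‖ ≤ a) :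
    ‖g z‖ ≤ K * (2 * a / (R' - a)) ^ (N + 1) + 2 * e * 48 ^ N := by
  classical
  have hN' : (0 : ℝ) < N := by exact_mod_cast hN
  have he0 : 0 ≤ e := (norm_nonneg _).trans (he 0 (by omega))
  have hK0 : 0 ≤ K := (norm_nonneg _).trans (hK c (by simp; linarith))
  have hinjR : ∀ i j, i ≤ N → j ≤ N → x i = x j → i = j := by
    intro i j hi hj hij
    by_contra hne
    have : ∀ i j, i < j → j ≤ N → x i = x j → False := by
      intro i j hlt hj h
      have h1 := hsep i j hlt hj
      have h2 : (i : ℝ) < j := by exact_mod_cast hlt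
      have h4 : 0 < ((j : ℝ) - i) * (a / N) := mul_pos (by linarith) (by positivity)
      linarith
    rcases lt_or_gt_of_ne hne with h | h
    · exact this i j h hj hij
    · exact this j i h hi hij.symm
  set s := Finset.range (N + 1) with hs
  set v : ℕ → ℂ := fun i => (x i : ℂ) with hv
  have hinj : Set.InjOn v s := by
    intro i hi j hj hij
    simp only [hs, Finset.coe_range, Set.mem_Iio] at hi hj
    exact hinjR i j (by omega) (by omega) (by simpa [hv] using hij)
  -- The interpolant inherits the smallness of the nodal values up to an exponential factor in N.
  -- The remainder g - P vanishes at every node, and its quotient q by the nodal polynomial is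
  -- bounded by the maximum principle on the circle of radius R'.
  set P := Lagrange.interpolate s v (fun i => g (v i)) with hP
  have hPbound : ∀ (ρ : ℝ) (ζ : ℂ), ‖ζ - c‖ ≤ ρ →
      ‖P.eval ζ‖ ≤ e * 2 ^ N * (6 * (ρ + a) / a) ^ N := by
    intro ρ ζ hζ
    have hρ : 0 ≤ ρ := (norm_nonneg _).trans hζ
    rw [hP, Lagrange.interpolate_apply, Polynomial.eval_finsetSum]
    calc _ ≤ ∑ i ∈ s, e * (6 * (ρ + a) / a) ^ N := by
          refine norm_sum_le_of_le _ fun i hi => ?_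
          have hi' : i ≤ N := by simp only [hs, Finset.mem_range] at hi; omega
          rw [Polynomial.eval_mul, Polynomial.eval_C, norm_mul]
          exact mul_le_mul (he i hi') (norm_eval_basis_le hN ha hx hsep i hi' ζ hζ)
            (norm_nonneg _) he0
      _ = (N + 1 : ℝ) * (e * (6 * (ρ + a) / a) ^ N) := by simp [hs]
      _ ≤ 2 ^ N * (e * (6 * (ρ + a) / a) ^ N) := by
          gcongr
          exact_mod_cast Nat.lt_two_pow_self (n := N)
      _ = _ := by ring
  have hvball : ∀ i ≤ N, v i ∈ Metric.ball (c : ℂ) R := by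
    intro i hi
    rw [Metric.mem_ball, Complex.dist_eq, hv]
    simp only
    rw [← Complex.ofReal_sub, Complex.norm_real, Real.norm_eq_abs]
    linarith [hx i hi]
  obtain ⟨q, hq1, hq2⟩ := exists_eq_prod_sub_mul (c := (c : ℂ)) (R := R) (s.image v)
    (fun ζ => g ζ - P.eval ζ) (hg.sub P.differentiable.differentiableOn)
    (by
      intro y hy
      simp only [Finset.coe_image, Set.mem_image, hs, Finset.coe_range, Set.mem_Iio] at hy
      obtain ⟨i, hi, rfl⟩ := hy
      exact hvball i (by omega))
    (by
      intro p hp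
      obtain ⟨i, hi, rfl⟩ := Finset.mem_image.1 hp
      simp only [hP]
      rw [Lagrange.eval_interpolate_at_node _ hinj hi, sub_self])
  have hprod : ∀ ζ : ℂ, ∏ p ∈ s.image v, (ζ - p) = ∏ i ∈ s, (ζ - v i) := fun ζ =>
    Finset.prod_image hinj
  have hR'a : 0 < R' - a := by linarith
  have hR'0 : R' ≠ 0 := (show 0 < R' by linarith).ne'
  have hnode : ∀ i ≤ N, ‖v i - c‖ ≤ a := by
    intro i hi
    simp only [hv]
    rw [← Complex.ofReal_sub, Complex.norm_real, Real.norm_eq_abs]; exact hx i hi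
  set B := (K + e * 2 ^ N * (6 * (R' + a) / a) ^ N) / (R' - a) ^ (N + 1) with hB
  have hqb : ‖q z‖ ≤ B := by
    have hcl : closure (Metric.ball (c : ℂ) R') = Metric.closedBall (c : ℂ) R' :=
      closure_ball _ hR'0
    refine Complex.norm_le_of_forall_mem_frontier_norm_le (U := Metric.ball (c : ℂ) R')
      Metric.isBounded_ball ?_ ?_ ?_
    · refine DifferentiableOn.diffContOnCl ?_
      rw [hcl]
      exact hq1.mono (Metric.closedBall_subset_ball hR)
    · intro ζ hζ
      rw [frontier_ball _ hR'0, Metric.mem_sphere, Complex.dist_eq] at hζ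
      have hζR : ζ ∈ Metric.ball (c : ℂ) R := by
        rw [Metric.mem_ball, Complex.dist_eq]; linarith
      have h5 : (R' - a) ^ (N + 1) ≤ ‖∏ p ∈ s.image v, (ζ - p)‖ := by
        rw [hprod, norm_prod]
        calc (R' - a) ^ (N + 1) = ∏ i ∈ s, (R' - a) := by simp [hs]
          _ ≤ _ := by
            refine Finset.prod_le_prod (fun _ _ => hR'a.le) fun i hi => ?_
            have hi' : i ≤ N := by simp only [hs, Finset.mem_range] at hi; omega
            have h6 := norm_sub_norm_le (ζ - c) (v i - c)
            rw [sub_sub_sub_cancel_right] at h6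
            linarith [hnode i hi']
      have h7 : ‖∏ p ∈ s.image v, (ζ - p)‖ * ‖q ζ‖ ≤
          K + e * 2 ^ N * (6 * (R' + a) / a) ^ N := by
        rw [← norm_mul, ← hq2 ζ]
        exact (norm_sub_le _ _).trans (add_le_add (hK ζ hζR) (hPbound R' ζ hζ.le))
      rw [hB, le_div_iff₀ (by positivity), mul_comm]
      exact (mul_le_mul_of_nonneg_right h5 (norm_nonneg _)).trans h7
    · rw [hcl, Metric.mem_closedBall, Complex.dist_eq]; linarith
  have hωz : ‖∏ p ∈ s.image v, (z - p)‖ ≤ (2 * a) ^ (N + 1) := by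
    rw [hprod, norm_prod]
    calc _ ≤ ∏ i ∈ s, (2 * a) := by
          refine Finset.prod_le_prod (fun _ _ => norm_nonneg _) fun i hi => ?_
          have hi' : i ≤ N := by simp only [hs, Finset.mem_range] at hi; omega
          have h6 := norm_sub_le (z - c) (v i - c)
          rw [sub_sub_sub_cancel_right] at h6
          linarith [hnode i hi']
      _ = _ := by simp [hs]
  have hgz : g z = P.eval z + (∏ p ∈ s.image v, (z - p)) * q z := by
    rw [← hq2 z]; ring
  have h8 : 2 * a / (R' - a) ≤ 1 := by rw [div_le_one hR'a]; linarith
  -- On the large circle P may grow by the second factor to the power N, while dividing by the nodal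
  -- polynomial there and multiplying by it near c gains the first. The condition 3 a ≤ R' makes the
  -- product at most 24; with the factor 2^N from counting nodes this gives 48^N.
  have h9 : 2 * a / (R' - a) * (6 * (R' + a) / a) ≤ 24 := by
    rw [show 2 * a / (R' - a) * (6 * (R' + a) / a) = 12 * (R' + a) / (R' - a) by field_simp; ring,
      div_le_iff₀ hR'a]; linarith
  have hRa : 0 < R' + a := by linarith
  have h10 : (2 * a) ^ (N + 1) * B ≤ K * (2 * a / (R' - a)) ^ (N + 1) + e * 48 ^ N := by
    have : (2 * a) ^ (N + 1) * B = K * (2 * a / (R' - a)) ^ (N + 1) +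
        e * 2 ^ N * ((2 * a / (R' - a) * (6 * (R' + a) / a)) ^ N * (2 * a / (R' - a))) := by
      rw [hB, mul_pow (2 * a / (R' - a)), div_pow (2 * a), div_pow (2 * a)]
      rw [pow_succ, pow_succ]
      field_simp
    rw [this]
    refine add_le_add le_rfl ?_
    calc e * 2 ^ N * ((2 * a / (R' - a) * (6 * (R' + a) / a)) ^ N * (2 * a / (R' - a)))
        ≤ e * 2 ^ N * (24 ^ N * 1) := by gcongr
      _ = e * 48 ^ N := by
        rw [show (48 : ℝ) = 2 * 24 by norm_num, mul_pow]; ring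
  have h11 : ‖P.eval z‖ ≤ e * 48 ^ N := by
    refine (hPbound a z hz).trans ?_
    rw [show 6 * (a + a) / a = 12 by field_simp; norm_num, mul_assoc, ← mul_pow]
    gcongr; norm_num
  rw [hgz]
  calc _ ≤ ‖P.eval z‖ + ‖∏ p ∈ s.image v, (z - p)‖ * ‖q z‖ := by
        rw [← norm_mul]; exact norm_add_le _ _
    _ ≤ e * 48 ^ N + (2 * a) ^ (N + 1) * B := by gcongr
    _ ≤ _ := by linarith


/-- A bounded holomorphic family which is pointwise `O(ε²)` on a real interval is
`O(ε^(3/2))` uniformly on a complex neighbourhood of the centre. -/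
lemma exists_uniform_bound_of_pointwise {g : ℝ → ℂ → ℂ} {c R K ε₀ : ℝ} (hR : 0 < R) (hε₀ : 0 < ε₀)
    (hg : ∀ ε ∈ Set.Ioo 0 ε₀, DifferentiableOn ℂ (g ε) (Metric.ball (c : ℂ) R))
    (hK : ∀ ε ∈ Set.Ioo 0 ε₀, ∀ z ∈ Metric.ball (c : ℂ) R, ‖g ε z‖ ≤ K)
    (hpt : ∀ x : ℝ, |x - c| < R → ∃ C : ℝ, ∀ᶠ ε in 𝓝[>] (0 : ℝ), ‖g ε x‖ ≤ C * ε ^ 2) :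
    ∃ a C ε₁ : ℝ, 0 < a ∧ a < R ∧ 0 < ε₁ ∧ 0 ≤ C ∧ ∀ ε ∈ Set.Ioo 0 ε₁, ∀ z : ℂ, ‖z - c‖ ≤ a →
      ‖g ε z‖ ≤ C * (ε * √ε) := by
  have hK0 : 0 ≤ K := (norm_nonneg _).trans
    (hK (ε₀ / 2) ⟨by linarith, by linarith⟩ c (by simp [hR]))
  -- Chosen so that 2 a / (R / 2 - a) = 48⁻³ exactly.
  set a := R / 2 / (2 * 48 ^ 3 + 1) with ha
  have ha0 : 0 < a := by positivity
  have haR : R / 2 = (2 * 48 ^ 3 + 1) * a := by rw [ha]; field_simp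
  -- Egorov-type argument: the constant and the threshold of the pointwise bound depend on x, but
  -- the sets where both are governed by n increase to the whole interval of length 2 a. Hence one
  -- of them has measure above a, enough room for N + 1 nodes at spacing a / N.
  set S : ℕ → Set ℝ := fun n => {x | x ∈ Set.Icc (c - a) (c + a) ∧
    ∀ ε ∈ Set.Ioo 0 ε₀, ε < 1 / ((n : ℝ) + 1) → ‖g ε x‖ ≤ ((n : ℝ) + 1) * ε ^ 2} with hS
  have hmono : Monotone S := by
    intro n m hnm x hx
    have hnm' : (n : ℝ) ≤ m := by exact_mod_cast hnm
    refine ⟨hx.1, fun ε hε hε' => (hx.2 ε hε (hε'.trans_le ?_)).trans ?_⟩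
    · gcongr
    · gcongr
  have hunion : ⋃ n, S n = Set.Icc (c - a) (c + a) := by
    ext x
    simp only [Set.mem_iUnion]
    refine ⟨fun ⟨n, hn⟩ => hn.1, fun hx => ?_⟩
    obtain ⟨C, hC⟩ := hpt x (by rw [abs_lt]; constructor <;> linarith [hx.1, hx.2])
    rw [eventually_nhdsWithin_iff, Metric.eventually_nhds_iff] at hC
    obtain ⟨d, hd, hC⟩ := hC
    obtain ⟨n, hn⟩ := exists_nat_ge (max C (1 / d))
    refine ⟨n, hx, fun ε hε hεn => ?_⟩
    have h1 : C ≤ n := (le_max_left _ _).trans hn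
    have h2 : 1 / d ≤ n := (le_max_right _ _).trans hn
    have h3 : ε < d := by
      refine hεn.trans_le ?_
      rw [div_le_iff₀ (by positivity)]
      rw [div_le_iff₀ hd] at h2
      nlinarith
    refine (hC (by rw [Real.dist_eq, sub_zero, abs_of_pos hε.1]; exact h3) hε.1).trans ?_
    gcongr
    linarith
  have hlim : Tendsto (fun n => volume (S n)) atTop (𝓝 (volume (Set.Icc (c - a) (c + a)))) := by
    rw [← hunion]; exact tendsto_measure_iUnion_atTop hmono
  rw [Real.volume_Icc] at hlim
  obtain ⟨n, hn⟩ := (hlim.eventually (lt_mem_nhds (show ENNReal.ofReal a < _ from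
    (ENNReal.ofReal_lt_ofReal_iff (by linarith)).2 (by linarith)))).exists
  refine ⟨a, K + 2 * (n + 1), min ε₀ (min (1 / ((n : ℝ) + 1)) (1 / 48 ^ 2)), ha0, by linarith,
    by positivity, by positivity, ?_⟩
  intro ε hε z hz
  have hε0 : 0 < ε := hε.1
  have hε1 : ε < ε₀ := hε.2.trans_le (min_le_left _ _)
  have hε2 : ε < 1 / ((n : ℝ) + 1) := hε.2.trans_le ((min_le_right _ _).trans (min_le_left _ _))
  have hε3 : ε < 1 / 48 ^ 2 := hε.2.trans_le ((min_le_right _ _).trans (min_le_right _ _))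
  have hs0 : 0 < √ε := Real.sqrt_pos.2 hε0
  have hs1 : √ε < 1 / 48 := by
    rw [Real.sqrt_lt' (by norm_num)]; simpa using hε3
  have hss : √ε * √ε = ε := Real.mul_self_sqrt hε0.le
  -- With 48^N ≤ ε^(-1/2) < 48^(N+1), interpolation costs half a power of ε, so ε² becomes ε^(3/2),
  -- and the remainder 48^(-3(N+1)) is below ε^(3/2) as well.
  obtain ⟨N, hN1, hN2⟩ := exists_nat_pow_near (x := 1 / √ε) (y := 48)
    (by rw [le_div_iff₀ hs0]; linarith) (by norm_num)
  have hN : 1 ≤ N := by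
    by_contra hcon
    have : N = 0 := by omega
    subst this
    rw [div_lt_iff₀ hs0, zero_add, pow_one] at hN2
    linarith
  have hN' : (0 : ℝ) < N := by exact_mod_cast hN
  have hvol : ENNReal.ofReal (N * (a / N)) < volume (S n) := by
    rwa [mul_div_cancel₀ _ hN'.ne']
  obtain ⟨x, hx1, hx2⟩ := exists_separated_points (h := a / N) (by positivity) N (S n)
    ⟨c - a, fun y hy => hy.1.1⟩ hvol
  have hmain := norm_le_of_small_at_separated (g := g ε) (c := c) (a := a) (R := R) (R' := R / 2)
    (K := K) (e := ((n : ℝ) + 1) * ε ^ 2) hN ha0 (by linarith) (by linarith) (hg ε ⟨hε0, hε1⟩)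
    (hK ε ⟨hε0, hε1⟩) (x := x)
    (fun i hi => by
      have := (hx1 i hi).1
      rw [abs_le]; constructor <;> linarith [this.1, this.2]) hx2
    (fun i hi => (hx1 i hi).2 ε ⟨hε0, hε1⟩ hε2) z hz
  have hq : 2 * a / (R / 2 - a) = (1 / 48) ^ 3 := by
    rw [haR]; field_simp; norm_num
  rw [div_lt_iff₀ hs0] at hN2
  rw [le_div_iff₀ hs0] at hN1
  have h1 : ((1 / 48 : ℝ) ^ 3) ^ (N + 1) ≤ ε * √ε := by
    have h2 : (1 / 48 : ℝ) ^ (N + 1) ≤ √ε := by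
      rw [one_div_pow, div_le_iff₀ (by positivity)]; linarith
    calc ((1 / 48 : ℝ) ^ 3) ^ (N + 1) = ((1 / 48 : ℝ) ^ (N + 1)) ^ 3 := by
          rw [← pow_mul, ← pow_mul, mul_comm]
      _ ≤ √ε ^ 3 := by gcongr
      _ = _ := by rw [pow_succ, pow_two, hss]
  calc ‖g ε z‖ ≤ _ := hmain
    _ = K * ((1 / 48 : ℝ) ^ 3) ^ (N + 1) + 2 * (n + 1) * (ε * √ε) * (48 ^ N * √ε) := by
        rw [hq, show ε ^ 2 = (ε * √ε) * √ε by rw [mul_assoc, hss]; ring]; ring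
    _ ≤ K * (ε * √ε) + 2 * (n + 1) * (ε * √ε) * 1 := by gcongr
    _ = _ := by ring

/-- A bounded holomorphic family with pointwise second order expansions at the points of a real
interval converges at rate `O(ε)` on a complex neighbourhood of the centre. -/
theorem exists_holomorphic_limit {F : ℝ → ℂ → ℂ} {c R K ε₀ : ℝ} (hR : 0 < R) (hε₀ : 0 < ε₀)
    (hF : ∀ ε ∈ Set.Ioo 0 ε₀, DifferentiableOn ℂ (F ε) (Metric.ball (c : ℂ) R))
    (hK : ∀ ε ∈ Set.Ioo 0 ε₀, ∀ z ∈ Metric.ball (c : ℂ) R, ‖F ε z‖ ≤ K)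
    (hpt : ∀ x : ℝ, |x - c| < R → ∃ (b₀ b₁ : ℂ) (C : ℝ), ∀ᶠ ε : ℝ in 𝓝[>] (0 : ℝ),
      ‖F ε x - (b₀ + b₁ * ε)‖ ≤ C * ε ^ 2) :
    ∃ (a C ε₁ : ℝ) (F₀ : ℂ → ℂ), 0 < a ∧ a ≤ R ∧ 0 < ε₁ ∧ ε₁ ≤ ε₀ ∧
      DifferentiableOn ℂ F₀ (Metric.ball (c : ℂ) a) ∧
      ∀ ε ∈ Set.Ioo 0 ε₁, ∀ z ∈ Metric.ball (c : ℂ) a, ‖F ε z - F₀ z‖ ≤ C * ε := by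
  have hK0 : 0 ≤ K := (norm_nonneg _).trans
    (hK (ε₀ / 2) ⟨by linarith, by linarith⟩ c (by simp [hR]))
  -- The combination F_ε - 3 F_(ε/2) + 2 F_(ε/4) annihilates b₀ + b₁ ε, whatever the dependence of
  -- b₀ and b₁ on x. It is therefore pointwise O(ε²) and bounded by 6 K.
  obtain ⟨a, C, ε₁, ha, haR, hε₁, hC0, hC⟩ := exists_uniform_bound_of_pointwise
    (g := fun ε z => F ε z - 3 * F (ε / 2) z + 2 * F (ε / 4) z) (K := 6 * K) hR hε₀
    (fun ε hε => by
      have h1 := hF ε hε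
      have h2 := hF (ε / 2) ⟨by linarith [hε.1], by linarith [hε.1, hε.2]⟩
      have h3 := hF (ε / 4) ⟨by linarith [hε.1], by linarith [hε.1, hε.2]⟩
      fun_prop)
    (fun ε hε z hz => by
      have h1 := hK ε hε z hz
      have h2 := hK (ε / 2) ⟨by linarith [hε.1], by linarith [hε.1, hε.2]⟩ z hz
      have h3 := hK (ε / 4) ⟨by linarith [hε.1], by linarith [hε.1, hε.2]⟩ z hz
      calc _ ≤ ‖F ε z‖ + ‖3 * F (ε / 2) z‖ + ‖2 * F (ε / 4) z‖ :=
            (norm_add_le _ _).trans (add_le_add (norm_sub_le _ _) le_rfl)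
        _ ≤ _ := by rw [norm_mul, norm_mul, Complex.norm_ofNat, Complex.norm_ofNat]; linarith)
    (fun x hx => by
      obtain ⟨b₀, b₁, C, hC⟩ := hpt x hx
      have hdiv : ∀ d : ℝ, 1 ≤ d → Tendsto (fun ε : ℝ => ε / d) (𝓝[>] 0) (𝓝[>] 0) := by
        intro d hd
        refine tendsto_nhdsWithin_iff.2 ⟨?_, ?_⟩
        · have : Tendsto (fun ε : ℝ => ε / d) (𝓝 0) (𝓝 (0 / d)) := tendsto_id.div_const d
          rw [zero_div] at this
          exact this.mono_left nhdsWithin_le_nhds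
        · filter_upwards [self_mem_nhdsWithin] with ε hε
          exact div_pos (Set.mem_Ioi.1 hε) (lt_of_lt_of_le one_pos hd)
      refine ⟨C + 3 * C / 4 + C / 8, ?_⟩
      filter_upwards [hC, (hdiv 2 (by norm_num)).eventually hC,
        (hdiv 4 (by norm_num)).eventually hC] with ε h1 h2 h3
      have : F ε x - 3 * F (ε / 2) x + 2 * F (ε / 4) x = (F ε x - (b₀ + b₁ * ε))
          - 3 * (F (ε / 2) x - (b₀ + b₁ * ((ε / 2 : ℝ) : ℂ)))
          + 2 * (F (ε / 4) x - (b₀ + b₁ * ((ε / 4 : ℝ) : ℂ))) := by push_cast; ring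
      rw [this]
      refine ((norm_add_le _ _).trans (add_le_add (norm_sub_le _ _) le_rfl)).trans ?_
      rw [norm_mul, norm_mul, Complex.norm_ofNat, Complex.norm_ofNat]
      nlinarith)
  set ε₂ := min ε₀ ε₁ / 2 with hε₂
  have hm : 0 < min ε₀ ε₁ := lt_min hε₀ hε₁
  have hε₂0 : 0 < ε₂ := by positivity
  have hlt0 : ε₂ < ε₀ := by linarith [min_le_left ε₀ ε₁]
  have hlt1 : ε₂ < ε₁ := by linarith [min_le_right ε₀ ε₁]
  set B := 4 * K / ε₂ + 4 * C * √ε₂ with hB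
  have hball : ∀ z ∈ Metric.ball (c : ℂ) a, z ∈ Metric.ball (c : ℂ) R :=
    fun z hz => Metric.ball_subset_ball haR.le hz
  -- With D(δ) = F_δ - F_(δ/2), the combination at 2δ is D(2δ) - 2 D(δ). So D(δ)/δ changes by O(√δ)
  -- at each halving and stays bounded. The term -4 C √δ lets the induction close, because 3 √(2δ) ≥
  -- 4 √δ. Any exponent above 1 in place of 3/2 would serve equally.
  have hD : ∀ n : ℕ, ∀ δ : ℝ, ε₂ / 2 ^ (n + 1) < δ → δ ≤ ε₂ / 2 ^ n → ∀ z ∈ Metric.ball (c : ℂ) a,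
      ‖F δ z - F (δ / 2) z‖ ≤ δ * (B - 4 * C * √δ) := by
    intro n
    induction n with
    | zero =>
      intro δ h1 h2 z hz
      simp only [zero_add, pow_one, pow_zero, div_one] at h1 h2
      have hδ : 0 < δ := by linarith
      have h3 := hK δ ⟨hδ, by linarith⟩ z (hball z hz)
      have h4 := hK (δ / 2) ⟨by linarith, by linarith⟩ z (hball z hz)
      have h5 : √δ ≤ √ε₂ := Real.sqrt_le_sqrt h2
      have h6 : 2 * K ≤ δ * (4 * K / ε₂) := by
        rw [mul_div_assoc', le_div_iff₀ hε₂0]; nlinarith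
      calc _ ≤ 2 * K := (norm_sub_le _ _).trans (by linarith)
        _ ≤ δ * (4 * K / ε₂) := h6
        _ ≤ _ := by
          gcongr
          rw [hB]
          nlinarith
    | succ n ih =>
      intro δ h1 h2 z hz
      have hδ : 0 < δ := lt_trans (by positivity) h1
      have h3 := ih (2 * δ) (by rw [pow_succ, ← div_div] at h1; linarith)
        (by rw [pow_succ, ← div_div] at h2; linarith) z hz
      have h2' : δ ≤ ε₂ / 2 := by
        refine h2.trans ?_
        gcongr
        rw [pow_succ]
        have : (1 : ℝ) ≤ 2 ^ n := one_le_pow₀ (by norm_num)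
        linarith
      have h4 := hC (2 * δ) ⟨by linarith, by linarith⟩ z
        (by rw [← Complex.dist_eq]; exact (Metric.mem_ball.1 hz).le)
      simp only [show 2 * δ / 2 = δ by ring, show 2 * δ / 4 = δ / 2 by ring] at h3 h4
      have h5 : F δ z - F (δ / 2) z = (1 / 2 : ℂ) * ((F (2 * δ) z - F δ z) -
        (F (2 * δ) z - 3 * F δ z + 2 * F (δ / 2) z)) := by ring
      have h6 : 4 / 3 * √δ ≤ √(2 * δ) := by
        refine Real.le_sqrt_of_sq_le ?_
        rw [mul_pow, Real.sq_sqrt hδ.le]; linarith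
      rw [h5, norm_mul]
      have h7 : ‖(1 / 2 : ℂ)‖ = 1 / 2 := by norm_num
      rw [h7]
      have h8 := norm_sub_le (F (2 * δ) z - F δ z) (F (2 * δ) z - 3 * F δ z + 2 * F (δ / 2) z)
      have h9 : C * (4 / 3 * √δ) ≤ C * √(2 * δ) := by gcongr
      nlinarith [mul_le_mul_of_nonneg_left h9 hδ.le]
  have hD' : ∀ δ : ℝ, 0 < δ → δ ≤ ε₂ → ∀ z ∈ Metric.ball (c : ℂ) a,
      ‖F δ z - F (δ / 2) z‖ ≤ B * δ := by
    intro δ h1 h2 z hz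
    obtain ⟨n, hn1, hn2⟩ := exists_nat_pow_near (x := ε₂ / δ) (y := 2)
      ((one_le_div h1).2 h2) (by norm_num)
    refine (hD n δ ?_ ?_ z hz).trans ?_
    · rw [div_lt_iff₀ (by positivity)]; rw [div_lt_iff₀ h1] at hn2; linarith
    · rw [le_div_iff₀ (by positivity)]; rw [le_div_iff₀ h1] at hn1; linarith
    · have : 0 ≤ 4 * C * √δ := by positivity
      nlinarith
  have hB0 : 0 ≤ B := by positivity
  have hlim : ∀ ε : ℝ, 0 < ε → ε ≤ ε₂ → ∃ L : ℂ → ℂ, DifferentiableOn ℂ L (Metric.ball (c : ℂ) a) ∧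
      (∀ z ∈ Metric.ball (c : ℂ) a, ‖F ε z - L z‖ ≤ 2 * B * ε) ∧
      (∀ z ∈ Metric.ball (c : ℂ) a, Tendsto (fun n : ℕ => F (ε / 2 ^ n) z) atTop (𝓝 (L z))) := by
    intro ε h1 h2
    have hsmall : ∀ n : ℕ, 0 < ε / 2 ^ n ∧ ε / 2 ^ n ≤ ε₂ := by
      intro n
      refine ⟨by positivity, (div_le_self h1.le (one_le_pow₀ (by norm_num))).trans h2⟩
    have hstep : ∀ z ∈ Metric.ball (c : ℂ) a, ∀ n : ℕ,
        dist (F (ε / 2 ^ n) z) (F (ε / 2 ^ (n + 1)) z) ≤ 2 * B * ε / 2 / 2 ^ n := by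
      intro z hz n
      rw [pow_succ, ← div_div, Complex.dist_eq]
      refine (hD' _ (hsmall n).1 (hsmall n).2 z hz).trans (le_of_eq ?_)
      ring
    have hex : ∀ z : ℂ, ∃ l : ℂ, z ∈ Metric.ball (c : ℂ) a →
        Tendsto (fun n : ℕ => F (ε / 2 ^ n) z) atTop (𝓝 l) := by
      intro z
      by_cases hz : z ∈ Metric.ball (c : ℂ) a
      · obtain ⟨l, hl⟩ := cauchySeq_tendsto_of_complete (cauchySeq_of_le_geometric_two (hstep z hz))
        exact ⟨l, fun _ => hl⟩
      · exact ⟨0, fun h => absurd h hz⟩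
    choose L hL using hex
    have hbound : ∀ z ∈ Metric.ball (c : ℂ) a, ∀ n : ℕ,
        dist (F (ε / 2 ^ n) z) (L z) ≤ 2 * B * ε / 2 ^ n := fun z hz n =>
      dist_le_of_le_geometric_two_of_tendsto (hstep z hz) (hL z hz) n
    refine ⟨L, ?_, ?_, fun z hz => hL z hz⟩
    · have hunif : TendstoUniformlyOn (fun n : ℕ => F (ε / 2 ^ n)) L atTop
          (Metric.ball (c : ℂ) a) := by
        rw [Metric.tendstoUniformlyOn_iff]
        intro e he
        have ht : Tendsto (fun n : ℕ => 2 * B * ε * (1 / 2 : ℝ) ^ n) atTop (𝓝 (2 * B * ε * 0)) :=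
          (tendsto_pow_atTop_nhds_zero_of_lt_one (by norm_num) (by norm_num)).const_mul _
        rw [mul_zero] at ht
        filter_upwards [ht.eventually (gt_mem_nhds he)] with n hn z hz
        rw [dist_comm]
        refine (hbound z hz n).trans_lt ?_
        rwa [one_div_pow, mul_one_div] at hn
      refine hunif.tendstoLocallyUniformlyOn.differentiableOn (Eventually.of_forall fun n => ?_)
        Metric.isOpen_ball
      exact (hF _ ⟨(hsmall n).1, (hsmall n).2.trans_lt hlt0⟩).mono
        (Metric.ball_subset_ball haR.le)
    · intro z hz
      have := hbound z hz 0
      simpa [Complex.dist_eq] using this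
  obtain ⟨F₀, hF₀d, -, hF₀t⟩ := hlim ε₂ hε₂0 le_rfl
  have hreal : ∀ x : ℝ, |x - c| < R → ∃ b₀ : ℂ, Tendsto (fun ε : ℝ => F ε x) (𝓝[>] 0) (𝓝 b₀) := by
    intro x hx
    obtain ⟨b₀, b₁, C, hC⟩ := hpt x hx
    refine ⟨b₀, ?_⟩
    have h1 : Tendsto (fun ε : ℝ => F ε x - (b₀ + b₁ * ε)) (𝓝[>] 0) (𝓝 0) := by
      refine squeeze_zero_norm' hC ?_
      have : Tendsto (fun ε : ℝ => C * ε ^ 2) (𝓝 0) (𝓝 (C * 0 ^ 2)) := by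
        exact (Continuous.tendsto (by fun_prop) 0)
      simp only [ne_eq, OfNat.ofNat_ne_zero, not_false_eq_true, zero_pow, mul_zero] at this
      exact this.mono_left nhdsWithin_le_nhds
    have h2 : Tendsto (fun ε : ℝ => b₀ + b₁ * (ε : ℂ)) (𝓝[>] 0) (𝓝 b₀) := by
      have : Tendsto (fun ε : ℝ => b₀ + b₁ * (ε : ℂ)) (𝓝 0) (𝓝 (b₀ + b₁ * ((0 : ℝ) : ℂ))) :=
        Continuous.tendsto (by fun_prop) 0
      simp only [Complex.ofReal_zero, mul_zero, add_zero] at this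
      exact this.mono_left nhdsWithin_le_nhds
    simpa using h1.add h2
  have hdy : ∀ ε : ℝ, 0 < ε → Tendsto (fun n : ℕ => ε / 2 ^ n) atTop (𝓝[>] 0) := by
    intro ε hε
    refine tendsto_nhdsWithin_iff.2 ⟨?_, Eventually.of_forall fun n => by
      simp only [Set.mem_Ioi]; positivity⟩
    have ht : Tendsto (fun n : ℕ => ε * (1 / 2 : ℝ) ^ n) atTop (𝓝 (ε * 0)) :=
      (tendsto_pow_atTop_nhds_zero_of_lt_one (by norm_num) (by norm_num)).const_mul _
    simpa [one_div_pow, div_eq_mul_inv] using ht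
  refine ⟨a, 2 * B, ε₂, F₀, ha, haR.le, hε₂0, hlt0.le, hF₀d, ?_⟩
  intro ε hε z hz
  obtain ⟨L, hLd, hLb, hLt⟩ := hlim ε hε.1 hε.2.le
  -- A priori the limit along ε / 2^n depends on ε. At real points it does not, since the limit as ε
  -- ↓ 0 exists there, and the identity theorem spreads this over the ball.
  have hLF : Set.EqOn L F₀ (Metric.ball (c : ℂ) a) := by
    refine AnalyticOnNhd.eqOn_of_preconnected_of_frequently_eq (z₀ := (c : ℂ))
      (hLd.analyticOnNhd Metric.isOpen_ball) (hF₀d.analyticOnNhd Metric.isOpen_ball)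
      (convex_ball _ _).isPreconnected (by simp [ha]) ?_
    have hne : Tendsto (fun x : ℝ => ((c + x : ℝ) : ℂ)) (𝓝[>] 0) (𝓝[≠] (c : ℂ)) := by
      refine tendsto_nhdsWithin_iff.2 ⟨?_, ?_⟩
      · have : Tendsto (fun x : ℝ => ((c + x : ℝ) : ℂ)) (𝓝 0) (𝓝 ((c + 0 : ℝ) : ℂ)) :=
          Continuous.tendsto (by fun_prop) 0
        rw [add_zero] at this
        exact this.mono_left nhdsWithin_le_nhds
      · filter_upwards [self_mem_nhdsWithin] with x hx
        simp only [Set.mem_compl_iff, Set.mem_singleton_iff, Complex.ofReal_inj, add_eq_left]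
        exact (ne_of_gt hx)
    refine hne.frequently (Eventually.frequently ?_)
    filter_upwards [Ioo_mem_nhdsGT ha] with x hx
    have hxb : ((c + x : ℝ) : ℂ) ∈ Metric.ball (c : ℂ) a := by
      rw [Metric.mem_ball, Complex.dist_eq, ← Complex.ofReal_sub, Complex.norm_real, add_sub_cancel_left,
        Real.norm_eq_abs, abs_of_pos hx.1]
      exact hx.2
    obtain ⟨b₀, hb₀⟩ := hreal (c + x) (by
      rw [add_sub_cancel_left, abs_of_pos hx.1]; exact hx.2.trans haR)
    exact (tendsto_nhds_unique (hLt _ hxb) (hb₀.comp (hdy ε hε.1))).trans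
      (tendsto_nhds_unique (hF₀t _ hxb) (hb₀.comp (hdy ε₂ hε₂0))).symm
  rw [← hLF hz]
  exact hLb z hz

end

/-! ### Phragmén–Lindelöf bounds on narrow vertical strips -/

section

/-- One step of Borel-Carathéodory on a disc contained in a half-plane preimage. -/
lemma norm_le_of_re_le_on_ball {G : ℂ → ℂ} {c : ℂ} {r A : ℝ} (hr : 0 < r) (hA : 0 < A)
    (hG : DifferentiableOn ℂ G (Metric.ball c r)) (hre : ∀ z ∈ Metric.ball c r, (G z).re ≤ A)
    {z : ℂ} (hz : ‖z - c‖ ≤ r / 2) : ‖G z‖ + A ≤ 3 * (‖G c‖ + A) := by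
  have hmap : ∀ w ∈ Metric.ball (0 : ℂ) r, c + w ∈ Metric.ball c r := by
    intro w hw
    simpa [Complex.dist_eq] using hw
  have h := Complex.borelCaratheodory (f := fun w => G (c + w)) (z := z - c) hA
    (hG.comp (by fun_prop) hmap) (fun w hw => hre _ (hmap w hw)) hr
    (by simp only [Metric.mem_ball, dist_zero_right]; linarith)
  simp only [add_sub_cancel, add_zero] at h
  have hn := norm_nonneg (z - c)
  have hd : 0 < r - ‖z - c‖ := by linarith
  have h1 : 2 * A * ‖z - c‖ / (r - ‖z - c‖) ≤ 2 * A := by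
    rw [div_le_iff₀ hd]; nlinarith
  have h2 : ‖G c‖ * (r + ‖z - c‖) / (r - ‖z - c‖) ≤ 3 * ‖G c‖ := by
    rw [div_le_iff₀ hd]; nlinarith [norm_nonneg (G c)]
  linarith

/-- A holomorphic function on a vertical strip whose real part is bounded above grows at most
exponentially. -/
lemma exists_exp_growth {G : ℂ → ℂ} {u r A : ℝ} (hr : 0 < r)
    (hG : DifferentiableOn ℂ G {z : ℂ | |z.re - u| < r})
    (hre : ∀ z : ℂ, |z.re - u| < r → (G z).re ≤ A) :
    ∃ B c : ℝ, 0 < B ∧ 0 < c ∧ ∀ z : ℂ, |z.re - u| < r / 4 → ‖G z‖ ≤ B * Real.exp (c * |z.im|) := by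
  set A' := max A 1 with hA'
  have hA0 : 0 < A' := lt_of_lt_of_le one_pos (le_max_right _ _)
  have hball : ∀ q : ℝ, Metric.ball (⟨u, q⟩ : ℂ) r ⊆ {z : ℂ | |z.re - u| < r} := by
    intro q z hz
    rw [Metric.mem_ball, Complex.dist_eq] at hz
    have := Complex.abs_re_le_norm (z - ⟨u, q⟩)
    simp only [Complex.sub_re] at this
    exact lt_of_le_of_lt this hz
  have hstep : ∀ (q : ℝ) (z : ℂ), ‖z - ⟨u, q⟩‖ ≤ r / 2 →
      ‖G z‖ + A' ≤ 3 * (‖G ⟨u, q⟩‖ + A') := fun q z hz =>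
    norm_le_of_re_le_on_ball hr hA0 (hG.mono (hball q))
      (fun w hw => (hre w (hball q hw)).trans (le_max_left _ _)) hz
  have hnorm : ∀ x y : ℝ, ‖(⟨x, y⟩ : ℂ)‖ ≤ |x| + |y| := fun x y => Complex.norm_le_abs_re_add_abs_im _
  set B0 := ‖G ⟨u, 0⟩‖ + A' with hB0
  have hB0pos : 0 < B0 := by positivity
  -- Borel–Carathéodory is chained along the line Re z = u in steps of length r / 4, upwards or
  -- downwards according to σ. Each step multiplies ‖G‖ + A' by at most 3, whence the growth
  -- exponent log 3 / (r / 4).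
  have hind : ∀ (σ : ℝ), |σ| = 1 → ∀ n : ℕ, ‖G ⟨u, σ * (n * (r / 4))⟩‖ + A' ≤ 3 ^ n * B0 := by
    intro σ hσ n
    induction n with
    | zero => simp [hB0]
    | succ n ih =>
      have h1 := hstep (σ * (n * (r / 4))) ⟨u, σ * ((n + 1 : ℕ) * (r / 4))⟩ (by
        refine (Complex.norm_le_abs_re_add_abs_im _).trans ?_
        simp only [Complex.sub_re, Complex.sub_im, sub_self, abs_zero, zero_add]
        rw [← mul_sub, abs_mul, hσ, one_mul]
        push_cast
        rw [show ((n : ℝ) + 1) * (r / 4) - n * (r / 4) = r / 4 by ring, abs_of_pos (by linarith)]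
        linarith)
      rw [pow_succ]
      linarith
  refine ⟨3 * B0, Real.log 3 / (r / 4), by positivity,
    div_pos (Real.log_pos (by norm_num)) (by linarith), ?_⟩
  intro z hz
  obtain ⟨σ, hσ, hσz⟩ : ∃ σ : ℝ, |σ| = 1 ∧ z.im = σ * |z.im| := by
    rcases le_total 0 z.im with h | h
    · exact ⟨1, by simp, by rw [abs_of_nonneg h, one_mul]⟩
    · exact ⟨-1, by simp, by rw [abs_of_nonpos h]; ring⟩
  set n := ⌊|z.im| / (r / 4)⌋₊ with hn
  have hq : 0 ≤ |z.im| / (r / 4) := by positivity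
  have hn1 : (n : ℝ) ≤ |z.im| / (r / 4) := Nat.floor_le hq
  have hn2 : |z.im| / (r / 4) < n + 1 := Nat.lt_floor_add_one _
  rw [div_lt_iff₀ (by linarith)] at hn2
  have hn1' := hn1
  rw [le_div_iff₀ (by linarith)] at hn1'
  have h1 := hstep (σ * (n * (r / 4))) z (by
    refine (Complex.norm_le_abs_re_add_abs_im _).trans ?_
    simp only [Complex.sub_re, Complex.sub_im]
    have : |z.im - σ * (n * (r / 4))| ≤ r / 4 := by
      rw [hσz, ← mul_sub, abs_mul, hσ, one_mul, abs_of_nonneg (by linarith)]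
      linarith
    linarith)
  have h2 := hind σ hσ n
  have h3 : (3 : ℝ) ^ n ≤ Real.exp (Real.log 3 / (r / 4) * |z.im|) := by
    rw [← Real.rpow_natCast, Real.rpow_def_of_pos (by norm_num)]
    apply Real.exp_le_exp.2
    rw [div_mul_eq_mul_div, mul_div_assoc]
    exact mul_le_mul_of_nonneg_left hn1 (Real.log_nonneg (by norm_num))
  calc ‖G z‖ ≤ 3 * (3 ^ n * B0) := by linarith
    _ = 3 * B0 * 3 ^ n := by ring
    _ ≤ _ := by gcongr

/-- Phragmén-Lindelöf for `M * exp (-G / ε)` on narrow vertical strips, when `M` is bounded and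
`Re G` is bounded above on a larger strip. -/
theorem exists_strip_width {G : ℂ → ℂ} {u r A : ℝ} (hr : 0 < r)
    (hG : DifferentiableOn ℂ G {z : ℂ | |z.re - u| < r})
    (hre : ∀ z : ℂ, |z.re - u| < r → (G z).re ≤ A) :
    ∃ η₀ : ℝ, 0 < η₀ ∧ η₀ < r ∧ ∀ (η : ℝ), 0 < η → η ≤ η₀ → ∀ (M : ℂ → ℂ) (ε B K : ℝ), 0 < ε →
      DifferentiableOn ℂ M {z : ℂ | |z.re - u| < r} →
      (∀ z : ℂ, |z.re - u| ≤ η → ‖M z‖ ≤ B) →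
      (∀ z : ℂ, |z.re - u| = η → ‖M z * Complex.exp (-G z / ε)‖ ≤ K) →
      ∀ z : ℂ, |z.re - u| ≤ η → ‖M z * Complex.exp (-G z / ε)‖ ≤ K := by
  obtain ⟨B₁, c, hB₁, hc, hgrow⟩ := exists_exp_growth hr hG hre
  -- On a strip of width 2 η, Phragmén–Lindelöf tolerates growth exp (b exp (c |Im z|)) with c < π /
  -- (2 η); this follows from η ≤ 1 / c and 2 < π. The parameter ε enters b = B₁ / ε but not c, so
  -- the admissible width does not depend on ε. The bound r / 8 keeps the strip inside the region of
  -- `exists_exp_growth`.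
  refine ⟨min (r / 8) (1 / c), by positivity, ?_, ?_⟩
  · exact (min_le_left _ _).trans_lt (by linarith)
  intro η hη hη₀ M ε B K hε hM hB hK z hz
  have hη1 : η ≤ r / 8 := hη₀.trans (min_le_left _ _)
  have hη2 : η ≤ 1 / c := hη₀.trans (min_le_right _ _)
  have hsub : ∀ w : ℂ, w.re ∈ Set.Icc (u - η) (u + η) → |w.re - u| ≤ η := by
    intro w hw
    rw [abs_le]; constructor <;> linarith [hw.1, hw.2]
  have hf : DifferentiableOn ℂ (fun w => M w * Complex.exp (-G w / ε)) {z : ℂ | |z.re - u| < r} :=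
    hM.mul ((hG.neg.div_const _).cexp)
  refine PhragmenLindelof.vertical_strip (f := fun w => M w * Complex.exp (-G w / ε))
    (a := u - η) (b := u + η) ?_ ?_ ?_ ?_ ?_ ?_
  · refine DifferentiableOn.diffContOnCl ?_
    rw [Complex.closure_preimage_re, closure_Ioo (show u - η < u + η by linarith).ne]
    refine hf.mono ?_
    intro w hw
    have h1 := hsub w hw
    exact lt_of_le_of_lt h1 (by linarith)
  · refine ⟨c, ?_, B₁ / ε, ?_⟩
    · rw [lt_div_iff₀ (by linarith)]
      rw [le_div_iff₀ hc] at hη2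
      nlinarith [Real.pi_gt_three]
    · refine IsBigO.of_bound B ?_
      rw [eventually_inf_principal]
      refine Eventually.of_forall fun w hw => ?_
      have hw' := hsub w (Set.Ioo_subset_Icc_self hw)
      rw [norm_mul]
      refine mul_le_mul (hB w hw') ?_ (norm_nonneg _) ((norm_nonneg _).trans (hB w hw'))
      rw [Real.norm_of_nonneg (Real.exp_pos _).le, Complex.norm_exp]
      apply Real.exp_le_exp.2
      rw [Complex.div_ofReal_re, Complex.neg_re, div_mul_eq_mul_div]
      gcongr
      exact (neg_le_abs _).trans ((Complex.abs_re_le_norm _).trans (hgrow w (by linarith)))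
  · intro w hw
    exact hK w (by rw [hw, show u - η - u = -η by ring, abs_neg, abs_of_pos hη])
  · intro w hw
    exact hK w (by rw [hw, add_sub_cancel_left, abs_of_pos hη])
  · linarith [(abs_le.1 hz).1]
  · linarith [(abs_le.1 hz).2]

end

/-! ### Mellin–Fourier representation of option prices -/

section

open scoped FourierTransform

/-- The one-sided exponential with exponent `c` decaying at infinity, with a unit jump at zero. -/
def halfExp (c y : ℝ) : ℂ :=
  if c < 0 then (Set.Ioi (0 : ℝ)).indicator (fun y => Complex.exp (c * y)) y
  else -(Set.Iic (0 : ℝ)).indicator (fun y => Complex.exp (c * y)) y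

lemma integrable_halfExp {c : ℝ} (hc : c ≠ 0) : Integrable (halfExp c) := by
  unfold halfExp
  rcases lt_or_gt_of_ne hc with h | h
  · simp only [h, if_true]
    rw [integrable_indicator_iff measurableSet_Ioi]
    exact integrableOn_exp_mul_complex_Ioi (by simpa using h) 0
  · simp only [not_lt.2 h.le, if_false]
    refine Integrable.neg ?_
    rw [integrable_indicator_iff measurableSet_Iic]
    exact integrableOn_exp_mul_complex_Iic (by simpa using h) 0

/-- The half-line and the sign in `halfExp` are such that the jump at zero is +1 in both cases, so
one formula covers both. This is why the three positions of u relative to 0 and 1 lead to the same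
integrand. -/
lemma fourier_halfExp {c : ℝ} (hc : c ≠ 0) (ξ : ℝ) :
    𝓕 (halfExp c) ξ = 1 / (2 * Real.pi * ξ * Complex.I - c) := by
  rw [Real.fourier_real_eq_integral_exp_smul]
  have hre : (c - 2 * Real.pi * ξ * Complex.I : ℂ).re = c := by simp
  have hexp : ∀ y : ℝ, Complex.exp (((-2 * Real.pi * y * ξ : ℝ) : ℂ) * Complex.I) •
      Complex.exp (c * y) = Complex.exp ((c - 2 * Real.pi * ξ * Complex.I) * y) := by
    intro y
    rw [smul_eq_mul, ← Complex.exp_add]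
    congr 1; push_cast; ring
  have hne : (c - 2 * Real.pi * ξ * Complex.I : ℂ) ≠ 0 := by
    intro h; rw [h] at hre; exact hc hre.symm
  have hne' : (2 * Real.pi * ξ * Complex.I - c : ℂ) ≠ 0 := by
    rw [← neg_sub]; exact neg_ne_zero.2 hne
  have hind : ∀ s : Set ℝ, ∀ y : ℝ, Complex.exp (((-2 * Real.pi * y * ξ : ℝ) : ℂ) * Complex.I) •
      s.indicator (fun y : ℝ => Complex.exp (c * y)) y =
      s.indicator (fun y : ℝ => Complex.exp ((c - 2 * Real.pi * ξ * Complex.I) * y)) y := by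
    intro s y
    by_cases hy : y ∈ s
    · rw [Set.indicator_of_mem hy, Set.indicator_of_mem hy, hexp]
    · rw [Set.indicator_of_notMem hy, Set.indicator_of_notMem hy, smul_zero]
  unfold halfExp
  rcases lt_or_gt_of_ne hc with h | h
  · simp only [h, if_true, hind]
    rw [integral_indicator measurableSet_Ioi, integral_exp_mul_complex_Ioi (by rw [hre]; exact h)]
    simp only [Complex.ofReal_zero, mul_zero, Complex.exp_zero]
    rw [div_eq_div_iff hne hne']; ring
  · simp only [not_lt.2 h.le, if_false, smul_neg, hind]
    rw [integral_neg, integral_indicator measurableSet_Iic,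
      integral_exp_mul_complex_Iic (by rw [hre]; exact h)]
    simp only [Complex.ofReal_zero, mul_zero, Complex.exp_zero]
    rw [← neg_div, div_eq_div_iff hne hne']; ring

lemma min_mul_sqrt_le_norm (a : ℝ) (q : ℝ) :
    min |a| 1 * √(1 + q ^ 2) ≤ ‖(a + q * Complex.I : ℂ)‖ := by
  rw [Complex.norm_add_mul_I, ← abs_of_nonneg (show 0 ≤ min |a| 1 by positivity),
    ← Real.sqrt_sq_eq_abs, ← Real.sqrt_mul (sq_nonneg _)]
  apply Real.sqrt_le_sqrt
  have h1 : min |a| 1 ^ 2 ≤ a ^ 2 := by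
    rw [← sq_abs a]; gcongr; exact min_le_left _ _
  have h2 : min |a| 1 ^ 2 ≤ 1 := by
    have : min |a| 1 ≤ 1 := min_le_right _ _
    have h0 : 0 ≤ min |a| 1 := by positivity
    nlinarith
  nlinarith [sq_nonneg q]

lemma norm_inv_mul_sub_one_le {u : ℝ} (hu0 : u ≠ 0) (hu1 : u ≠ 1) :
    ∃ B : ℝ, 0 < B ∧ ∀ q : ℝ,
      ‖1 / ((u + q * Complex.I : ℂ) * (u + q * Complex.I - 1))‖ ≤ B * (1 + q ^ 2)⁻¹ := by
  have h0 : 0 < min |u| 1 := lt_min (abs_pos.2 hu0) one_pos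
  have h1 : 0 < min |u - 1| 1 := lt_min (abs_pos.2 (sub_ne_zero.2 hu1)) one_pos
  refine ⟨(min |u| 1 * min |u - 1| 1)⁻¹, by positivity, fun q => ?_⟩
  have h2 := min_mul_sqrt_le_norm u q
  have h3 := min_mul_sqrt_le_norm (u - 1) q
  rw [show ((u - 1 : ℝ) : ℂ) + q * Complex.I = u + q * Complex.I - 1 by push_cast; ring] at h3
  rw [norm_div, norm_one, norm_mul, one_div, ← mul_inv]
  apply inv_anti₀ (by positivity)
  calc min |u| 1 * min |u - 1| 1 * (1 + q ^ 2)
      = (min |u| 1 * √(1 + q ^ 2)) * (min |u - 1| 1 * √(1 + q ^ 2)) := by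
        rw [mul_mul_mul_comm, Real.mul_self_sqrt (by positivity)]
    _ ≤ _ := by gcongr

lemma add_mul_I_ne {u : ℝ} (hu0 : u ≠ 0) (hu1 : u ≠ 1) (q : ℝ) :
    (u + q * Complex.I : ℂ) ≠ 0 ∧ (u + q * Complex.I - 1 : ℂ) ≠ 0 := by
  constructor
  · intro h
    have := congrArg Complex.re h
    simp at this
    exact hu0 this
  · intro h
    have := congrArg Complex.re h
    simp at this
    exact hu1 (by linarith)

lemma integrable_inv_mul_sub_one {u : ℝ} (hu0 : u ≠ 0) (hu1 : u ≠ 1) :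
    Integrable (fun q : ℝ => 1 / ((u + q * Complex.I : ℂ) * (u + q * Complex.I - 1))) := by
  obtain ⟨B, -, hB⟩ := norm_inv_mul_sub_one_le hu0 hu1
  refine (integrable_inv_one_add_sq.const_mul B).mono' ?_ (Eventually.of_forall hB)
  refine Continuous.aestronglyMeasurable ?_
  refine Continuous.div (by fun_prop) (by fun_prop) fun q => ?_
  exact mul_ne_zero (add_mul_I_ne hu0 hu1 q).1 (add_mul_I_ne hu0 hu1 q).2

/-- The exponentially damped payoff of an out-of-the-money-type option with unit strike. -/
lemma halfExp_sub_halfExp {u : ℝ} (hu0 : u ≠ 0) (hu1 : u ≠ 1) (y : ℝ) :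
    halfExp (1 - u) y - halfExp (-u) y = ((Real.exp (-u * y) *
      (max (Real.exp y - 1) 0 - (if u < 1 then 1 else 0) * Real.exp y + (if u < 0 then 1 else 0)) :
        ℝ) : ℂ) := by
  have e1 : Complex.exp (((1 - u : ℝ) : ℂ) * y) = ((Real.exp (-u * y) * Real.exp y : ℝ) : ℂ) := by
    rw [← Real.exp_add, Complex.ofReal_exp]; congr 1; push_cast; ring
  have e2 : Complex.exp (((-u : ℝ) : ℂ) * y) = ((Real.exp (-u * y) : ℝ) : ℂ) := by
    rw [Complex.ofReal_exp]; congr 1; push_cast; ring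
  unfold halfExp
  rcases le_or_gt y 0 with hy | hy
  · have hmax : max (Real.exp y - 1) 0 = 0 :=
      max_eq_right (by linarith [Real.exp_le_one_iff.2 hy])
    have hm1 : y ∉ Set.Ioi (0 : ℝ) := by simp [hy]
    have hm2 : y ∈ Set.Iic (0 : ℝ) := hy
    rw [Set.indicator_of_notMem hm1, Set.indicator_of_mem hm2, Set.indicator_of_notMem hm1,
      Set.indicator_of_mem hm2, hmax, e1, e2]
    rcases lt_or_gt_of_ne hu0 with h0 | h0 <;> rcases lt_or_gt_of_ne hu1 with h1 | h1
    · rw [if_neg (by linarith), if_neg (by linarith), if_pos h1, if_pos h0]; push_cast; ring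
    · linarith
    · rw [if_neg (by linarith), if_pos (by linarith), if_pos h1, if_neg (by linarith)]
      push_cast; ring
    · rw [if_pos (by linarith), if_pos (by linarith), if_neg (by linarith), if_neg (by linarith)]
      push_cast; ring
  · have hmax : max (Real.exp y - 1) 0 = Real.exp y - 1 :=
      max_eq_left (by linarith [Real.one_le_exp hy.le])
    have hm1 : y ∈ Set.Ioi (0 : ℝ) := hy
    have hm2 : y ∉ Set.Iic (0 : ℝ) := by simp [hy]
    rw [Set.indicator_of_notMem hm2, Set.indicator_of_mem hm1, Set.indicator_of_notMem hm2,
      Set.indicator_of_mem hm1, hmax, e1, e2]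
    rcases lt_or_gt_of_ne hu0 with h0 | h0 <;> rcases lt_or_gt_of_ne hu1 with h1 | h1
    · rw [if_neg (by linarith), if_neg (by linarith), if_pos h1, if_pos h0]; push_cast; ring
    · linarith
    · rw [if_neg (by linarith), if_pos (by linarith), if_pos h1, if_neg (by linarith)]
      push_cast; ring
    · rw [if_pos (by linarith), if_pos (by linarith), if_neg (by linarith), if_neg (by linarith)]
      push_cast; ring

/-- Mellin-Fourier representation of the unit strike payoff along the line `Re z = u`. -/
lemma payoff_eq_integral {u : ℝ} (hu0 : u ≠ 0) (hu1 : u ≠ 1) (y : ℝ) :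
    ((max (Real.exp y - 1) 0 - (if u < 1 then 1 else 0) * Real.exp y + (if u < 0 then 1 else 0) :
      ℝ) : ℂ) = (1 / (2 * Real.pi) : ℝ) * ∫ q : ℝ, Complex.exp ((u + q * Complex.I) * y) *
        (1 / ((u + q * Complex.I : ℂ) * (u + q * Complex.I - 1))) := by
  set w : ℝ → ℂ := fun y => halfExp (1 - u) y - halfExp (-u) y with hw
  have i1 := integrable_halfExp (c := 1 - u) (sub_ne_zero.2 (Ne.symm hu1))
  have i2 := integrable_halfExp (c := -u) (neg_ne_zero.2 hu0)
  -- Pointwise Fourier inversion needs continuity; the unit jumps of the two half exponentials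
  -- cancel.
  have hcont : Continuous w := by
    rw [show w = fun y => ((Real.exp (-u * y) * (max (Real.exp y - 1) 0 -
      (if u < 1 then 1 else 0) * Real.exp y + (if u < 0 then 1 else 0)) : ℝ) : ℂ) from
      funext fun y => halfExp_sub_halfExp hu0 hu1 y]
    fun_prop
  -- This is 1 / (z - 1) - 1 / z = 1 / (z (z - 1)) at z = u + 2πiξ; the quadratic decay makes the
  -- transform integrable.
  have hF : 𝓕 w = fun ξ : ℝ => 1 / ((u + (2 * Real.pi * ξ : ℝ) * Complex.I : ℂ) *
      (u + (2 * Real.pi * ξ : ℝ) * Complex.I - 1)) := by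
    ext ξ
    have h1 : 𝓕 w ξ = 𝓕 (halfExp (1 - u)) ξ - 𝓕 (halfExp (-u)) ξ := by
      have : w = halfExp (1 - u) - halfExp (-u) := rfl
      rw [this, Real.fourier_real_eq_integral_exp_smul, Real.fourier_real_eq_integral_exp_smul,
        Real.fourier_real_eq_integral_exp_smul, ← integral_sub]
      · refine integral_congr_ae (Eventually.of_forall fun v => ?_)
        simp only [Pi.sub_apply, smul_sub]
      · have := (Real.fourierIntegral_convergent_iff ξ).2 i1
        refine this.congr (Eventually.of_forall fun v => ?_)
        simp only [Real.fourierChar_apply, Circle.smul_def, real_inner_eq_re_inner]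
        congr 3; simp; ring
      · have := (Real.fourierIntegral_convergent_iff ξ).2 i2
        refine this.congr (Eventually.of_forall fun v => ?_)
        simp only [Real.fourierChar_apply, Circle.smul_def]
        congr 3; simp; ring
    rw [h1, fourier_halfExp (sub_ne_zero.2 (Ne.symm hu1)), fourier_halfExp (neg_ne_zero.2 hu0)]
    obtain ⟨n1, n2⟩ := add_mul_I_ne hu0 hu1 (2 * Real.pi * ξ)
    push_cast at n1 n2 ⊢
    rw [show (2 * Real.pi * ξ * Complex.I - (1 - u) : ℂ) = u + 2 * Real.pi * ξ * Complex.I - 1 by ring,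
      show (2 * Real.pi * ξ * Complex.I - -u : ℂ) = u + 2 * Real.pi * ξ * Complex.I by ring]
    field_simp
    ring
  have h2pi : (2 * Real.pi : ℝ) ≠ 0 := by positivity
  have hFint : Integrable (𝓕 w) := by
    rw [hF]
    exact (integrable_inv_mul_sub_one hu0 hu1).comp_mul_left' h2pi
  have hinv := congrFun (hcont.fourierInv_fourier_eq (i1.sub i2) hFint) y
  rw [Real.fourierInv_eq', hF] at hinv
  have hwy : w y = _ := halfExp_sub_halfExp hu0 hu1 y
  rw [hwy] at hinv
  have hsub := Measure.integral_comp_mul_left (fun q : ℝ => Complex.exp ((u + q * Complex.I) * y) *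
        (1 / ((u + q * Complex.I : ℂ) * (u + q * Complex.I - 1)))) (2 * Real.pi)
  have hmul : ((Real.exp (u * y) : ℝ) : ℂ) * ((Real.exp (-u * y) : ℝ) : ℂ) = 1 := by
    rw [← Complex.ofReal_mul, ← Real.exp_add]; simp
  rw [Complex.ofReal_mul] at hinv
  calc _ = ((Real.exp (u * y) : ℝ) : ℂ) * (((Real.exp (-u * y) : ℝ) : ℂ) * _) := by
        rw [← mul_assoc, hmul, one_mul]
    _ = _ := by
        rw [← hinv, ← integral_const_mul]
        rw [abs_of_pos (by positivity), Complex.real_smul, inv_eq_one_div] at hsub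
        rw [← hsub]
        refine integral_congr_ae (Eventually.of_forall fun ξ => ?_)
        simp only [smul_eq_mul]
        rw [← mul_assoc, Complex.ofReal_exp, ← Complex.exp_add]
        congr 2
        simp only [RCLike.inner_apply, conj_trivial]
        push_cast; ring

variable {Ω : Type*} [MeasurableSpace Ω]

/-- Representation of option prices as an integral of the moment generating function. -/
theorem price_eq_integral {μ : Measure Ω} [IsProbabilityMeasure μ] {X : Ω → ℝ} (hX : Measurable X)
    (hmean : ∫ a, Real.exp (X a) ∂μ = 1) {u : ℝ} (hu0 : u ≠ 0) (hu1 : u ≠ 1)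
    (hint : Integrable (fun a => Real.exp (u * X a)) μ) (κ : ℝ) :
    ((∫ a, max (Real.exp (X a) - Real.exp κ) 0 ∂μ - (if u < 1 then 1 else 0)
      + (if u < 0 then 1 else 0) * Real.exp κ : ℝ) : ℂ) =
      (1 / (2 * Real.pi) : ℝ) * ∫ q : ℝ, Complex.exp (κ - (u + q * Complex.I) * κ) *
        complexMGF X μ (u + q * Complex.I) *
        (1 / ((u + q * Complex.I : ℂ) * (u + q * Complex.I - 1))) := by
  -- The integral of a non-integrable function is 0 by convention, so a mean equal to 1 forces
  -- integrability.
  have hiX : Integrable (fun a => Real.exp (X a)) μ := by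
    by_contra h
    rw [integral_undef h] at hmean
    exact zero_ne_one hmean
  have himax : Integrable (fun a => max (Real.exp (X a) - Real.exp κ) 0) μ := by
    refine hiX.mono' (by fun_prop) (Eventually.of_forall fun a => ?_)
    rw [Real.norm_of_nonneg (le_max_right _ _)]
    exact max_le (by linarith [Real.exp_pos κ]) (Real.exp_pos _).le
  have hpay : ∀ a, max (Real.exp (X a) - Real.exp κ) 0 - (if u < 1 then 1 else 0) * Real.exp (X a)
      + (if u < 0 then 1 else 0) * Real.exp κ = Real.exp κ * (max (Real.exp (X a - κ) - 1) 0 -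
        (if u < 1 then 1 else 0) * Real.exp (X a - κ) + (if u < 0 then 1 else 0)) := by
    intro a
    have h1 : Real.exp (X a) = Real.exp κ * Real.exp (X a - κ) := by
      rw [← Real.exp_add]; congr 1; ring
    have h2 : max (Real.exp (X a) - Real.exp κ) 0 = Real.exp κ * max (Real.exp (X a - κ) - 1) 0 := by
      rw [mul_max_of_nonneg _ _ (Real.exp_pos κ).le, mul_zero, h1]; congr 1; ring
    rw [h2, h1]; ring
  have hprice : ∫ a, max (Real.exp (X a) - Real.exp κ) 0 ∂μ - (if u < 1 then 1 else 0)
      + (if u < 0 then 1 else 0) * Real.exp κ = ∫ a, Real.exp κ * (max (Real.exp (X a - κ) - 1) 0 -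
        (if u < 1 then 1 else 0) * Real.exp (X a - κ) + (if u < 0 then 1 else 0)) ∂μ := by
    rw [← integral_congr_ae (Eventually.of_forall hpay), integral_add, integral_sub himax,
      integral_const_mul, hmean]
    · simp
    · exact hiX.const_mul _
    · exact himax.sub (hiX.const_mul _)
    · exact integrable_const _
  set f : Ω → ℝ → ℂ := fun a q => Complex.exp (κ - (u + q * Complex.I) * κ) *
    Complex.exp ((u + q * Complex.I) * X a) *
        (1 / ((u + q * Complex.I : ℂ) * (u + q * Complex.I - 1))) with hf
  -- On the line Re z = u the modulus factorises into a multiple of exp (u X) and the integrable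
  -- kernel 1 / |z (z - 1)|, so Fubini applies.
  have hfint : Integrable (Function.uncurry f) (μ.prod volume) := by
    have hI := (hint.const_mul (Real.exp (κ - u * κ))).mul_prod
      (integrable_inv_mul_sub_one hu0 hu1).norm
    refine hI.mono' ?_ (Eventually.of_forall fun p => ?_)
    · refine Measurable.aestronglyMeasurable ?_
      simp only [hf, Function.uncurry_def]
      fun_prop
    · simp only [hf, Function.uncurry_def, norm_mul, Complex.norm_exp]
      refine le_of_eq ?_
      congr 2
      · congr 1; simp
      · congr 1; simp
  have hswap := integral_integral_swap hfint
  rw [hprice, ← integral_complex_ofReal]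
  calc _ = ∫ a, ((1 / (2 * Real.pi) : ℝ) : ℂ) * (∫ q : ℝ, f a q) ∂μ := by
        refine integral_congr_ae (Eventually.of_forall fun a => ?_)
        simp only []
        rw [Complex.ofReal_mul, payoff_eq_integral hu0 hu1 (X a - κ), mul_left_comm,
          ← integral_const_mul]
        congr 1
        refine integral_congr_ae (Eventually.of_forall fun q => ?_)
        simp only [hf]
        rw [← mul_assoc, Complex.ofReal_exp, ← Complex.exp_add, ← Complex.exp_add]
        congr 2
        push_cast; ring
    _ = (1 / (2 * Real.pi) : ℝ) * ∫ q : ℝ, ∫ a, f a q ∂μ := by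
        rw [integral_const_mul, hswap]
    _ = _ := by
        congr 1
        refine integral_congr_ae (Eventually.of_forall fun q => ?_)
        simp only [hf, complexMGF]
        rw [integral_mul_const, integral_const_mul]

end

/-! ### Laplace expansion through a saddlepoint with a varying amplitude -/

section

open scoped Nat

lemma norm_iteratedDeriv_le {f : ℂ → ℂ} {c : ℂ} {r K : ℝ} (hr : 0 < r)
    (hf : DifferentiableOn ℂ f (Metric.ball c r)) (hK : ∀ z ∈ Metric.ball c r, ‖f z‖ ≤ K) (n : ℕ) :
    ‖iteratedDeriv n f c‖ ≤ n ! * K / (r / 2) ^ n := by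
  refine Complex.norm_iteratedDeriv_le_of_forall_mem_sphere_norm_le n (by linarith) ?_ ?_
  · refine DifferentiableOn.diffContOnCl ?_
    rw [closure_ball _ (by positivity)]
    exact hf.mono (Metric.closedBall_subset_ball (by linarith))
  · intro z hz
    exact hK z (Metric.sphere_subset_closedBall.trans
      (Metric.closedBall_subset_ball (by linarith)) hz)

lemma norm_taylorCoeff_le {f : ℂ → ℂ} {c : ℂ} {r K : ℝ} (hr : 0 < r)
    (hf : DifferentiableOn ℂ f (Metric.ball c r)) (hK : ∀ z ∈ Metric.ball c r, ‖f z‖ ≤ K) (n : ℕ) :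
    ‖iteratedDeriv n f c / (n !)‖ ≤ K * (2 / r) ^ n := by
  have h := norm_iteratedDeriv_le hr hf hK n
  have hn : (0 : ℝ) < n ! := by positivity
  rw [norm_div, Complex.norm_natCast, div_le_iff₀ hn]
  refine h.trans (le_of_eq ?_)
  rw [div_pow, div_pow]; field_simp

lemma norm_sub_taylor_le {f : ℂ → ℂ} {c : ℂ} {r K : ℝ} (hr : 0 < r)
    (hf : DifferentiableOn ℂ f (Metric.ball c r)) (hK : ∀ z ∈ Metric.ball c r, ‖f z‖ ≤ K) (n : ℕ)
    {z : ℂ} (hz : ‖z - c‖ ≤ r / 4) :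
    ‖f z - ∑ i ∈ Finset.range n, iteratedDeriv i f c / i ! * (z - c) ^ i‖
      ≤ 2 * K * (2 / r) ^ n * ‖z - c‖ ^ n := by
  have hK0 : 0 ≤ K := (norm_nonneg _).trans (hK c (by simp [hr]))
  have hzb : z ∈ Metric.ball c r := by rw [Metric.mem_ball, Complex.dist_eq]; linarith
  have hs := Complex.hasSum_taylorSeries_on_ball hf hzb
  have hterm : ∀ i : ℕ, (i ! : ℂ)⁻¹ • (z - c) ^ i • iteratedDeriv i f c =
      iteratedDeriv i f c / i ! * (z - c) ^ i := by
    intro i; simp only [smul_eq_mul]; field_simp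
  simp only [hterm] at hs
  have hs' := (hasSum_nat_add_iff' n).2 hs
  rw [← hs'.tsum_eq]
  set x := 2 / r * ‖z - c‖ with hx
  have hx0 : 0 ≤ x := by positivity
  have hx1 : x ≤ 1 / 2 := by
    rw [hx, div_mul_eq_mul_div, div_le_iff₀ hr]; linarith
  have hgeo : HasSum (fun i : ℕ => K * x ^ n * (1 / 2 : ℝ) ^ i) (K * x ^ n * 2) := by
    have := (hasSum_geometric_of_lt_one (r := (1 / 2 : ℝ)) (by norm_num) (by norm_num)).mul_left
      (K * x ^ n)
    norm_num at this ⊢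
    exact this
  refine (tsum_of_norm_bounded hgeo fun i => ?_).trans (le_of_eq ?_)
  · rw [norm_mul, norm_pow]
    calc _ ≤ K * (2 / r) ^ (i + n) * ‖z - c‖ ^ (i + n) := by
          gcongr; exact norm_taylorCoeff_le hr hf hK _
      _ = K * x ^ n * x ^ i := by rw [hx]; ring
      _ ≤ _ := by gcongr
  · rw [hx, mul_pow]; ring

/-- Third order Taylor formula with holomorphic remainder. -/
lemma exists_cubic_remainder {G : ℂ → ℂ} {c : ℂ} {r : ℝ} (hr : 0 < r)
    (hG : DifferentiableOn ℂ G (Metric.ball c r)) :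
    ∃ S : ℂ → ℂ, DifferentiableOn ℂ S (Metric.ball c r) ∧
      (∀ z, G z = G c + deriv G c * (z - c) + iteratedDeriv 2 G c / 2 * (z - c) ^ 2
        + (z - c) ^ 3 * S z) ∧
      S c = iteratedDeriv 3 G c / 6 ∧ deriv S c = iteratedDeriv 4 G c / 24 := by
  have hcb : c ∈ Metric.ball c r := by simp [hr]
  have hnhds : Metric.ball c r ∈ 𝓝 c := Metric.isOpen_ball.mem_nhds hcb
  have hdiff : ∀ f : ℂ → ℂ, DifferentiableOn ℂ f (Metric.ball c r) →
      DifferentiableOn ℂ (dslope f c) (Metric.ball c r) := fun f hf =>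
    (Complex.differentiableOn_dslope hnhds).2 hf
  -- The remainder S is the third iterated divided slope of G. Its power series is that of G shifted
  -- by three places, which gives both its value and its derivative at c.
  have hp := (hG.analyticAt hnhds).hasFPowerSeriesAt
  have hpn := fun n => hp.has_fpower_series_iterate_dslope_fslope n
  have hcoeff : ∀ n m, (FormalMultilinearSeries.fslope^[n] (FormalMultilinearSeries.ofScalars ℂ
      (fun n ↦ iteratedDeriv n G c / n !))).coeff m = iteratedDeriv (m + n) G c / (m + n)! := by
    intro n m
    rw [FormalMultilinearSeries.coeff_iterate_fslope, FormalMultilinearSeries.coeff_ofScalars]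
  have hval : ∀ n, ((Function.swap dslope c)^[n] G) c = iteratedDeriv n G c / n ! := by
    intro n
    have h := (hpn n).coeff_zero 1
    rw [← h]
    have := hcoeff n 0
    rw [zero_add] at this
    rw [← this, FormalMultilinearSeries.coeff]
  have hstep : ∀ f : ℂ → ℂ, ∀ z, f z = f c + (z - c) * dslope f c z := by
    intro f z
    have := sub_smul_dslope f c z
    rw [smul_eq_mul] at this
    rw [this]; ring
  refine ⟨(Function.swap dslope c)^[3] G, hdiff _ (hdiff _ (hdiff _ hG)), ?_, ?_, ?_⟩
  · intro z
    have h0 := hstep G z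
    have h1 := hstep ((Function.swap dslope c)^[1] G) z
    have h2 := hstep ((Function.swap dslope c)^[2] G) z
    rw [hval 1] at h1
    rw [hval 2] at h2
    simp only [Function.iterate_succ, Function.iterate_zero, Function.comp, id, Function.swap,
      iteratedDeriv_one] at h1 h2 ⊢
    rw [h0, h1, h2]
    norm_num [Nat.factorial]
    ring
  · rw [hval 3]; norm_num [Nat.factorial]
  · rw [(hpn 3).deriv]
    refine Eq.trans rfl ((hcoeff 3 1).trans ?_)
    norm_num [Nat.factorial]

lemma integrable_pow_mul_gaussian {b : ℝ} (hb : 0 < b) (n : ℕ) :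
    Integrable (fun q : ℝ => q ^ n * Real.exp (-b * q ^ 2)) := by
  have := integrable_rpow_mul_exp_neg_mul_sq hb (s := n)
    (by linarith [show (0 : ℝ) ≤ n from Nat.cast_nonneg n])
  simpa using this

lemma integral_pow_mul_gaussian_odd (b : ℝ) {n : ℕ} (hn : Odd n) :
    ∫ q : ℝ, q ^ n * Real.exp (-b * q ^ 2) = 0 := by
  have h := integral_neg_eq_self (fun q : ℝ => q ^ n * Real.exp (-b * q ^ 2)) volume
  simp only [hn.neg_pow, neg_sq, neg_mul, integral_neg] at h
  simp only [neg_mul]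
  linarith

lemma integral_pow_mul_gaussian_succ {b : ℝ} (hb : 0 < b) (n : ℕ) :
    ∫ q : ℝ, q ^ (n + 2) * Real.exp (-b * q ^ 2) =
      (n + 1) / (2 * b) * ∫ q : ℝ, q ^ n * Real.exp (-b * q ^ 2) := by
  have i0 := integrable_pow_mul_gaussian hb n
  have i2 := integrable_pow_mul_gaussian hb (n + 2)
  have h := integral_eq_zero_of_hasDerivAt_of_integrable
    (f := fun q : ℝ => q ^ (n + 1) * Real.exp (-b * q ^ 2))
    (f' := fun q : ℝ => (n + 1) * (q ^ n * Real.exp (-b * q ^ 2))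
      - 2 * b * (q ^ (n + 2) * Real.exp (-b * q ^ 2)))
    (fun q => by
      have h1 : HasDerivAt (fun q : ℝ => -b * q ^ 2) (-b * (2 * q)) q := by
        simpa using (hasDerivAt_pow 2 q).const_mul (-b)
      have h2 := (hasDerivAt_pow (n + 1) q).mul h1.exp
      refine h2.congr_deriv ?_
      push_cast
      ring)
    ((i0.const_mul _).sub (i2.const_mul _)) (integrable_pow_mul_gaussian hb (n + 1))
  rw [integral_sub (i0.const_mul _) (i2.const_mul _), integral_const_mul, integral_const_mul] at h
  rw [div_mul_eq_mul_div, eq_div_iff (by positivity)]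
  linarith

lemma integral_pow_mul_gaussian_zero (b : ℝ) :
    ∫ q : ℝ, q ^ 0 * Real.exp (-b * q ^ 2) = √(Real.pi / b) := by
  simpa using integral_gaussian b

lemma exists_integral_even_pow {a : ℝ} (ha : 0 < a) (n : ℕ) :
    ∃ C : ℝ, 0 ≤ C ∧ ∀ ε : ℝ, 0 < ε →
      ∫ q : ℝ, q ^ (2 * n) * Real.exp (-(a / (4 * ε)) * q ^ 2) = C * ε ^ n * √ε := by
  induction n with
  | zero =>
    refine ⟨√(4 * Real.pi / a), by positivity, fun ε hε => ?_⟩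
    rw [mul_zero, integral_pow_mul_gaussian_zero, pow_zero, mul_one, ← Real.sqrt_mul (by positivity)]
    congr 1; field_simp
  | succ n ih =>
    obtain ⟨C, hC, h⟩ := ih
    refine ⟨2 * (2 * n + 1) / a * C, by positivity, fun ε hε => ?_⟩
    rw [show 2 * (n + 1) = 2 * n + 2 by ring, integral_pow_mul_gaussian_succ (by positivity), h ε hε]
    push_cast
    field_simp
    ring

/-- The polynomial in the local variable approximating the non-Gaussian part of a saddlepoint
integrand. -/
def saddlePoly (b : ℕ → ℕ → ℂ) (ε q : ℝ) : ℂ :=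
  ∑ j ∈ Finset.range 4, ∑ i ∈ Finset.range (4 - j),
    b j i * (q * Complex.I) ^ (3 * j + i) / (ε : ℂ) ^ j

/-- At the Gaussian scale q ~ √ε, the term with indices j, i has order ε^((i+j)/2), and `saddlePoly`
keeps i + j ≤ 3. The odd moments vanish; only q^0, q^2, q^4, q^6 survive, so the formula is exact,
with 3 and 15 the Gaussian moments and the signs those of powers of the imaginary unit. -/
lemma integral_saddlePoly {a ε : ℝ} (ha : 0 < a) (hε : 0 < ε) (b : ℕ → ℕ → ℂ) :
    Integrable (fun q : ℝ => (Real.exp (-(a / (2 * ε)) * q ^ 2) : ℂ) * saddlePoly b ε q) ∧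
    ∫ q : ℝ, (Real.exp (-(a / (2 * ε)) * q ^ 2) : ℂ) * saddlePoly b ε q =
      (√(2 * Real.pi * ε / a) : ℝ) *
        (b 0 0 + ε * (-(b 0 2) / a + 3 * b 1 1 / a ^ 2 - 15 * b 2 0 / a ^ 3)) := by
  set β := a / (2 * ε) with hβ
  have hβ0 : 0 < β := by positivity
  have hterm : ∀ (q : ℝ) (j i : ℕ), (Real.exp (-β * q ^ 2) : ℂ) *
      (b j i * (q * Complex.I) ^ (3 * j + i) / (ε : ℂ) ^ j) =
      (b j i * Complex.I ^ (3 * j + i) / (ε : ℂ) ^ j) *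
        ((q ^ (3 * j + i) * Real.exp (-β * q ^ 2) : ℝ) : ℂ) := by
    intro q j i; push_cast; ring
  have hint : ∀ j i : ℕ, Integrable (fun q : ℝ => (b j i * Complex.I ^ (3 * j + i) / (ε : ℂ) ^ j) *
        ((q ^ (3 * j + i) * Real.exp (-β * q ^ 2) : ℝ) : ℂ)) := fun j i =>
    ((integrable_pow_mul_gaussian hβ0 _).ofReal).const_mul _
  have hfun : (fun q : ℝ => (Real.exp (-β * q ^ 2) : ℂ) * saddlePoly b ε q) = fun q =>
      ∑ j ∈ Finset.range 4, ∑ i ∈ Finset.range (4 - j),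
        (b j i * Complex.I ^ (3 * j + i) / (ε : ℂ) ^ j) *
        ((q ^ (3 * j + i) * Real.exp (-β * q ^ 2) : ℝ) : ℂ) := by
    ext q
    simp only [saddlePoly, Finset.mul_sum, hterm]
  rw [hfun]
  refine ⟨integrable_finsetSum _ fun j _ => integrable_finsetSum _ fun i _ => hint j i, ?_⟩
  rw [integral_finsetSum _ fun j _ => integrable_finsetSum _ fun i _ => hint j i]
  simp only [integral_finsetSum _ fun i _ => hint _ i, integral_const_mul, integral_complex_ofReal]
  have m0 := integral_pow_mul_gaussian_zero β
  have m2 := integral_pow_mul_gaussian_succ hβ0 0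
  have m4 := integral_pow_mul_gaussian_succ hβ0 2
  have m6 := integral_pow_mul_gaussian_succ hβ0 4
  have m1 := integral_pow_mul_gaussian_odd β (n := 1) (by decide)
  have m3 := integral_pow_mul_gaussian_odd β (n := 3) (by decide)
  have m5 := integral_pow_mul_gaussian_odd β (n := 5) (by decide)
  have m7 := integral_pow_mul_gaussian_odd β (n := 7) (by decide)
  have m9 := integral_pow_mul_gaussian_odd β (n := 9) (by decide)
  simp only [zero_add, Nat.reduceAdd, Nat.cast_zero, Nat.cast_ofNat] at m2 m4 m6
  rw [m0] at m2
  rw [m2] at m4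
  rw [m4] at m6
  have hr : √(Real.pi / β) = √(2 * Real.pi * ε / a) := by
    congr 1; rw [hβ]; field_simp
  have I3 : Complex.I ^ 3 = -Complex.I := by rw [pow_succ, Complex.I_sq]; ring
  have I4 : Complex.I ^ 4 = 1 := Complex.I_pow_four
  have I6 : Complex.I ^ 6 = -1 := by rw [show 6 = 4 + 2 by norm_num, pow_add, I4, Complex.I_sq]; ring
  simp only [Finset.sum_range_succ, Finset.sum_range_zero, Nat.reduceSub, Nat.reduceMul,
    Nat.reduceAdd, mul_zero, zero_add, m0, m1, m3, m5, m7, m9, m2, m4, m6, I4, I6, Complex.I_sq,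
    Complex.ofReal_zero, add_zero]
  have ha' : (a : ℂ) ≠ 0 := by exact_mod_cast ha.ne'
  have hε' : (ε : ℂ) ≠ 0 := by exact_mod_cast hε.ne'
  rw [hr]
  rw [hβ]
  push_cast
  field_simp
  ring

/-- The Gaussian-type majorant of the remainder of a saddlepoint integrand. -/
def saddleMajorant (ε q : ℝ) : ℝ := ∑ j ∈ Finset.range 5, q ^ (2 * (j + 2)) / ε ^ j

lemma saddleMajorant_nonneg {ε : ℝ} (hε : 0 < ε) (q : ℝ) : 0 ≤ saddleMajorant ε q :=
  Finset.sum_nonneg fun j _ => div_nonneg (by rw [pow_mul]; positivity) (by positivity)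

/-- Every term of the majorant has order ε² at the scale q ~ √ε. The exponent a / (4ε) is half the
true Gaussian exponent a / (2ε): the other half is spent on the exponential of the cubic remainder.
-/
lemma integral_saddleMajorant {a : ℝ} (ha : 0 < a) :
    ∃ C : ℝ, 0 ≤ C ∧ ∀ ε : ℝ, 0 < ε →
      Integrable (fun q : ℝ => saddleMajorant ε q * Real.exp (-(a / (4 * ε)) * q ^ 2)) ∧
      ∫ q : ℝ, saddleMajorant ε q * Real.exp (-(a / (4 * ε)) * q ^ 2) = C * (ε ^ 2 * √ε) := by
  choose C hC0 hC using fun n => exists_integral_even_pow ha n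
  refine ⟨∑ j ∈ Finset.range 5, C (j + 2), Finset.sum_nonneg fun j _ => hC0 _, fun ε hε => ?_⟩
  have hb : 0 < a / (4 * ε) := by positivity
  have hint : ∀ j : ℕ, Integrable (fun q : ℝ => (ε ^ j)⁻¹ *
      (q ^ (2 * (j + 2)) * Real.exp (-(a / (4 * ε)) * q ^ 2))) := fun j =>
    (integrable_pow_mul_gaussian hb _).const_mul _
  have hfun : (fun q : ℝ => saddleMajorant ε q * Real.exp (-(a / (4 * ε)) * q ^ 2)) = fun q =>
      ∑ j ∈ Finset.range 5, (ε ^ j)⁻¹ *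
      (q ^ (2 * (j + 2)) * Real.exp (-(a / (4 * ε)) * q ^ 2)) := by
    ext q
    rw [saddleMajorant, Finset.sum_mul]
    refine Finset.sum_congr rfl fun j _ => ?_
    rw [div_eq_inv_mul]; ring
  rw [hfun]
  refine ⟨integrable_finsetSum _ fun j _ => hint j, ?_⟩
  rw [integral_finsetSum _ fun j _ => hint j, Finset.sum_mul]
  refine Finset.sum_congr rfl fun j _ => ?_
  rw [integral_const_mul, hC _ ε hε, pow_add]
  field_simp

/-- Away from the saddle, multiplying by (|q| / η)^(4-j-i) ≥ 1 raises each power 3j + i to 2j + 4.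
The majorant of the local error thus also covers the tails of the Gaussian integral, and no separate
tail estimate is needed. -/
lemma norm_saddlePoly_le {b : ℕ → ℕ → ℂ} {K η ε q : ℝ} (hK : ∀ j < 4, ∀ i < 4, ‖b j i‖ ≤ K) (hη : 0 < η)
    (hη1 : η ≤ 1) (hε : 0 < ε) (hq : η ≤ |q|) :
    ‖saddlePoly b ε q‖ ≤ 4 * K / η ^ 4 * saddleMajorant ε q := by
  have hK0 : 0 ≤ K := (norm_nonneg _).trans (hK 0 (by norm_num) 0 (by norm_num))
  have hq0 : 0 < |q| := hη.trans_le hq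
  have hterm : ∀ j ∈ Finset.range 4, ∑ i ∈ Finset.range (4 - j),
      ‖b j i * (q * Complex.I) ^ (3 * j + i) / (ε : ℂ) ^ j‖ ≤
        4 * (K / η ^ 4 * (q ^ (2 * (j + 2)) / ε ^ j)) := by
    intro j hj
    have hj := Finset.mem_range.1 hj
    calc _ ≤ ∑ i ∈ Finset.range (4 - j), K / η ^ 4 * (q ^ (2 * (j + 2)) / ε ^ j) := by
          refine Finset.sum_le_sum fun i hi => ?_
          have hi := Finset.mem_range.1 hi
          rw [norm_div, norm_mul, norm_pow, norm_pow, norm_mul, Complex.norm_I, mul_one,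
            Complex.norm_real, Complex.norm_real, Real.norm_eq_abs, Real.norm_eq_abs, abs_of_pos hε]
          have h1 : |q| ^ (3 * j + i) ≤ q ^ (2 * (j + 2)) / η ^ 4 := by
            rw [le_div_iff₀ (by positivity), ← (Even.pow_abs (by simp) q : |q| ^ (2 * (j + 2)) = _)]
            calc |q| ^ (3 * j + i) * η ^ 4 ≤ |q| ^ (3 * j + i) * η ^ (4 - j - i) := by
                  gcongr ?_ * ?_
                  exact pow_le_pow_of_le_one hη.le hη1 (by omega)
              _ ≤ |q| ^ (3 * j + i) * |q| ^ (4 - j - i) := by gcongr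
              _ = |q| ^ (2 * (j + 2)) := by rw [← pow_add]; congr 1; omega
          calc ‖b j i‖ * |q| ^ (3 * j + i) / ε ^ j
              ≤ K * (q ^ (2 * (j + 2)) / η ^ 4) / ε ^ j := by
                gcongr
                exact hK j hj i (by omega)
            _ = _ := by ring
      _ = (4 - j : ℕ) * (K / η ^ 4 * (q ^ (2 * (j + 2)) / ε ^ j)) := by simp
      _ ≤ _ := by
          have : ((4 - j : ℕ) : ℝ) ≤ 4 := by exact_mod_cast Nat.sub_le 4 j
          gcongr
          rw [pow_mul]; positivity
  calc ‖saddlePoly b ε q‖ ≤ ∑ j ∈ Finset.range 4, ∑ i ∈ Finset.range (4 - j),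
      ‖b j i * (q * Complex.I) ^ (3 * j + i) / (ε : ℂ) ^ j‖ :=
        norm_sum_le_of_le _ fun j _ => norm_sum_le _ _
    _ ≤ ∑ j ∈ Finset.range 4, 4 * (K / η ^ 4 * (q ^ (2 * (j + 2)) / ε ^ j)) := Finset.sum_le_sum hterm
    _ ≤ ∑ j ∈ Finset.range 5, 4 * (K / η ^ 4 * (q ^ (2 * (j + 2)) / ε ^ j)) := by
        refine Finset.sum_le_sum_of_subset_of_nonneg (by simp) fun j _ _ => ?_
        rw [pow_mul]; positivity
    _ = _ := by rw [saddleMajorant, Finset.mul_sum]; refine Finset.sum_congr rfl fun j _ => ?_; ring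

/-- Pointwise approximation of the exponential factor of a saddlepoint integrand. -/
lemma norm_exp_mul_sub_saddlePoly_le {T s A : ℂ} {b : ℕ → ℕ → ℂ} {q ε K K₁ Q a : ℝ} (hε : 0 < ε)
    (hQ0 : 0 ≤ Q)
    (hT : T = (q * Complex.I) ^ 3 * s / ε) (hs : ‖s‖ ≤ K₁) (hA : ‖A‖ ≤ K)
    (hTa : ‖T‖ ≤ a / (4 * ε) * q ^ 2)
    (hb : ∀ j < 4, ‖s ^ j * A / (j ! : ℂ) -
      ∑ i ∈ Finset.range (4 - j), b j i * (q * Complex.I) ^ i‖ ≤ Q * |q| ^ (4 - j)) :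
    ‖Complex.exp T * A - saddlePoly b ε q‖ ≤
      (K₁ ^ 4 * K + Q) * saddleMajorant ε q * Real.exp (a / (4 * ε) * q ^ 2) := by
  have hK0 : 0 ≤ K := (norm_nonneg _).trans hA
  have hw : ‖(q * Complex.I : ℂ)‖ = |q| := by simp
  have hTn : ‖T‖ ≤ K₁ * |q| ^ 3 / ε := by
    rw [hT, norm_div, norm_mul, norm_pow, hw, Complex.norm_real, Real.norm_of_nonneg hε.le]
    rw [mul_comm K₁]
    gcongr
  have habs : ∀ j : ℕ, |q| ^ (2 * (j + 2)) = q ^ (2 * (j + 2)) := fun j => Even.pow_abs (by simp) q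
  -- Two truncations: the exponential series after four terms, with error |T|^4 e^|T|, and the
  -- Taylor series of each s^j A / j! at order 4 - j.
  have hdecomp : Complex.exp T * A - saddlePoly b ε q =
      (Complex.exp T - ∑ m ∈ Finset.range 4, T ^ m / m !) * A +
      ∑ j ∈ Finset.range 4, ((q * Complex.I) ^ 3 / ε) ^ j * (s ^ j * A / (j ! : ℂ) -
        ∑ i ∈ Finset.range (4 - j), b j i * (q * Complex.I) ^ i) := by
    have h1 : ∀ j ∈ Finset.range 4, ((q * Complex.I) ^ 3 / ε : ℂ) ^ j * (s ^ j * A / (j ! : ℂ) -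
        ∑ i ∈ Finset.range (4 - j), b j i * (q * Complex.I) ^ i) = T ^ j / j ! * A -
        ∑ i ∈ Finset.range (4 - j), b j i * (q * Complex.I) ^ (3 * j + i) / (ε : ℂ) ^ j := by
      intro j _
      rw [mul_sub, Finset.mul_sum]
      congr 1
      · rw [hT, div_pow, div_pow, mul_pow]; ring
      · refine Finset.sum_congr rfl fun i _ => ?_
        rw [div_pow, ← pow_mul, pow_add]; ring
    rw [Finset.sum_congr rfl h1, Finset.sum_sub_distrib, ← Finset.sum_mul, saddlePoly]
    ring
  have hexp1 : 1 ≤ Real.exp (a / (4 * ε) * q ^ 2) :=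
    Real.one_le_exp ((norm_nonneg _).trans hTa)
  have hmaj4 : q ^ 12 / ε ^ 4 ≤ saddleMajorant ε q := by
    refine Finset.single_le_sum (f := fun j : ℕ => q ^ (2 * (j + 2)) / ε ^ j) (fun j _ => ?_)
      (Finset.mem_range.2 (show 4 < 5 by norm_num))
    rw [pow_mul]; positivity
  have hfirst : ‖(Complex.exp T - ∑ m ∈ Finset.range 4, T ^ m / m !) * A‖ ≤
      K₁ ^ 4 * K * saddleMajorant ε q * Real.exp (a / (4 * ε) * q ^ 2) := by
    rw [norm_mul]
    calc _ ≤ (‖T‖ ^ 4 * Real.exp ‖T‖) * K := by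
          gcongr
          exact Complex.norm_exp_sub_sum_le_norm_mul_exp T 4
      _ ≤ ((K₁ * |q| ^ 3 / ε) ^ 4 * Real.exp (a / (4 * ε) * q ^ 2)) * K := by gcongr
      _ = K₁ ^ 4 * K * (q ^ 12 / ε ^ 4) * Real.exp (a / (4 * ε) * q ^ 2) := by
          rw [← habs 4]; ring
      _ ≤ _ := by gcongr
  have hsecond : ‖∑ j ∈ Finset.range 4, ((q * Complex.I) ^ 3 / ε : ℂ) ^ j * (s ^ j * A / (j ! : ℂ) -
        ∑ i ∈ Finset.range (4 - j), b j i * (q * Complex.I) ^ i)‖ ≤ Q * saddleMajorant ε q := by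
    calc _ ≤ ∑ j ∈ Finset.range 4, Q * (q ^ (2 * (j + 2)) / ε ^ j) := by
          refine norm_sum_le_of_le _ fun j hj => ?_
          have hj := Finset.mem_range.1 hj
          rw [norm_mul, norm_pow, norm_div, norm_pow, hw, Complex.norm_real,
            Real.norm_of_nonneg hε.le]
          calc _ ≤ (|q| ^ 3 / ε) ^ j * (Q * |q| ^ (4 - j)) := by
                gcongr; exact hb j hj
            _ = Q * (|q| ^ (3 * j + (4 - j)) / ε ^ j) := by rw [div_pow, ← pow_mul, pow_add]; ring
            _ = _ := by rw [← habs j, show 3 * j + (4 - j) = 2 * (j + 2) by omega]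
      _ ≤ ∑ j ∈ Finset.range 5, Q * (q ^ (2 * (j + 2)) / ε ^ j) := by
          refine Finset.sum_le_sum_of_subset_of_nonneg (by simp) fun j _ _ => ?_
          rw [pow_mul]; positivity
      _ = _ := by rw [saddleMajorant, Finset.mul_sum]
  rw [hdecomp]
  have hm := saddleMajorant_nonneg hε q
  calc _ ≤ K₁ ^ 4 * K * saddleMajorant ε q * Real.exp (a / (4 * ε) * q ^ 2) +
        Q * saddleMajorant ε q := (norm_add_le _ _).trans (add_le_add hfirst hsecond)
    _ ≤ K₁ ^ 4 * K * saddleMajorant ε q * Real.exp (a / (4 * ε) * q ^ 2) +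
        Q * saddleMajorant ε q * Real.exp (a / (4 * ε) * q ^ 2) := by
        have := le_mul_of_one_le_right (mul_nonneg hQ0 hm) hexp1
        linarith
    _ = _ := by ring

/-- Second order Laplace expansion along a vertical segment through a saddlepoint, for amplitudes
depending on the small parameter. -/
theorem laplace_expansion {G : ℂ → ℂ} {u r k a K C₀ ε₀ : ℝ} {α : ℝ → ℂ → ℂ} {α₀ : ℂ → ℂ}
    (hr : 0 < r) (ha : 0 < a) (hε₀ : 0 < ε₀)
    (hG : DifferentiableOn ℂ G (Metric.ball (u : ℂ) r)) (hG1 : deriv G u = k)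
    (hG2 : iteratedDeriv 2 G u = a)
    (hα : ∀ ε ∈ Set.Ioo 0 ε₀, DifferentiableOn ℂ (α ε) (Metric.ball (u : ℂ) r))
    (hα₀ : DifferentiableOn ℂ α₀ (Metric.ball (u : ℂ) r))
    (hK : ∀ ε ∈ Set.Ioo 0 ε₀, ∀ z ∈ Metric.ball (u : ℂ) r, ‖α ε z‖ ≤ K)
    (hC₀ : ∀ ε ∈ Set.Ioo 0 ε₀, ∀ z ∈ Metric.ball (u : ℂ) r, ‖α ε z - α₀ z‖ ≤ C₀ * ε) :
    ∃ η C : ℝ, 0 < η ∧ η < r ∧ ∀ ε ∈ Set.Ioo 0 ε₀,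
      ‖(∫ q in (-η)..η, Complex.exp ((G (u + q * Complex.I) - G u - k * (q * Complex.I)) / ε) *
          α ε (u + q * Complex.I)) -
        (√(2 * Real.pi * ε / a) : ℝ) * (α ε u + ε * (-(iteratedDeriv 2 α₀ u) / (2 * a)
          + 3 * (iteratedDeriv 4 G u / 24 * α₀ u + iteratedDeriv 3 G u / 6 * deriv α₀ u) / a ^ 2
          - 15 * (iteratedDeriv 3 G u) ^ 2 / 72 * α₀ u / a ^ 3))‖ ≤ C * (ε ^ 2 * √ε) := by
  obtain ⟨S, hS, hGS, hS0, hS1⟩ := exists_cubic_remainder hr hG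
  -- The bound r₁ ≤ 1 makes 2 / r₁ ≥ 1, so its fourth power dominates the lower ones; K₁ ≥ 1 below
  -- plays the same role for the powers of S.
  set r₁ := min (r / 2) 1 with hr₁
  have hr₁0 : 0 < r₁ := lt_min (by linarith) one_pos
  have hr₁r : r₁ < r := (min_le_left _ _).trans_lt (by linarith)
  have hr₁1 : r₁ ≤ 1 := min_le_right _ _
  have hsub : Metric.ball (u : ℂ) r₁ ⊆ Metric.ball (u : ℂ) r := Metric.ball_subset_ball hr₁r.le
  obtain ⟨K₁, hK₁1, hK₁⟩ : ∃ K₁ : ℝ, 1 ≤ K₁ ∧ ∀ z ∈ Metric.ball (u : ℂ) r₁, ‖S z‖ ≤ K₁ := by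
    obtain ⟨B, hB⟩ := (isCompact_closedBall (u : ℂ) r₁).exists_bound_of_continuousOn
      (hS.continuousOn.mono (Metric.closedBall_subset_ball hr₁r))
    exact ⟨max B 1, le_max_right _ _, fun z hz =>
      (hB z (Metric.ball_subset_closedBall hz)).trans (le_max_left _ _)⟩
  have hK0 : 0 ≤ K := (norm_nonneg _).trans
    (hK (ε₀ / 2) ⟨by linarith, by linarith⟩ u (by simp [hr]))
  have hC₀0 : 0 ≤ C₀ := by
    have := (norm_nonneg _).trans
      (hC₀ (ε₀ / 2) ⟨by linarith, by linarith⟩ u (by simp [hr]))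
    exact nonneg_of_mul_nonneg_left this (by linarith)
  set B : (ℂ → ℂ) → ℕ → ℂ → ℂ := fun A j z => S z ^ j * A z / (j ! : ℂ) with hB
  set b : (ℂ → ℂ) → ℕ → ℕ → ℂ := fun A j i => iteratedDeriv i (B A j) u / (i ! : ℂ) with hb
  have hBd : ∀ A : ℂ → ℂ, DifferentiableOn ℂ A (Metric.ball (u : ℂ) r) → ∀ j,
      DifferentiableOn ℂ (B A j) (Metric.ball (u : ℂ) r₁) := fun A hA j =>
    (((hS.pow j).mul hA).div_const _).mono hsub
  have hBb : ∀ (A : ℂ → ℂ) (L : ℝ), (∀ z ∈ Metric.ball (u : ℂ) r, ‖A z‖ ≤ L) → ∀ j < 4,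
      ∀ z ∈ Metric.ball (u : ℂ) r₁, ‖B A j z‖ ≤ K₁ ^ 4 * L := by
    intro A L hL j hj z hz
    have hL0 : 0 ≤ L := (norm_nonneg _).trans (hL z (hsub hz))
    simp only [hB, norm_div, norm_mul, norm_pow, Complex.norm_natCast]
    calc _ ≤ K₁ ^ j * L / 1 := by
          gcongr
          · exact hK₁ z hz
          · exact hL z (hsub hz)
          · exact_mod_cast Nat.one_le_iff_ne_zero.2 (Nat.factorial_ne_zero j)
      _ ≤ K₁ ^ 4 * L := by
          rw [div_one]; gcongr
  have h2r : 1 ≤ 2 / r₁ := by rw [le_div_iff₀ hr₁0]; linarith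
  set Q := 2 * (K₁ ^ 4 * K) * (2 / r₁) ^ 4 with hQ
  have hQ0 : 0 ≤ Q := by positivity
  -- The second bound makes the cubic remainder at most a q² / (4ε) in modulus, half of the Gaussian
  -- exponent; the first keeps the segment where the Taylor estimates hold.
  set η := min (r₁ / 4) (a / (4 * K₁)) with hη
  have hη0 : 0 < η := by positivity
  have hηr : η ≤ r₁ / 4 := min_le_left _ _
  have hηa : η * K₁ ≤ a / 4 := by
    have : η ≤ a / (4 * K₁) := min_le_right _ _
    rw [le_div_iff₀ (by positivity)] at this
    linarith
  obtain ⟨D, hD0, hD⟩ := integral_saddleMajorant ha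
  set Q₂ := (K₁ ^ 4 * K + Q) + 4 * Q / η ^ 4 with hQ₂
  have hQ₂0 : 0 ≤ Q₂ := by positivity
  set E := 2 * (K₁ ^ 4 * C₀) * (2 / r₁) ^ 4 with hE
  set Z := 1 / a + 3 / a ^ 2 + 15 / a ^ 3 with hZ
  refine ⟨η, Q₂ * D + √(2 * Real.pi / a) * (E * Z), hη0, by linarith, fun ε hε => ?_⟩
  have hε0 : 0 < ε := hε.1
  have hε' : (ε : ℂ) ≠ 0 := by exact_mod_cast hε0.ne'
  have hαd := hα ε hε
  have hαK := hK ε hε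
  have hbK : ∀ j < 4, ∀ i < 4, ‖b (α ε) j i‖ ≤ Q := by
    intro j hj i hi
    refine (norm_taylorCoeff_le hr₁0 (hBd _ hαd j) (hBb _ K hαK j hj) i).trans ?_
    have : (2 / r₁) ^ i ≤ (2 / r₁) ^ 4 := pow_le_pow_right₀ h2r (by omega)
    calc K₁ ^ 4 * K * (2 / r₁) ^ i ≤ K₁ ^ 4 * K * (2 / r₁) ^ 4 := by gcongr
      _ ≤ Q := by
        rw [hQ]
        have : 0 ≤ K₁ ^ 4 * K * (2 / r₁) ^ 4 := by positivity
        linarith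
  set Φ : ℝ → ℂ := fun q => Complex.exp ((G (u + q * Complex.I) - G u - k * (q * Complex.I)) / ε) *
          α ε (u + q * Complex.I) with hΦ
  set P : ℝ → ℂ := fun q => (Real.exp (-(a / (2 * ε)) * q ^ 2) : ℂ) * saddlePoly (b (α ε)) ε q with hP
  have hball : ∀ q : ℝ, |q| ≤ η → (u + q * Complex.I : ℂ) ∈ Metric.ball (u : ℂ) r₁ := by
    intro q hq
    rw [Metric.mem_ball, Complex.dist_eq, add_sub_cancel_left]
    simp only [norm_mul, Complex.norm_I, mul_one, Complex.norm_real, Real.norm_eq_abs]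
    linarith
  have hexp : ∀ q : ℝ, Real.exp (-(a / (2 * ε)) * q ^ 2) * Real.exp (a / (4 * ε) * q ^ 2) =
      Real.exp (-(a / (4 * ε)) * q ^ 2) := by
    intro q
    rw [← Real.exp_add]; congr 1; field_simp; ring
  -- The comparison is made on the whole real line, with the integrand cut off outside the segment,
  -- so that the full Gaussian moments can be used for P.
  have hpoint : ∀ q : ℝ, ‖(Set.Ioc (-η) η).indicator Φ q - P q‖ ≤
      Q₂ * (saddleMajorant ε q * Real.exp (-(a / (4 * ε)) * q ^ 2)) := by
    intro q
    have hm := saddleMajorant_nonneg hε0 q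
    by_cases hq : q ∈ Set.Ioc (-η) η
    · rw [Set.indicator_of_mem hq]
      have hq' : |q| ≤ η := abs_le.2 ⟨hq.1.le, hq.2⟩
      set z : ℂ := u + q * Complex.I with hz
      have hzb := hball q hq'
      have hzc : z - u = q * Complex.I := by rw [hz]; ring
      set T : ℂ := (q * Complex.I) ^ 3 * S z / ε with hT
      have hΦT : Φ q = (Real.exp (-(a / (2 * ε)) * q ^ 2) : ℂ) * (Complex.exp T * α ε z) := by
        simp only [hΦ]
        rw [Complex.ofReal_exp, ← mul_assoc (Complex.exp _) (Complex.exp T), ← Complex.exp_add, ← hz]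
        congr 2
        rw [hGS z, hG1, hG2, hzc, hT]
        push_cast
        field_simp
        rw [Complex.I_sq]
        ring
      have hTa : ‖T‖ ≤ a / (4 * ε) * q ^ 2 := by
        rw [hT, norm_div, norm_mul, norm_pow, norm_mul, Complex.norm_I, mul_one, Complex.norm_real,
          Complex.norm_real, Real.norm_eq_abs, Real.norm_of_nonneg hε0.le, div_le_iff₀ hε0]
        have h3 : a / (4 * ε) * q ^ 2 * ε = a / 4 * |q| ^ 2 := by rw [sq_abs]; field_simp
        rw [h3]
        calc |q| ^ 3 * ‖S z‖ ≤ |q| ^ 3 * K₁ := by gcongr; exact hK₁ z hzb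
          _ = |q| * K₁ * |q| ^ 2 := by ring
          _ ≤ η * K₁ * |q| ^ 2 := by gcongr
          _ ≤ _ := by gcongr
      have hmain := norm_exp_mul_sub_saddlePoly_le (T := T) (s := S z) (A := α ε z) (b := b (α ε))
        (q := q) (ε := ε) (K := K) (K₁ := K₁) (Q := Q) (a := a) hε0 hQ0 hT (hK₁ z hzb)
        (hαK z (hsub hzb)) hTa (by
          intro j hj
          have h4 := norm_sub_taylor_le hr₁0 (hBd _ hαd j) (hBb _ K hαK j hj) (4 - j) (z := z) (by
            rw [hzc]; simp only [norm_mul, Complex.norm_I, mul_one, Complex.norm_real,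
              Real.norm_eq_abs]; linarith)
          rw [hzc] at h4
          refine h4.trans ?_
          simp only [norm_mul, Complex.norm_I, mul_one, Complex.norm_real, Real.norm_eq_abs]
          rw [hQ]
          gcongr
          omega)
      rw [hΦT, hP]
      simp only
      rw [← mul_sub, norm_mul, Complex.norm_real, Real.norm_of_nonneg (Real.exp_pos _).le]
      calc _ ≤ Real.exp (-(a / (2 * ε)) * q ^ 2) *
            ((K₁ ^ 4 * K + Q) * saddleMajorant ε q * Real.exp (a / (4 * ε) * q ^ 2)) := by gcongr
        _ = (K₁ ^ 4 * K + Q) * (saddleMajorant ε q * Real.exp (-(a / (4 * ε)) * q ^ 2)) := by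
            rw [← hexp q]; ring
        _ ≤ _ := by
            gcongr
            rw [hQ₂]
            have : 0 ≤ 4 * Q / η ^ 4 := by positivity
            linarith
    · rw [Set.indicator_of_notMem hq, zero_sub, norm_neg]
      have hq' : η ≤ |q| := by
        by_contra hcon
        push Not at hcon
        exact hq ⟨(abs_lt.1 hcon).1, (abs_lt.1 hcon).2.le⟩
      simp only [hP]
      rw [norm_mul, Complex.norm_real, Real.norm_of_nonneg (Real.exp_pos _).le]
      calc _ ≤ Real.exp (-(a / (4 * ε)) * q ^ 2) * (4 * Q / η ^ 4 * saddleMajorant ε q) := by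
            gcongr ?_ * ?_
            · apply Real.exp_le_exp.2
              have : a / (4 * ε) ≤ a / (2 * ε) := by gcongr; linarith
              nlinarith [sq_nonneg q]
            · exact norm_saddlePoly_le hbK hη0 (by linarith) hε0 hq'
        _ = 4 * Q / η ^ 4 * (saddleMajorant ε q * Real.exp (-(a / (4 * ε)) * q ^ 2)) := by ring
        _ ≤ _ := by
            gcongr
            rw [hQ₂]
            have : 0 ≤ K₁ ^ 4 * K + Q := by positivity
            linarith
  obtain ⟨hPint, hPval⟩ := integral_saddlePoly ha hε0 (b (α ε))
  obtain ⟨hmint, hmval⟩ := hD ε hε0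
  have hΦcont : ContinuousOn Φ (Set.Icc (-η) η) := by
    have hmaps : Set.MapsTo (fun q : ℝ => (u + q * Complex.I : ℂ)) (Set.Icc (-η) η)
        (Metric.ball (u : ℂ) r) := fun q hq => hsub (hball q (abs_le.2 hq))
    have hc1 : ContinuousOn (fun q : ℝ => G (u + q * Complex.I)) (Set.Icc (-η) η) :=
      hG.continuousOn.comp (by fun_prop) hmaps
    have hc2 : ContinuousOn (fun q : ℝ => α ε (u + q * Complex.I)) (Set.Icc (-η) η) :=
      hαd.continuousOn.comp (by fun_prop) hmaps
    exact ((((hc1.sub continuousOn_const).sub (by fun_prop)).div_const _).cexp).mul hc2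
  have hΦint : Integrable ((Set.Ioc (-η) η).indicator Φ) := by
    rw [integrable_indicator_iff measurableSet_Ioc]
    exact (hΦcont.integrableOn_Icc).mono_set Set.Ioc_subset_Icc_self
  have hclose : ‖(∫ q in (-η)..η, Φ q) - ∫ q, P q‖ ≤ Q₂ * D * (ε ^ 2 * √ε) := by
    rw [intervalIntegral.integral_of_le (by linarith), ← integral_indicator measurableSet_Ioc,
      ← integral_sub hΦint hPint]
    refine (norm_integral_le_of_norm_le (hmint.const_mul Q₂) (Eventually.of_forall hpoint)).trans
      (le_of_eq ?_)
    rw [integral_const_mul, hmval]; ring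
  -- By Cauchy estimates the Taylor coefficients converge at rate ε. In the corrections that already
  -- carry a factor ε, the limit amplitude may thus replace α ε at a cost O(ε²); the leading term
  -- keeps the exact value at u.
  have hcoef : ∀ j < 4, ∀ i < 4, ‖b (α ε) j i - b α₀ j i‖ ≤ E * ε := by
    intro j hj i hi
    have hmem : Metric.ball (u : ℂ) r₁ ∈ 𝓝 (u : ℂ) := Metric.ball_mem_nhds _ hr₁0
    have hcd : ∀ A : ℂ → ℂ, DifferentiableOn ℂ A (Metric.ball (u : ℂ) r) →
        ContDiffAt ℂ i (B A j) u := fun A hA => ((hBd A hA j).analyticAt hmem).contDiffAt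
    have hsubd : b (α ε) j i - b α₀ j i =
        iteratedDeriv i (B (fun z => α ε z - α₀ z) j) u / (i ! : ℂ) := by
      have hfe : B (fun z => α ε z - α₀ z) j = B (α ε) j - B α₀ j := by
        ext z; simp only [hB, Pi.sub_apply]; ring
      rw [hfe, iteratedDeriv_sub (hcd _ hαd) (hcd _ hα₀)]
      simp only [hb]; ring
    rw [hsubd]
    refine (norm_taylorCoeff_le hr₁0 (hBd _ (hαd.sub hα₀) j)
      (hBb _ (C₀ * ε) (hC₀ ε hε) j hj) i).trans ?_
    have : (2 / r₁) ^ i ≤ (2 / r₁) ^ 4 := pow_le_pow_right₀ h2r (by omega)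
    calc K₁ ^ 4 * (C₀ * ε) * (2 / r₁) ^ i ≤ K₁ ^ 4 * (C₀ * ε) * (2 / r₁) ^ 4 := by gcongr
      _ ≤ E * ε := by
        rw [hE]
        have : 0 ≤ K₁ ^ 4 * (C₀ * ε) * (2 / r₁) ^ 4 := by positivity
        linarith
  have hb00 : b (α ε) 0 0 = α ε u := by simp [hb, hB]
  have hb02 : b α₀ 0 2 = iteratedDeriv 2 α₀ u / 2 := by
    have : B α₀ 0 = α₀ := by ext z; simp [hB]
    simp [hb, this]
  have hnr : Metric.ball (u : ℂ) r ∈ 𝓝 (u : ℂ) := Metric.ball_mem_nhds _ hr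
  have hb11 : b α₀ 1 1 = iteratedDeriv 4 G u / 24 * α₀ u + iteratedDeriv 3 G u / 6 * deriv α₀ u := by
    have : B α₀ 1 = S * α₀ := by ext z; simp [hB]
    simp only [hb, this, iteratedDeriv_one, Nat.factorial_one, Nat.cast_one, div_one]
    rw [deriv_mul (hS.differentiableAt hnr) (hα₀.differentiableAt hnr), hS0, hS1]
  have hb20 : b α₀ 2 0 = (iteratedDeriv 3 G u) ^ 2 / 72 * α₀ u := by
    simp only [hb, hB, iteratedDeriv_zero, hS0]
    norm_num; ring
  have ha' : (a : ℂ) ≠ 0 := by exact_mod_cast ha.ne'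
  set c₁ : ℂ := -(iteratedDeriv 2 α₀ u) / (2 * a)
          + 3 * (iteratedDeriv 4 G u / 24 * α₀ u + iteratedDeriv 3 G u / 6 * deriv α₀ u) / a ^ 2
          - 15 * (iteratedDeriv 3 G u) ^ 2 / 72 * α₀ u / a ^ 3 with hc₁
  have hc₁b : c₁ = -(b α₀ 0 2) / a + 3 * b α₀ 1 1 / a ^ 2 - 15 * b α₀ 2 0 / a ^ 3 := by
    rw [hb02, hb11, hb20, hc₁]; field_simp
  have hdiff : ‖(∫ q, P q) - (√(2 * Real.pi * ε / a) : ℝ) * (α ε u + ε * c₁)‖ ≤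
      √(2 * Real.pi / a) * (E * Z) * (ε ^ 2 * √ε) := by
    rw [hPval, hb00, hc₁b, ← mul_sub, norm_mul, Complex.norm_real,
      Real.norm_of_nonneg (Real.sqrt_nonneg _)]
    have h5 : √(2 * Real.pi * ε / a) = √(2 * Real.pi / a) * √ε := by
      rw [← Real.sqrt_mul (by positivity)]; congr 1; ring
    have h6 : α ε u + (ε : ℂ) * (-(b (α ε) 0 2) / a + 3 * b (α ε) 1 1 / a ^ 2
        - 15 * b (α ε) 2 0 / a ^ 3) - (α ε u + ε * (-(b α₀ 0 2) / a + 3 * b α₀ 1 1 / a ^ 2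
        - 15 * b α₀ 2 0 / a ^ 3)) = (ε : ℂ) * (-((b (α ε) 0 2 - b α₀ 0 2) / a) +
          3 * (b (α ε) 1 1 - b α₀ 1 1) / a ^ 2 - 15 * (b (α ε) 2 0 - b α₀ 2 0) / a ^ 3) := by ring
    rw [h6, h5, norm_mul, Complex.norm_real, Real.norm_of_nonneg hε0.le]
    have h7 : ‖(-((b (α ε) 0 2 - b α₀ 0 2) / a) +
          3 * (b (α ε) 1 1 - b α₀ 1 1) / a ^ 2 - 15 * (b (α ε) 2 0 - b α₀ 2 0) / a ^ 3 : ℂ)‖ ≤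
        E * ε * Z := by
      refine (norm_sub_le _ _).trans ((add_le_add (norm_add_le _ _) le_rfl).trans ?_)
      simp only [norm_neg, norm_div, norm_mul, norm_pow, Complex.norm_real, Complex.norm_ofNat,
        Real.norm_of_nonneg ha.le]
      calc _ ≤ E * ε / a + 3 * (E * ε) / a ^ 2 + 15 * (E * ε) / a ^ 3 := by
            gcongr
            · exact hcoef 0 (by norm_num) 2 (by norm_num)
            · exact hcoef 1 (by norm_num) 1 (by norm_num)
            · exact hcoef 2 (by norm_num) 0 (by norm_num)
        _ = _ := by rw [hZ]; ring
    calc _ ≤ √(2 * Real.pi / a) * √ε * (ε * (E * ε * Z)) := by gcongr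
      _ = _ := by ring
  calc _ ≤ ‖(∫ q in (-η)..η, Φ q) - ∫ q, P q‖ +
        ‖(∫ q, P q) - (√(2 * Real.pi * ε / a) : ℝ) * (α ε u + ε * c₁)‖ :=
          norm_sub_le_norm_sub_add_norm_sub _ _ _
    _ ≤ _ := by linarith

end

/-! ### Restriction to the real axis and positivity of the second derivative -/

section

/-- Real iterated derivatives of the restriction of a holomorphic function. -/
lemma eventually_ofReal_iteratedDeriv_eq {G : ℂ → ℂ} {f : ℝ → ℝ} {u : ℝ} (hG : AnalyticAt ℂ G u)
    (hf : ∀ᶠ x : ℝ in 𝓝 u, (f x : ℂ) = G x) (n : ℕ) :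
    ∀ᶠ x : ℝ in 𝓝 u, ((iteratedDeriv n f x : ℝ) : ℂ) = iteratedDeriv n G x := by
  have hGev : ∀ᶠ x : ℝ in 𝓝 u, AnalyticAt ℂ G x :=
    (Complex.continuous_ofReal.tendsto u).eventually hG.eventually_analyticAt
  induction n with
  | zero => simpa using hf
  | succ n ih =>
    filter_upwards [ih.eventually_nhds, hGev] with x hx hxG
    have hd : HasDerivAt (iteratedDeriv n G) (iteratedDeriv (n + 1) G x) (x : ℂ) := by
      rw [iteratedDeriv_succ]
      have : AnalyticAt ℂ (iteratedDeriv n G) x := by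
        rw [iteratedDeriv_eq_iterate]; exact hxG.iterated_deriv n
      exact this.differentiableAt.hasDerivAt
    have h1 : HasDerivAt (iteratedDeriv n f) (iteratedDeriv (n + 1) G x).re x := by
      refine hd.real_of_complex.congr_of_eventuallyEq ?_
      filter_upwards [hx] with y hy
      rw [← hy, Complex.ofReal_re]
    have h2 : HasDerivAt (fun y : ℝ => ((iteratedDeriv n f y : ℝ) : ℂ)) (iteratedDeriv (n + 1) G x) x :=
      hd.comp_ofReal.congr_of_eventuallyEq hx
    have h3 := h1.ofReal_comp
    rw [iteratedDeriv_succ, h1.deriv]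
    exact h3.unique h2

/-- Leading order consequence of `Re H (p + iq) ≤ Re H p` in a direction `θ`. -/
lemma re_exp_mul_le_of_re_le {H g : ℂ → ℂ} {u : ℝ} {n : ℕ} (hg : ContinuousAt g u)
    (hH : ∀ᶠ z in 𝓝 (u : ℂ), H z = (z - u) ^ n * g z)
    (hmax : ∀ᶠ z in 𝓝 (u : ℂ), (H z).re ≤ (H z.re).re) (θ : ℝ) :
    (Complex.exp (n * θ * Complex.I) * g u).re ≤ Real.cos θ ^ n * (g u).re := by
  have hpath : ∀ w : ℂ, Tendsto (fun t : ℝ => (u : ℂ) + t * w) (𝓝[>] 0) (𝓝 (u : ℂ)) := by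
    intro w
    have : Tendsto (fun t : ℝ => (u : ℂ) + t * w) (𝓝 0) (𝓝 ((u : ℂ) + (0 : ℝ) * w)) :=
      Continuous.tendsto (by fun_prop) 0
    simp only [Complex.ofReal_zero, zero_mul, add_zero] at this
    exact this.mono_left nhdsWithin_le_nhds
  set e := Complex.exp (θ * Complex.I) with he
  have hre : e.re = Real.cos θ := by rw [he, Complex.exp_ofReal_mul_I_re]
  have h1 : Tendsto (fun t : ℝ => (e ^ n * g (u + t * e)).re) (𝓝[>] 0) (𝓝 (e ^ n * g u).re) :=
    (Complex.continuous_re.tendsto _).comp ((hg.tendsto.comp (hpath e)).const_mul _)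
  have h2 : Tendsto (fun t : ℝ => ((Real.cos θ : ℂ) ^ n * g (u + t * (Real.cos θ : ℂ))).re) (𝓝[>] 0)
      (𝓝 ((Real.cos θ : ℂ) ^ n * g u).re) :=
    (Complex.continuous_re.tendsto _).comp ((hg.tendsto.comp (hpath _)).const_mul _)
  have h3 := le_of_tendsto_of_tendsto h1 h2 (by
    filter_upwards [(hpath e).eventually hH, (hpath _).eventually hH, (hpath e).eventually hmax,
      self_mem_nhdsWithin] with t k1 k2 k3 k4
    have hzre : (((u : ℂ) + t * e).re : ℂ) = u + t * (Real.cos θ : ℂ) := by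
      simp [hre]
    rw [hzre, k1, k2, add_sub_cancel_left, add_sub_cancel_left, mul_pow, mul_pow, mul_assoc,
      mul_assoc, ← Complex.ofReal_pow, Complex.re_ofReal_mul, Complex.re_ofReal_mul] at k3
    exact le_of_mul_le_mul_left k3 (pow_pos k4 n))
  rw [← Complex.ofReal_pow, Complex.re_ofReal_mul, he, ← Complex.exp_nat_mul] at h3
  rwa [mul_assoc]

/-- A holomorphic function whose real part decreases off the real axis on vertical lines, and which
is not affine, has positive second derivative at real points where its first two derivatives
are real. -/
lemma second_deriv_pos {G : ℂ → ℂ} {u r k a : ℝ} (hr : 0 < r)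
    (hG : DifferentiableOn ℂ G (Metric.ball (u : ℂ) r))
    (hmax : ∀ z ∈ Metric.ball (u : ℂ) r, (G z).re ≤ (G z.re).re)
    (hG1 : deriv G u = k) (hG2 : iteratedDeriv 2 G u = a)
    (hna : ¬ ∀ᶠ z in 𝓝 (u : ℂ), G z = G u + k * (z - u)) : 0 < a := by
  obtain ⟨S, hS, hGS, -, -⟩ := exists_cubic_remainder hr hG
  have hball : Metric.ball (u : ℂ) r ∈ 𝓝 (u : ℂ) := Metric.ball_mem_nhds _ hr
  set H : ℂ → ℂ := fun z => G z - G u - k * (z - u) with hH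
  have hHmax : ∀ᶠ z in 𝓝 (u : ℂ), (H z).re ≤ (H z.re).re := by
    filter_upwards [hball] with z hz
    have := hmax z hz
    simp only [hH, Complex.sub_re, Complex.re_ofReal_mul, Complex.ofReal_re]
    linarith
  have hHS : ∀ z, H z = (z - u) ^ 2 * (a / 2 + (z - u) * S z) := by
    intro z
    simp only [hH]
    rw [hGS z, hG1, hG2]; ring
  have hScont : ContinuousAt S u := hS.continuousOn.continuousAt hball
  -- In the vertical direction θ = π / 2 the factor exp (2iθ) is -1 and the cosine vanishes, so the
  -- inequality reads -a / 2 ≤ 0.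
  have hge : 0 ≤ a := by
    have h := re_exp_mul_le_of_re_le (g := fun z => a / 2 + (z - u) * S z) (n := 2)
      (by fun_prop) (Eventually.of_forall hHS) hHmax (Real.pi / 2)
    have e1 : Complex.exp ((2 : ℕ) * ((Real.pi / 2 : ℝ) : ℂ) * Complex.I) = -1 := by
      rw [← Complex.exp_pi_mul_I]; congr 1; push_cast; ring
    rw [e1, Real.cos_pi_div_two] at h
    have e2 : ((a : ℂ) / 2).re = a / 2 := by
      rw [show (a : ℂ) / 2 = ((a / 2 : ℝ) : ℂ) by push_cast; ring, Complex.ofReal_re]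
    simp [e2] at h
    linarith
  -- If a = 0, then G minus its tangent, not being locally zero, vanishes at u to a finite order n ≥
  -- 3. Its leading term then has too many directions of increase.
  refine lt_of_le_of_ne hge fun ha => ?_
  have hHS' : ∀ z, H z = (z - u) ^ 3 * S z := by
    intro z; rw [hHS z, ← ha]; push_cast; ring
  have hSz : ¬ ∀ᶠ z in 𝓝 (u : ℂ), S z = 0 := by
    intro h
    refine hna ?_
    filter_upwards [h] with z hz
    have := hHS' z
    rw [hz, mul_zero] at this
    simp only [hH] at this
    linear_combination this
  obtain ⟨m, g, hg, hg0, hSg⟩ :=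
    (AnalyticAt.exists_eventuallyEq_pow_smul_nonzero_iff (hS.analyticAt hball)).2 hSz
  have hHg : ∀ᶠ z in 𝓝 (u : ℂ), H z = (z - u) ^ (m + 3) * g z := by
    filter_upwards [hSg] with z hz
    rw [hHS', hz, smul_eq_mul]; ring
  have hdir := re_exp_mul_le_of_re_le hg.continuousAt hHg hHmax
  set γ := g u with hγ
  set n := m + 3 with hn
  have hn3 : (3 : ℝ) ≤ n := by rw [hn]; push_cast; linarith [show (0 : ℝ) ≤ m from Nat.cast_nonneg m]
  have hn0 : (n : ℝ) ≠ 0 := by positivity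
  -- At these angles exp (inθ) γ = ‖γ‖, so the directional inequality reads ‖γ‖ ≤ (cos θ)^n Re γ and
  -- forces |cos θ| = 1. Taking j = 0 and j = 1 gives sin (2π/n) = 0, impossible for n ≥ 3.
  have hkey : ∀ j : ℤ, Real.sin ((-γ.arg + 2 * Real.pi * j) / n) = 0 := by
    intro j
    by_contra hsin
    set θ := (-γ.arg + 2 * Real.pi * j) / n with hθ
    have h := hdir θ
    have hexp : Complex.exp (n * θ * Complex.I) * γ = ‖γ‖ := by
      conv_lhs => rw [← Complex.norm_mul_exp_arg_mul_I γ]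
      rw [mul_left_comm, ← Complex.exp_add]
      have hnc : (n : ℂ) ≠ 0 := by exact_mod_cast hn0
      have : (n * θ * Complex.I + γ.arg * Complex.I : ℂ) = j * (2 * Real.pi * Complex.I) := by
        rw [hθ]; push_cast; field_simp; ring
      rw [this, Complex.exp_int_mul_two_pi_mul_I, mul_one]
    rw [hexp, Complex.ofReal_re] at h
    have hcos : |Real.cos θ| < 1 := by
      rw [← sq_lt_one_iff_abs_lt_one]
      have := Real.sin_sq_add_cos_sq θ
      have : 0 < Real.sin θ ^ 2 := by positivity
      linarith
    have hpow : |Real.cos θ| ^ n < 1 := pow_lt_one₀ (abs_nonneg _) hcos (by omega)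
    have hγ0 : 0 < ‖γ‖ := norm_pos_iff.2 hg0
    have : Real.cos θ ^ n * γ.re ≤ |Real.cos θ| ^ n * ‖γ‖ := by
      calc _ ≤ |Real.cos θ ^ n * γ.re| := le_abs_self _
        _ = |Real.cos θ| ^ n * |γ.re| := by rw [abs_mul, abs_pow]
        _ ≤ _ := by gcongr; exact Complex.abs_re_le_norm _
    nlinarith
  have s0 := hkey 0
  have s1 := hkey 1
  simp only [Int.cast_zero, mul_zero, add_zero, Int.cast_one, mul_one, add_div] at s0 s1
  rw [Real.sin_add, s0, zero_mul, zero_add] at s1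
  rcases mul_eq_zero.1 s1 with h | h
  · have := Real.sin_sq_add_cos_sq (-γ.arg / n)
    rw [s0, h] at this; norm_num at this
  · have hpos : 0 < Real.sin (2 * Real.pi / n) := by
      refine Real.sin_pos_of_pos_of_lt_pi (by positivity) ?_
      rw [div_lt_iff₀ (by positivity)]
      nlinarith [Real.pi_pos]
    exact hpos.ne' h

end

/-! ### Large maturity rescaling, bounds on the amplitude, convexity -/

section

section Rescaling

variable {Ω : Type*} [MeasurableSpace Ω] {μ : Measure Ω} {X : ℝ → Ω → ℝ} {t : ℝ}

lemma complexMgf_largeMaturityFamily {ε : ℝ} (hε : ε ≠ 0) (z : ℂ) :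
    complexMgf μ (largeMaturityFamily X t) ε z = complexMGF (fwd X t (1 / ε)) μ z := by
  have hε' : (ε : ℂ) ≠ 0 := by exact_mod_cast hε
  simp only [complexMgf, complexMGF, largeMaturityFamily]
  refine integral_congr_ae (Eventually.of_forall fun a => ?_)
  simp only []
  congr 1
  push_cast
  field_simp

lemma effDomain_largeMaturityFamily {ε : ℝ} (hε : ε ≠ 0) :
    effDomain μ (largeMaturityFamily X t) ε = integrableExpSet (fwd X t (1 / ε)) μ := by
  ext p
  simp only [effDomain, integrableExpSet, Set.mem_ofPred_eq, largeMaturityFamily]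
  have : ∀ a, p / ε * (ε * fwd X t (1 / ε) a) = p * fwd X t (1 / ε) a := by
    intro a; field_simp
  simp only [this]

lemma lmgf_largeMaturityFamily {ε : ℝ} (hε : ε ≠ 0) (p : ℝ) :
    lmgf μ (largeMaturityFamily X t) ε p = ε * Real.log (mgf (fwd X t (1 / ε)) μ p) := by
  simp only [lmgf, cgf, mgf, largeMaturityFamily]
  have : ∀ a, p / ε * (ε * fwd X t (1 / ε) a) = p * fwd X t (1 / ε) a := by
    intro a; field_simp
  simp only [this]

lemma measurable_fwd (hX : ∀ s : ℝ, 0 ≤ s → Measurable (X s)) (ht : 0 ≤ t) {τ : ℝ} (hτ : 0 ≤ τ) :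
    Measurable (fwd X t τ) :=
  (hX _ (add_nonneg ht hτ)).sub (hX t ht)

end Rescaling

section Bounds

variable {Ω : Type*} [MeasurableSpace Ω] {μ : Measure Ω}

/-- The tail conditions bound `M_ε exp (-G / ε)` on a full vertical line. -/
lemma exists_line_bound {Y : ℝ → Ω → ℝ} {G : ℂ → ℂ} {p : ℝ}
    (hloc : ∀ R : ℝ, 0 < R → ∃ C : ℝ, ∀ᶠ ε in 𝓝[>] (0 : ℝ), ∀ q : ℝ, |q| ≤ R →
        complexMgf μ Y ε ⟨p, q⟩ ≠ 0 ∧ |reLmgf μ Y ε ⟨p, q⟩ - (G ⟨p, q⟩).re| ≤ C * ε)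
    (htail : ∃ ε₁ R M : ℝ, 0 < ε₁ ∧ 0 < R ∧ ∀ ε : ℝ, 0 < ε → ε ≤ ε₁ → p ∈ effDomain μ Y ε ∧
        ∀ q : ℝ, R ≤ |q| → complexMgf μ Y ε ⟨p, q⟩ = 0 ∨
          reLmgf μ Y ε ⟨p, q⟩ - (G ⟨p, q⟩).re ≤ M * ε) :
    ∃ K ε₁ : ℝ, 0 < ε₁ ∧ ∀ ε ∈ Set.Ioo 0 ε₁, ∀ q : ℝ,
      ‖complexMgf μ Y ε ⟨p, q⟩ * Complex.exp (-G ⟨p, q⟩ / ε)‖ ≤ K := by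
  obtain ⟨ε₁, R, M, hε₁, hR, htail⟩ := htail
  obtain ⟨C, hC⟩ := hloc R hR
  obtain ⟨ε₂, hε₂, hC⟩ := mem_nhdsGT_iff_exists_Ioo_subset.1 hC
  refine ⟨Real.exp (max C M), min ε₁ ε₂, lt_min hε₁ hε₂, fun ε hε q => ?_⟩
  have hε0 : 0 < ε := hε.1
  have key : ∀ C' : ℝ, C' ≤ max C M → complexMgf μ Y ε ⟨p, q⟩ ≠ 0 →
      reLmgf μ Y ε ⟨p, q⟩ - (G ⟨p, q⟩).re ≤ C' * ε →
      ‖complexMgf μ Y ε ⟨p, q⟩ * Complex.exp (-G ⟨p, q⟩ / ε)‖ ≤ Real.exp (max C M) := by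
    intro C' hC' hne hle
    rw [norm_mul, Complex.norm_exp, ← Real.exp_log (norm_pos_iff.2 hne), ← Real.exp_add]
    apply Real.exp_le_exp.2
    rw [Complex.div_ofReal_re, Complex.neg_re]
    have h1 : Real.log ‖complexMgf μ Y ε ⟨p, q⟩‖ = reLmgf μ Y ε ⟨p, q⟩ / ε := by
      rw [reLmgf]; field_simp
    rw [h1, ← add_div, div_le_iff₀ hε0]
    nlinarith
  rcases le_total |q| R with h | h
  · have := hC ⟨hε0, hε.2.trans_le (min_le_right _ _)⟩ q h
    exact key C (le_max_left _ _) this.1 ((le_abs_self _).trans this.2)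
  · by_cases h0 : complexMgf μ Y ε ⟨p, q⟩ = 0
    · rw [h0, zero_mul, norm_zero]; exact (Real.exp_pos _).le
    · exact key M (le_max_right _ _) h0 (((htail ε hε0 (hε.2.le.trans (min_le_left _ _))).2 q h).resolve_left h0)

/-- For p between u - η and u + η, exp (pX) is at most the sum of its values at the two ends. The
bound depends on ε when applied and serves only as the a priori boundedness required by
`exists_strip_width`. -/
lemma norm_complexMGF_le_of_strip {X : Ω → ℝ} {u η : ℝ}
    (h1 : u - η ∈ integrableExpSet X μ) (h2 : u + η ∈ integrableExpSet X μ) {z : ℂ}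
    (hz : |z.re - u| ≤ η) :
    ‖complexMGF X μ z‖ ≤ mgf X μ (u - η) + mgf X μ (u + η) := by
  refine norm_complexMGF_le_mgf.trans ?_
  rw [mgf, mgf, mgf, ← integral_add h1 h2]
  have hz' := abs_le.1 hz
  refine integral_mono_of_nonneg (Eventually.of_forall fun a => (Real.exp_pos _).le) (h1.add h2)
    (Eventually.of_forall fun a => ?_)
  simp only []
  rcases le_total 0 (X a) with h | h
  · have : z.re * X a ≤ (u + η) * X a := by gcongr; linarith
    exact (Real.exp_le_exp.2 this).trans (le_add_of_nonneg_left (Real.exp_pos _).le)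
  · have : z.re * X a ≤ (u - η) * X a := mul_le_mul_of_nonpos_right (by linarith) h
    exact (Real.exp_le_exp.2 this).trans (le_add_of_nonneg_right (Real.exp_pos _).le)

/-- Expansion of `exp ((Λ_ε - Λ₀) / ε)` from an expansion of `Λ_ε`. -/
lemma exp_div_expansion {y : ℝ → ℝ} {c₀ c₁ c₂ : ℝ}
    (h : (fun ε : ℝ => y ε - (c₀ + c₁ * ε + c₂ * ε ^ 2)) =O[𝓝[>] (0 : ℝ)] (fun ε : ℝ => ε ^ 3)) :
    ∃ C : ℝ, ∀ᶠ ε in 𝓝[>] (0 : ℝ),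
      |Real.exp ((y ε - c₀) / ε) - (Real.exp c₁ + Real.exp c₁ * c₂ * ε)| ≤ C * ε ^ 2 := by
  obtain ⟨C, hC⟩ := h.bound
  refine ⟨Real.exp c₁ * (|C| + (|c₂| + |C|) ^ 2), ?_⟩
  have hsmall : ∀ᶠ ε in 𝓝[>] (0 : ℝ), ε < min 1 (1 / (|c₂| + |C| + 1)) :=
    mem_of_superset (Ioo_mem_nhdsGT (show (0 : ℝ) < min 1 (1 / (|c₂| + |C| + 1)) by positivity))
      fun ε hε => hε.2
  filter_upwards [hC, hsmall, self_mem_nhdsWithin] with ε h1 h2 h3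
  have hε : 0 < ε := h3
  have hε1 : ε ≤ 1 := (h2.trans_le (min_le_left _ _)).le
  have hε2 : ε * (|c₂| + |C|) ≤ 1 := by
    have := h2.trans_le (min_le_right _ _)
    rw [lt_div_iff₀ (by positivity)] at this
    nlinarith
  -- w is the exponent beyond its limit c₁: it is c₂ ε + O(ε²), hence O(ε), and e^w = 1 + w + O(w²).
  set w := (y ε - c₀) / ε - c₁ with hw
  have hwC : |w - c₂ * ε| ≤ |C| * ε ^ 2 := by
    have e1 : w - c₂ * ε = (y ε - (c₀ + c₁ * ε + c₂ * ε ^ 2)) / ε := by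
      rw [hw]; field_simp; ring
    rw [e1, abs_div, abs_of_pos hε, div_le_iff₀ hε]
    rw [Real.norm_eq_abs, Real.norm_eq_abs, abs_of_pos (by positivity : 0 < ε ^ 3)] at h1
    calc _ ≤ C * ε ^ 3 := h1
      _ ≤ |C| * ε ^ 3 := by gcongr; exact le_abs_self C
      _ = _ := by ring
  have hw1 : |w| ≤ ε * (|c₂| + |C|) := by
    have : |w| ≤ |w - c₂ * ε| + |c₂ * ε| := by
      calc |w| = |(w - c₂ * ε) + c₂ * ε| := by ring_nf
        _ ≤ _ := abs_add_le _ _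
    rw [abs_mul, abs_of_pos hε] at this
    have h5 : |C| * ε ^ 2 ≤ |C| * ε := by
      gcongr; nlinarith
    linarith
  have hexp : |Real.exp w - 1 - w| ≤ w ^ 2 := Real.abs_exp_sub_one_sub_id_le (hw1.trans hε2)
  have e2 : Real.exp ((y ε - c₀) / ε) - (Real.exp c₁ + Real.exp c₁ * c₂ * ε) =
      Real.exp c₁ * ((Real.exp w - 1 - w) + (w - c₂ * ε)) := by
    have : (y ε - c₀) / ε = c₁ + w := by rw [hw]; ring
    rw [this, Real.exp_add]; ring
  rw [e2, abs_mul, abs_of_pos (Real.exp_pos _), mul_assoc]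
  gcongr
  have h6 : w ^ 2 ≤ (|c₂| + |C|) ^ 2 * ε ^ 2 := by
    rw [← sq_abs w, ← mul_pow, mul_comm]; gcongr
  calc _ ≤ |Real.exp w - 1 - w| + |w - c₂ * ε| := abs_add_le _ _
    _ ≤ _ := by linarith

end Bounds

section Convexity

/-- Strict tangent line inequality. -/
lemma tangent_lt {S : Set ℝ} {f : ℝ → ℝ} (hf : StrictConvexOn ℝ S f) {u y : ℝ} (hu : u ∈ S)
    (hy : y ∈ S) (hd : DifferentiableAt ℝ f u) (hne : y ≠ u) :
    f u + deriv f u * (y - u) < f y := by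
  rcases lt_or_gt_of_ne hne with h | h
  · have := hf.slope_lt_deriv hy hu h hd
    rw [slope_def_field, div_lt_iff₀ (by linarith)] at this
    linarith
  · have := hf.deriv_lt_slope hu hy h hd
    rw [slope_def_field, lt_div_iff₀ (by linarith)] at this
    linarith

/-- The graph lies above its tangent of slope k at u, so the supremum is attained at the
saddlepoint. -/
lemma legendre_eq {S : Set ℝ} {f : ℝ → ℝ} (hf : StrictConvexOn ℝ S f) {k u : ℝ}
    (hu : IsSaddlePoint S f k u) (hd : DifferentiableAt ℝ f u) :
    legendre S f k = u * k - f u := by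
  have hgr : IsGreatest ((fun u : ℝ => u * k - f u) '' S) (u * k - f u) := by
    refine ⟨⟨u, hu.1, rfl⟩, ?_⟩
    rintro _ ⟨y, hy, rfl⟩
    simp only
    rcases eq_or_ne y u with rfl | hne
    · exact le_rfl
    · have := tangent_lt hf hu.1 hy hd hne
      rw [hu.2] at this
      linarith
  exact hgr.csSup_eq

end Convexity

end

/-! ### Uniform control of the amplitude near the saddlepoint -/

section

variable {Ω : Type*} [MeasurableSpace Ω] {μ : Measure Ω} {X : ℝ → Ω → ℝ} {t : ℝ}

/-- The amplitude `F_ε = E[exp (z X_{1/ε})] exp (-G z / ε)` of the moment generating function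
relative to a given exponent `G`. -/
def amplitude (μ : Measure Ω) (X : ℝ → Ω → ℝ) (t : ℝ) (G : ℂ → ℂ) (ε : ℝ) (z : ℂ) : ℂ :=
  complexMGF (fwd X t (1 / ε)) μ z * Complex.exp (-G z / ε)

/-- The analytic content of the standing assumption around a point `u` of the open domain `S`: on a
strip around `u` the amplitude is uniformly bounded, and on a disc it converges at rate `ε`. -/
structure AmplitudeControl (μ : Measure Ω) (X : ℝ → Ω → ℝ) (t : ℝ) (S : Set ℝ)
    (Λ₀ Λ₁ Λ₂ : ℝ → ℝ) (u : ℝ) (G F₀ : ℂ → ℂ) (r ε₁ K C : ℝ) : Prop where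
  r_pos : 0 < r
  eps_pos : 0 < ε₁
  mem : ∀ p : ℝ, |p - u| < r → p ∈ S
  diff : DifferentiableOn ℂ G {z : ℂ | |z.re - u| < r}
  real : ∀ x : ℝ, |x - u| < r → G x = Λ₀ x
  re_le : ∀ z : ℂ, |z.re - u| < r → (G z).re ≤ (G z.re).re
  gap : ∀ δ : ℝ, 0 < δ → ∃ d : ℝ, 0 < d ∧ ∀ q : ℝ, δ ≤ |q| → (G (u + q * Complex.I)).re ≤ Λ₀ u - d
  integrable : ∀ ε ∈ Set.Ioo 0 ε₁, ∀ p : ℝ, |p - u| < r →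
    Integrable (fun a => Real.exp (p * fwd X t (1 / ε) a)) μ
  diffAmp : ∀ ε ∈ Set.Ioo 0 ε₁, DifferentiableOn ℂ (amplitude μ X t G ε) {z : ℂ | |z.re - u| < r}
  bound : ∀ ε ∈ Set.Ioo 0 ε₁, ∀ z : ℂ, |z.re - u| < r → ‖amplitude μ X t G ε z‖ ≤ K
  diffLim : DifferentiableOn ℂ F₀ (Metric.ball (u : ℂ) r)
  rate : ∀ ε ∈ Set.Ioo 0 ε₁, ∀ z ∈ Metric.ball (u : ℂ) r, ‖amplitude μ X t G ε z - F₀ z‖ ≤ C * ε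
  pointwise : ∀ x : ℝ, |x - u| < r → ∃ C' : ℝ, ∀ᶠ ε : ℝ in 𝓝[>] (0 : ℝ),
    ‖amplitude μ X t G ε x - (Real.exp (Λ₁ x) + (Real.exp (Λ₁ x) * Λ₂ x : ℝ) * ε)‖ ≤ C' * ε ^ 2

lemma abs_re_sub_lt_of_mem_ball {z : ℂ} {u r : ℝ} (hz : z ∈ Metric.ball (u : ℂ) r) :
    |z.re - u| < r := by
  rw [Metric.mem_ball, Complex.dist_eq] at hz
  have := Complex.abs_re_le_norm (z - u)
  simp only [Complex.sub_re, Complex.ofReal_re] at this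
  exact this.trans_lt hz

/-- The tail conditions bound the amplitude on the two lines Re z = u ± η, Phragmén–Lindelöf bounds
it in between, and the pointwise expansion of Λ_ε then yields a holomorphic limit at rate ε. -/
theorem exists_amplitudeControl [IsProbabilityMeasure μ] {D₀ : Set ℝ} {Λ₀ Λ₁ Λ₂ : ℝ → ℝ}
    (hΛ : StandingAssumption μ (largeMaturityFamily X t) D₀ Λ₀ Λ₁ Λ₂) {u : ℝ}
    (hu : u ∈ interior D₀) (hu0 : u ≠ 0) :
    ∃ (G F₀ : ℂ → ℂ) (r ε₁ K C : ℝ),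
      AmplitudeControl μ X t (interior D₀) Λ₀ Λ₁ Λ₂ u G F₀ r ε₁ K C := by
  set S := interior D₀ with hS
  have hSo : IsOpen S := isOpen_interior
  obtain ⟨G, hG, hGreal, hGtail⟩ := hΛ.tail
  obtain ⟨ε₀, hε₀, hdom, -⟩ := hΛ.smooth
  -- The continuation G is only given off the line Re z = 0, so the strip must avoid it.
  obtain ⟨r, hr, hrS⟩ : ∃ r > 0, ∀ p : ℝ, |p - u| ≤ r → p ∈ S ∧ p ≠ 0 := by
    have : S ∩ {0}ᶜ ∈ 𝓝 u :=
      Filter.inter_mem (hSo.mem_nhds hu) (isOpen_compl_singleton.mem_nhds hu0)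
    obtain ⟨r, hr, h⟩ := Metric.nhds_basis_closedBall.mem_iff.1 this
    exact ⟨r, hr, fun p hp => h (by rwa [Metric.mem_closedBall, Real.dist_eq])⟩
  have hGd : DifferentiableOn ℂ G {z : ℂ | |z.re - u| < r} :=
    hG.mono fun z hz => hrS _ (le_of_lt hz)
  have hre : ∀ z : ℂ, |z.re - u| < r → (G z).re ≤ (G z.re).re := by
    intro z hz
    have hp := hrS _ hz.le
    rcases eq_or_ne z.im 0 with h | h
    · have : z = (z.re : ℂ) := Complex.ext rfl (by simp [h])
      rw [← this]
    · exact ((hGtail z.re hp.1 hp.2).2.1 z.im h).le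
  obtain ⟨A, hA⟩ : ∃ A : ℝ, ∀ p : ℝ, |p - u| ≤ r → Λ₀ p ≤ A := by
    have hc : ContinuousOn Λ₀ (Metric.closedBall u r) := fun p hp =>
      (hΛ.essentiallySmooth.differentiable p
        (hrS p (by rwa [Metric.mem_closedBall, Real.dist_eq] at hp)).1).continuousAt.continuousWithinAt
    obtain ⟨B, hB⟩ := (isCompact_closedBall u r).exists_bound_of_continuousOn hc
    exact ⟨B, fun p hp => (le_abs_self _).trans
      (hB p (by rwa [Metric.mem_closedBall, Real.dist_eq]))⟩
  have hreA : ∀ z : ℂ, |z.re - u| < r → (G z).re ≤ A := by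
    intro z hz
    refine (hre z hz).trans ?_
    rw [hGreal _ (hrS _ hz.le).1 (hrS _ hz.le).2, Complex.ofReal_re]
    exact hA _ hz.le
  obtain ⟨η, hη, hηr, hstrip⟩ := exists_strip_width hr hGd hreA
  have hint : ∀ ε ∈ Set.Ioo 0 ε₀, ∀ p : ℝ, |p - u| ≤ r →
      p ∈ integrableExpSet (fwd X t (1 / ε)) μ := by
    intro ε hε p hp
    rw [← effDomain_largeMaturityFamily hε.1.ne']
    exact hdom ε hε (hrS p hp).1
  have hMd : ∀ ε ∈ Set.Ioo 0 ε₀,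
      DifferentiableOn ℂ (complexMGF (fwd X t (1 / ε)) μ) {z : ℂ | |z.re - u| < r} := by
    intro ε hε
    refine differentiableOn_complexMGF.mono fun z hz => ?_
    have : S ⊆ integrableExpSet (fwd X t (1 / ε)) μ := by
      rw [← effDomain_largeMaturityFamily hε.1.ne']
      exact hdom ε hε
    exact interior_maximal this hSo (hrS _ (le_of_lt hz)).1
  have hline : ∀ p : ℝ, |p - u| ≤ r → ∃ K ε₁ : ℝ, 0 < ε₁ ∧ ∀ ε ∈ Set.Ioo 0 ε₁, ∀ q : ℝ,
      ‖amplitude μ X t G ε ⟨p, q⟩‖ ≤ K := by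
    intro p hp
    obtain ⟨h1, h2, h3, h4⟩ := hGtail p (hrS p hp).1 (hrS p hp).2
    obtain ⟨K, ε₁, hε₁, hK⟩ := exists_line_bound h1 h4
    refine ⟨K, ε₁, hε₁, fun ε hε q => ?_⟩
    have := hK ε hε q
    rwa [complexMgf_largeMaturityFamily hε.1.ne'] at this
  -- Only two lines are used, so it does not matter that the constants of the tail conditions vary
  -- with p without any uniformity.
  obtain ⟨K₁, e₁, he₁, hK₁⟩ := hline (u - η) (by rw [show u - η - u = -η by ring, abs_neg, abs_of_pos hη]; exact hηr.le)
  obtain ⟨K₂, e₂, he₂, hK₂⟩ := hline (u + η) (by rw [add_sub_cancel_left, abs_of_pos hη]; exact hηr.le)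
  set ε₁ := min ε₀ (min e₁ e₂) with hε₁
  have hε₁0 : 0 < ε₁ := lt_min hε₀ (lt_min he₁ he₂)
  have hsub0 : ∀ ε ∈ Set.Ioo 0 ε₁, ε ∈ Set.Ioo 0 ε₀ := fun ε hε =>
    ⟨hε.1, hε.2.trans_le (min_le_left _ _)⟩
  have hbound : ∀ ε ∈ Set.Ioo 0 ε₁, ∀ z : ℂ, |z.re - u| ≤ η →
      ‖amplitude μ X t G ε z‖ ≤ max K₁ K₂ := by
    intro ε hε
    refine hstrip η hη le_rfl (complexMGF (fwd X t (1 / ε)) μ) ε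
      (mgf (fwd X t (1 / ε)) μ (u - η) + mgf (fwd X t (1 / ε)) μ (u + η)) _ hε.1
      (hMd ε (hsub0 ε hε)) (fun z hz => ?_) (fun z hz => ?_)
    · refine norm_complexMGF_le_of_strip ?_ ?_ hz
      · exact hint ε (hsub0 ε hε) _ (by rw [show u - η - u = -η by ring, abs_neg, abs_of_pos hη]; exact hηr.le)
      · exact hint ε (hsub0 ε hε) _ (by rw [add_sub_cancel_left, abs_of_pos hη]; exact hηr.le)
    · rcases (abs_eq hη.le).1 hz with h | h
      · have hz' : z = ⟨u + η, z.im⟩ := Complex.ext (by simp; linarith) rfl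
        rw [hz']
        exact (hK₂ ε ⟨hε.1, hε.2.trans_le ((min_le_right _ _).trans (min_le_right _ _))⟩ _).trans
          (le_max_right _ _)
      · have hz' : z = ⟨u - η, z.im⟩ := Complex.ext (by simp; linarith) rfl
        rw [hz']
        exact (hK₁ ε ⟨hε.1, hε.2.trans_le ((min_le_right _ _).trans (min_le_left _ _))⟩ _).trans
          (le_max_left _ _)
  have hAd : ∀ ε ∈ Set.Ioo 0 ε₁,
      DifferentiableOn ℂ (amplitude μ X t G ε) {z : ℂ | |z.re - u| < r} := fun ε hε =>
    (hMd ε (hsub0 ε hε)).mul ((hGd.neg.div_const _).cexp)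
  have hpoint : ∀ x : ℝ, |x - u| < r → ∃ C' : ℝ, ∀ᶠ ε : ℝ in 𝓝[>] (0 : ℝ),
    ‖amplitude μ X t G ε x - (Real.exp (Λ₁ x) + (Real.exp (Λ₁ x) * Λ₂ x : ℝ) * ε)‖
      ≤ C' * ε ^ 2 := by
    intro x hx
    obtain ⟨C', hC'⟩ := exp_div_expansion (hΛ.expansion x (hrS x hx.le).1)
    refine ⟨C', ?_⟩
    filter_upwards [hC', Ioo_mem_nhdsGT hε₀] with ε h1 h2
    have hε : ε ≠ 0 := h2.1.ne'
    have hpos : 0 < mgf (fwd X t (1 / ε)) μ x := mgf_pos (hint ε h2 x hx.le)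
    have hamp : amplitude μ X t G ε x =
        ((Real.exp ((lmgf μ (largeMaturityFamily X t) ε x - Λ₀ x) / ε) : ℝ) : ℂ) := by
      rw [amplitude, complexMGF_ofReal, hGreal x (hrS x hx.le).1 (hrS x hx.le).2,
        lmgf_largeMaturityFamily hε, sub_div, mul_div_cancel_left₀ _ hε, sub_eq_add_neg,
        Real.exp_add, Real.exp_log hpos, Complex.ofReal_mul, Complex.ofReal_exp (-(Λ₀ x / ε))]
      congr 2
      push_cast; ring
    rw [hamp, ← Complex.ofReal_mul, ← Complex.ofReal_add, ← Complex.ofReal_sub, Complex.norm_real]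
    exact h1
  have hball : ∀ z ∈ Metric.ball (u : ℂ) η, |z.re - u| < η := fun z hz =>
    abs_re_sub_lt_of_mem_ball hz
  obtain ⟨a, C, ε₂, F₀, ha, haη, hε₂, hε₂₁, hF₀, hrate⟩ := exists_holomorphic_limit
    (F := amplitude μ X t G) (c := u) (R := η) (K := max K₁ K₂) (ε₀ := ε₁) hη hε₁0
    (fun ε hε => (hAd ε hε).mono fun z hz => (hball z hz).trans hηr)
    (fun ε hε z hz => hbound ε hε z (hball z hz).le)
    (fun x hx => by
      obtain ⟨C', hC'⟩ := hpoint x (hx.trans hηr)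
      exact ⟨_, _, C', hC'⟩)
  have har : a < r := haη.trans_lt hηr
  have hsub2 : ∀ ε ∈ Set.Ioo 0 ε₂, ε ∈ Set.Ioo 0 ε₁ := fun ε hε => ⟨hε.1, hε.2.trans_le hε₂₁⟩
  refine ⟨G, F₀, a, ε₂, max K₁ K₂, C, ⟨ha, hε₂, ?_, ?_, ?_, ?_, ?_, ?_, ?_, ?_, hF₀, hrate, ?_⟩⟩
  · exact fun p hp => (hrS p (hp.trans har).le).1
  · exact hGd.mono fun z hz => lt_trans hz har
  · exact fun x hx => hGreal x (hrS x (hx.trans har).le).1 (hrS x (hx.trans har).le).2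
  · exact fun z hz => hre z (hz.trans har)
  · intro δ hδ
    obtain ⟨-, h2, ⟨d, R, hd, hR⟩, -⟩ := hGtail u hu hu0
    have hval : (G ⟨u, 0⟩).re = Λ₀ u := by
      have : (⟨u, 0⟩ : ℂ) = (u : ℂ) := rfl
      rw [this, hGreal u hu hu0, Complex.ofReal_re]
    have hcont : ContinuousOn (fun q : ℝ => (G (u + q * Complex.I)).re) Set.univ := by
      refine Complex.continuous_re.comp_continuousOn (hGd.continuousOn.comp (by fun_prop) ?_)
      intro q _
      simp [hr]
    -- Beyond R the gap is assumed; on the compact remainder it comes from the strict maximum at q =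
    -- 0. The radius max R δ keeps this set nonempty.
    set T := {q : ℝ | δ ≤ |q|} ∩ Metric.closedBall 0 (max R δ) with hT
    have hTc : IsCompact T :=
      (isCompact_closedBall _ _).inter_left (isClosed_le continuous_const continuous_abs)
    have hTne : T.Nonempty := ⟨δ, by simp [abs_of_pos hδ], by
      rw [Metric.mem_closedBall, Real.dist_eq, sub_zero, abs_of_pos hδ]; exact le_max_right _ _⟩
    obtain ⟨q₀, hq₀, hmax⟩ := hTc.exists_isMaxOn hTne (hcont.mono (Set.subset_univ _))
    have hq₀0 : q₀ ≠ 0 := by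
      intro h
      have : δ ≤ |q₀| := hq₀.1
      rw [h, abs_zero] at this
      linarith
    have hlt := h2 q₀ hq₀0
    rw [hval, Complex.mk_eq_add_mul_I] at hlt
    refine ⟨min d (Λ₀ u - (G (u + q₀ * Complex.I)).re), lt_min hd (by linarith), fun q hq => ?_⟩
    rcases le_total R |q| with h | h
    · have := hR q h
      rw [hval, Complex.mk_eq_add_mul_I] at this
      linarith [min_le_left d (Λ₀ u - (G (u + q₀ * Complex.I)).re)]
    · have : q ∈ T := ⟨hq, by
        rw [Metric.mem_closedBall, Real.dist_eq, sub_zero]; exact h.trans (le_max_left _ _)⟩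
      have h5 : (G (u + q * Complex.I)).re ≤ (G (u + q₀ * Complex.I)).re := hmax this
      linarith [min_le_right d (Λ₀ u - (G (u + q₀ * Complex.I)).re)]
  · exact fun ε hε p hp => hint ε (hsub0 ε (hsub2 ε hε)) p (hp.trans har).le
  · exact fun ε hε => (hAd ε (hsub2 ε hε)).mono fun z hz => lt_trans hz har
  · exact fun ε hε z hz => hbound ε (hsub2 ε hε) z (hz.le.trans haη)
  · exact fun x hx => hpoint x (hx.trans har)

end

/-! ### Second order expansion of out-of-the-money prices -/

section

variable {Ω : Type*} [MeasurableSpace Ω] {μ : Measure Ω} {X : ℝ → Ω → ℝ} {t : ℝ}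
  {S : Set ℝ} {Λ₀ Λ₁ Λ₂ : ℝ → ℝ} {u : ℝ} {G F₀ : ℂ → ℂ} {r ε₁ K C : ℝ}

lemma tendsto_mul_pow_nhdsGT (C : ℝ) {n : ℕ} (hn : n ≠ 0) :
    Tendsto (fun ε : ℝ => C * ε ^ n) (𝓝[>] 0) (𝓝 0) := by
  have : Tendsto (fun ε : ℝ => C * ε ^ n) (𝓝 0) (𝓝 (C * 0 ^ n)) := Continuous.tendsto (by fun_prop) 0
  rw [zero_pow hn, mul_zero] at this
  exact this.mono_left nhdsWithin_le_nhds

/-- At a real point the holomorphic limit and the pointwise expansion are limits of the same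
quantity. -/
lemma AmplitudeControl.limit_real (h : AmplitudeControl μ X t S Λ₀ Λ₁ Λ₂ u G F₀ r ε₁ K C) {x : ℝ}
    (hx : |x - u| < r) : F₀ x = (Real.exp (Λ₁ x) : ℝ) := by
  have hxb : (x : ℂ) ∈ Metric.ball (u : ℂ) r := by
    rwa [Metric.mem_ball, Complex.dist_eq, ← Complex.ofReal_sub, Complex.norm_real]
  obtain ⟨C', hC'⟩ := h.pointwise x hx
  have h1 : Tendsto (fun ε : ℝ => amplitude μ X t G ε x - F₀ x) (𝓝[>] 0) (𝓝 0) := by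
    refine squeeze_zero_norm' ?_ (tendsto_mul_pow_nhdsGT C one_ne_zero)
    filter_upwards [Ioo_mem_nhdsGT h.eps_pos] with ε hε
    rw [pow_one]
    exact h.rate ε hε x hxb
  have h2 : Tendsto (fun ε : ℝ => amplitude μ X t G ε x -
      (Real.exp (Λ₁ x) + (Real.exp (Λ₁ x) * Λ₂ x : ℝ) * ε)) (𝓝[>] 0) (𝓝 0) :=
    squeeze_zero_norm' hC' (tendsto_mul_pow_nhdsGT C' two_ne_zero)
  have h3 : Tendsto (fun ε : ℝ => (Real.exp (Λ₁ x) : ℂ) + (Real.exp (Λ₁ x) * Λ₂ x : ℝ) * ε) (𝓝[>] 0)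
      (𝓝 (Real.exp (Λ₁ x) : ℂ)) := by
    have : Tendsto (fun ε : ℝ => (Real.exp (Λ₁ x) : ℂ) + (Real.exp (Λ₁ x) * Λ₂ x : ℝ) * ε) (𝓝 0)
      (𝓝 ((Real.exp (Λ₁ x) : ℂ) + (Real.exp (Λ₁ x) * Λ₂ x : ℝ) * (0 : ℝ))) :=
      Continuous.tendsto (by fun_prop) 0
    simp only [Complex.ofReal_zero, mul_zero, add_zero] at this
    exact this.mono_left nhdsWithin_le_nhds
  have h4 := tendsto_nhds_unique ((h3.add h2).sub h1) (by
    refine (tendsto_const_nhds (x := F₀ x)).congr fun ε => ?_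
    ring)
  simpa using h4.symm

/-- The standing assumption does not ask for smoothness of Λ₁. It holds because exp Λ₁ is the
restriction of the holomorphic F₀ to the real axis; the derivatives of Λ₁ in Υ are therefore genuine
ones. -/
lemma AmplitudeControl.contDiffAt (h : AmplitudeControl μ X t S Λ₀ Λ₁ Λ₂ u G F₀ r ε₁ K C) :
    ContDiffAt ℝ ∞ Λ₁ u := by
  have han : AnalyticAt ℂ F₀ u := h.diffLim.analyticAt (Metric.ball_mem_nhds _ h.r_pos)
  have hre : ContDiffAt ℝ ∞ (fun x : ℝ => (F₀ x).re) u := han.contDiffAt.real_of_complex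
  have hu : |u - u| < r := by simpa using h.r_pos
  have hlog := hre.log (by rw [h.limit_real hu, Complex.ofReal_re]; exact (Real.exp_pos _).ne')
  refine hlog.congr_of_eventuallyEq ?_
  filter_upwards [Metric.ball_mem_nhds u h.r_pos] with x hx
  rw [h.limit_real (by rwa [Metric.mem_ball, Real.dist_eq] at hx), Complex.ofReal_re, Real.log_exp]

/-- First two derivatives of `exp (f x) / (x (x - 1))`. -/
lemma derivs_exp_div {f : ℝ → ℝ} (hf : ContDiffAt ℝ ∞ f u) (hu0 : u ≠ 0) (hu1 : u ≠ 1) :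
    deriv (fun x => Real.exp (f x) * (1 / (x * (x - 1)))) u =
      Real.exp (f u) * (1 / (u * (u - 1))) * (deriv f u - 1 / u - 1 / (u - 1)) ∧
    iteratedDeriv 2 (fun x => Real.exp (f x) * (1 / (x * (x - 1)))) u =
      Real.exp (f u) * (1 / (u * (u - 1))) * ((deriv f u - 1 / u - 1 / (u - 1)) ^ 2
        + iteratedDeriv 2 f u + 1 / u ^ 2 + 1 / (u - 1) ^ 2) := by
  have hfd : ∀ᶠ x in 𝓝 u, HasDerivAt f (deriv f x) x := by
    have h2 : ContDiffAt ℝ 1 f u := hf.of_le (by exact_mod_cast le_top)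
    filter_upwards [h2.eventually (by simp)] with x hx
    exact (hx.differentiableAt (by simp)).hasDerivAt
  have hf2 : HasDerivAt (deriv f) (iteratedDeriv 2 f u) u := by
    rw [iteratedDeriv_succ, iteratedDeriv_one]
    have : ContDiffAt ℝ 1 (deriv f) u := by
      have h2 := (hf.fderiv_right (m := 1) (WithTop.coe_le_coe.2 (le_top : (1 + 1 : ℕ∞) ≤ ⊤))).clm_apply
        (contDiffAt_const (c := (1 : ℝ)))
      simpa using h2
    exact (this.differentiableAt (by simp)).hasDerivAt
  have hev : ∀ᶠ x in 𝓝 u, HasDerivAt (fun x => Real.exp (f x) * (1 / (x * (x - 1))))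
      (Real.exp (f x) * (1 / (x * (x - 1))) * (deriv f x - 1 / x - 1 / (x - 1))) x := by
    filter_upwards [hfd, isOpen_ne.mem_nhds hu0, isOpen_ne.mem_nhds hu1] with x hx h0 h1
    have h0 : x ≠ 0 := h0
    have h1' : x - 1 ≠ 0 := sub_ne_zero.2 h1
    have hq : HasDerivAt (fun x : ℝ => x * (x - 1)) (1 * (x - 1) + x * 1) x :=
      (hasDerivAt_id x).mul ((hasDerivAt_id x).sub_const 1)
    have := hx.exp.mul ((hasDerivAt_const x (1 : ℝ)).div hq (mul_ne_zero h0 h1'))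
    refine this.congr_deriv ?_
    simp only [Pi.div_apply]
    field_simp
    ring
  have hu1' : u - 1 ≠ 0 := sub_ne_zero.2 hu1
  refine ⟨hev.self_of_nhds.deriv, ?_⟩
  rw [iteratedDeriv_succ, iteratedDeriv_one]
  have heq : deriv (fun x => Real.exp (f x) * (1 / (x * (x - 1)))) =ᶠ[𝓝 u] fun x =>
      Real.exp (f x) * (1 / (x * (x - 1))) * (deriv f x - 1 / x - 1 / (x - 1)) :=
    hev.mono fun x hx => hx.deriv
  rw [heq.deriv_eq]
  have hi0 : HasDerivAt (fun x : ℝ => 1 / x) (-(1 / u ^ 2)) u := by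
    simpa using hasDerivAt_inv hu0
  have hi1 : HasDerivAt (fun x : ℝ => 1 / (x - 1)) (-(1 / (u - 1) ^ 2)) u := by
    have := ((hasDerivAt_id u).sub_const 1).fun_inv hu1'
    simpa [neg_div] using this
  have := hev.self_of_nhds.mul ((hf2.sub hi0).sub hi1)
  refine (HasDerivAt.deriv this).trans ?_
  simp only [Pi.sub_apply]
  ring

/-- The left side is the relative Laplace correction for the amplitude exp Λ₁ / (z (z - 1)). The
parameter v₂ cancels on the right; it is there so that the bracket matches `Upsilon` literally, with
v₂ in the place of Λ₂ u. -/
lemma Upsilon_eq {a A B g3 g4 v₂ : ℝ} (ha : a ≠ 0) (hu0 : u ≠ 0) (hu1 : u - 1 ≠ 0) :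
    -((A - 1 / u - 1 / (u - 1)) ^ 2 + B + 1 / u ^ 2 + 1 / (u - 1) ^ 2) / (2 * a)
      + 3 * (g4 / 24 + g3 / 6 * (A - 1 / u - 1 / (u - 1))) / a ^ 2 - 15 * g3 ^ 2 / 72 / a ^ 3 =
    (v₂ - 5 * g3 ^ 2 / (24 * a ^ 3) + (4 * A * g3 + g4) / (8 * a ^ 2)
    - (A ^ 2 + B) / (2 * a) - g3 / (2 * u * a ^ 2) - g3 / (2 * (u - 1) * a ^ 2)
    - (A * (1 - 2 * u) + 3) / (u * (u - 1) * a)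
    - 1 ^ 2 / (u ^ 2 * (u - 1) ^ 2 * a)) - v₂ := by
  field_simp
  ring

lemma AmplitudeControl.iteratedDeriv_eq (h : AmplitudeControl μ X t S Λ₀ Λ₁ Λ₂ u G F₀ r ε₁ K C)
    (n : ℕ) : iteratedDeriv n G u = (iteratedDeriv n Λ₀ u : ℝ) := by
  have hstrip : {z : ℂ | |z.re - u| < r} ∈ 𝓝 (u : ℂ) :=
    mem_of_superset (Metric.ball_mem_nhds _ h.r_pos) fun z hz => abs_re_sub_lt_of_mem_ball hz
  have := eventually_ofReal_iteratedDeriv_eq (G := G) (f := Λ₀) (u := u) (h.diff.analyticAt hstrip) (by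
    filter_upwards [Metric.ball_mem_nhds u h.r_pos] with x hx
    exact (h.real x (by rwa [Metric.mem_ball, Real.dist_eq] at hx)).symm) n
  exact this.self_of_nhds.symm

/-- Strict convexity alone would allow a vanishing second derivative, as for x^4 at 0. It is used
here only to exclude that G is affine near u; the maximum of Re G on vertical lines does the rest.
-/
lemma AmplitudeControl.second_deriv_pos (h : AmplitudeControl μ X t S Λ₀ Λ₁ Λ₂ u G F₀ r ε₁ K C)
    (hconv : StrictConvexOn ℝ S Λ₀) (hd : DifferentiableAt ℝ Λ₀ u) :
    0 < iteratedDeriv 2 Λ₀ u := by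
  have hsub : ∀ z ∈ Metric.ball (u : ℂ) r, |z.re - u| < r := fun z hz =>
    abs_re_sub_lt_of_mem_ball hz
  have h1 := h.iteratedDeriv_eq 1
  rw [iteratedDeriv_one, iteratedDeriv_one] at h1
  refine FwdSmile.second_deriv_pos (k := deriv Λ₀ u) h.r_pos (h.diff.mono hsub)
    (fun z hz => h.re_le z (hsub z hz)) h1 (h.iteratedDeriv_eq 2) ?_
  intro haff
  have huS : u ∈ S := h.mem u (by simpa using h.r_pos)
  have hreal : ∀ᶠ x : ℝ in 𝓝 u, G x = G u + (deriv Λ₀ u : ℝ) * ((x : ℂ) - u) :=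
    (Complex.continuous_ofReal.tendsto u).eventually haff
  obtain ⟨x, ⟨hx1, hx2⟩, hx3⟩ := ((hreal.and (Metric.ball_mem_nhds u h.r_pos)).filter_mono
    (nhdsWithin_le_nhds (s := Set.Ioi u))).and self_mem_nhdsWithin |>.exists
  have hx2' : |x - u| < r := by rwa [Real.dist_eq] at hx2
  have hlt := tangent_lt hconv huS (h.mem x hx2') hd (ne_of_gt hx3)
  rw [h.real x hx2', h.real u (by simpa using h.r_pos)] at hx1
  have : Λ₀ x = Λ₀ u + deriv Λ₀ u * (x - u) := by exact_mod_cast hx1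
  linarith

lemma exp_neg_div_le {d : ℝ} (hd : 0 < d) {ε : ℝ} (hε : 0 < ε) (hε1 : ε ≤ 1) :
    Real.exp (-(d / ε)) ≤ 6 / d ^ 3 * (ε ^ 2 * √ε) := by
  have h := Real.pow_div_factorial_le_exp (d / ε) (by positivity) 3
  have h6 : ((Nat.factorial 3 : ℕ) : ℝ) = 6 := by norm_num [Nat.factorial]
  rw [h6] at h
  have hs : ε ≤ √ε := Real.le_sqrt_of_sq_le (by nlinarith)
  rw [Real.exp_neg]
  calc (Real.exp (d / ε))⁻¹ ≤ ((d / ε) ^ 3 / 6)⁻¹ := inv_anti₀ (by positivity) h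
    _ = 6 / d ^ 3 * (ε ^ 2 * ε) := by field_simp
    _ ≤ _ := by gcongr

/-- The saddlepoint integrand. -/
def saddleIntegrand (μ : Measure Ω) (X : ℝ → Ω → ℝ) (t : ℝ) (G : ℂ → ℂ) (u k ε q : ℝ) : ℂ :=
  Complex.exp ((G (u + q * Complex.I) - G u - k * (q * Complex.I)) / ε) *
    (amplitude μ X t G ε (u + q * Complex.I) *
      (1 / ((u + q * Complex.I : ℂ) * (u + q * Complex.I - 1))))

/-- For |q| ≥ η the gap of Re G makes the integrand at most e^(-d/ε) times an integrable function of
q, and an exponentially small quantity is O(ε² √ε). -/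
lemma AmplitudeControl.tail (h : AmplitudeControl μ X t S Λ₀ Λ₁ Λ₂ u G F₀ r ε₁ K C) (hu0 : u ≠ 0)
    (hu1 : u ≠ 1) (k : ℝ) {η : ℝ} (hη : 0 < η) :
    ∃ C' : ℝ, ∀ ε ∈ Set.Ioo 0 (min ε₁ 1),
      ‖(∫ q, saddleIntegrand μ X t G u k ε q) - ∫ q in (-η)..η, saddleIntegrand μ X t G u k ε q‖
        ≤ C' * (ε ^ 2 * √ε) := by
  obtain ⟨d, hd, hgap⟩ := h.gap η hη
  obtain ⟨B, hB0, hB⟩ := norm_inv_mul_sub_one_le hu0 hu1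
  have huu : |u - u| < r := by simpa using h.r_pos
  have hlineS : ∀ q : ℝ, |(u + q * Complex.I : ℂ).re - u| < r := fun q => by simpa using h.r_pos
  refine ⟨6 / d ^ 3 * (K * B * Real.pi), fun ε hε => ?_⟩
  have hε0 : 0 < ε := hε.1
  have hε' : ε ∈ Set.Ioo 0 ε₁ := ⟨hε.1, hε.2.trans_le (min_le_left _ _)⟩
  have hK0 : 0 ≤ K := (norm_nonneg _).trans (h.bound ε hε' u (by simpa using h.r_pos))
  have hΨ : ∀ q : ℝ, ‖saddleIntegrand μ X t G u k ε q‖ ≤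
      Real.exp (((G (u + q * Complex.I)).re - Λ₀ u) / ε) * (K * (B * (1 + q ^ 2)⁻¹)) := by
    intro q
    rw [saddleIntegrand, norm_mul, norm_mul, Complex.norm_exp]
    have e1 : ((G (u + q * Complex.I) - G u - k * (q * Complex.I)) / ε : ℂ).re =
        ((G (u + q * Complex.I)).re - Λ₀ u) / ε := by
      rw [Complex.div_ofReal_re, h.real u huu]; simp
    rw [e1]
    gcongr
    · exact h.bound ε hε' _ (hlineS q)
    · exact hB q
  have hle : ∀ q : ℝ, (G (u + q * Complex.I)).re - Λ₀ u ≤ 0 := by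
    intro q
    have := h.re_le _ (hlineS q)
    have e2 : ((u + q * Complex.I : ℂ).re : ℂ) = (u : ℂ) := by simp
    rw [e2, h.real u huu, Complex.ofReal_re] at this
    linarith
  have hcont : Continuous (saddleIntegrand μ X t G u k ε) := by
    have hc1 : Continuous fun q : ℝ => G (u + q * Complex.I) := by
      rw [← continuousOn_univ]
      exact h.diff.continuousOn.comp (by fun_prop) fun q _ => hlineS q
    have hc2 : Continuous fun q : ℝ => amplitude μ X t G ε (u + q * Complex.I) := by
      rw [← continuousOn_univ]
      exact (h.diffAmp ε hε').continuousOn.comp (by fun_prop) fun q _ => hlineS q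
    have hc3 : Continuous fun q : ℝ => 1 / ((u + q * Complex.I : ℂ) * (u + q * Complex.I - 1)) :=
      Continuous.div (by fun_prop) (by fun_prop) fun q =>
        mul_ne_zero (add_mul_I_ne hu0 hu1 q).1 (add_mul_I_ne hu0 hu1 q).2
    exact (((hc1.sub continuous_const).sub (by fun_prop)).div_const _).cexp.mul (hc2.mul hc3)
  have hgI : Integrable fun q : ℝ => K * (B * (1 + q ^ 2)⁻¹) :=
    (integrable_inv_one_add_sq.const_mul B).const_mul K
  have hint : Integrable (saddleIntegrand μ X t G u k ε) := by
    refine hgI.mono' hcont.aestronglyMeasurable (Eventually.of_forall fun q => (hΨ q).trans ?_)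
    exact mul_le_of_le_one_left (by positivity)
      (Real.exp_le_one_iff.2 (div_nonpos_of_nonpos_of_nonneg (hle q) hε0.le))
  have hsplit := integral_add_compl (s := Set.Ioc (-η) η) measurableSet_Ioc hint
  rw [intervalIntegral.integral_of_le (by linarith), ← hsplit, add_sub_cancel_left]
  have hbd : ‖∫ q in (Set.Ioc (-η) η)ᶜ, saddleIntegrand μ X t G u k ε q‖ ≤
      ∫ q in (Set.Ioc (-η) η)ᶜ, Real.exp (-(d / ε)) * (K * (B * (1 + q ^ 2)⁻¹)) := by
    refine norm_integral_le_of_norm_le ((hgI.const_mul _).integrableOn) ?_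
    refine (ae_restrict_iff' measurableSet_Ioc.compl).2 (Eventually.of_forall fun q hq => ?_)
    have hq' : η ≤ |q| := by
      by_contra hcon
      push Not at hcon
      exact hq ⟨(abs_lt.1 hcon).1, (abs_lt.1 hcon).2.le⟩
    refine (hΨ q).trans ?_
    gcongr
    rw [← neg_div]
    gcongr
    linarith [hgap q hq']
  refine hbd.trans ?_
  have hfull : ∫ q in (Set.Ioc (-η) η)ᶜ, Real.exp (-(d / ε)) * (K * (B * (1 + q ^ 2)⁻¹)) ≤
      ∫ q, Real.exp (-(d / ε)) * (K * (B * (1 + q ^ 2)⁻¹)) :=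
    setIntegral_le_integral (hgI.const_mul _) (Eventually.of_forall fun q => by
      simp only [Pi.zero_apply]; positivity)
  refine hfull.trans ?_
  rw [integral_const_mul, integral_const_mul, integral_const_mul, integral_univ_inv_one_add_sq]
  calc Real.exp (-(d / ε)) * (K * (B * Real.pi)) ≤
      6 / d ^ 3 * (ε ^ 2 * √ε) * (K * (B * Real.pi)) := by
        have := exp_neg_div_le hd hε0 (hε.2.le.trans (min_le_right _ _))
        have := Real.pi_pos
        gcongr
    _ = _ := by ring

/-- Laplace's method with amplitude F_ε(z) / (z (z - 1)). The part Λ₂ of Υ comes from the pointwise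
expansion of F_ε at u, the remaining terms from the Gaussian correction with the limit amplitude. -/
lemma AmplitudeControl.local_expansion (h : AmplitudeControl μ X t S Λ₀ Λ₁ Λ₂ u G F₀ r ε₁ K C)
    (hu0 : u ≠ 0) (hu1 : u ≠ 1) {k : ℝ} (hk : deriv Λ₀ u = k) (ha : 0 < iteratedDeriv 2 Λ₀ u) :
    ∃ η C' : ℝ, 0 < η ∧ ∀ᶠ ε in 𝓝[>] (0 : ℝ),
      ‖(∫ q in (-η)..η, saddleIntegrand μ X t G u k ε q) -
        ((√(2 * Real.pi * ε / iteratedDeriv 2 Λ₀ u) * (Real.exp (Λ₁ u) * (1 / (u * (u - 1)))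
          * (1 + Upsilon Λ₀ Λ₁ Λ₂ 1 u * ε)) : ℝ) : ℂ)‖ ≤ C' * (ε ^ 2 * √ε) := by
  set a := iteratedDeriv 2 Λ₀ u with haD
  set N : ℂ → ℂ := fun z => 1 / (z * (z - 1)) with hN
  have hu0' : 0 < |u| := abs_pos.2 hu0
  have hu1' : 0 < |u - 1| := abs_pos.2 (sub_ne_zero.2 hu1)
  -- The disc must stay away from the poles 0 and 1 of the payoff transform.
  set ρ := min r (min (|u| / 2) (|u - 1| / 2)) with hρ
  have hρ0 : 0 < ρ := lt_min h.r_pos (lt_min (by linarith) (by linarith))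
  have hρr : ρ ≤ r := min_le_left _ _
  have hlow : ∀ z ∈ Metric.ball (u : ℂ) ρ, |u| / 2 ≤ ‖z‖ ∧ |u - 1| / 2 ≤ ‖z - 1‖ := by
    intro z hz
    rw [Metric.mem_ball, Complex.dist_eq] at hz
    have h1 : ‖z - u‖ < |u| / 2 := hz.trans_le ((min_le_right _ _).trans (min_le_left _ _))
    have h2 : ‖z - u‖ < |u - 1| / 2 := hz.trans_le ((min_le_right _ _).trans (min_le_right _ _))
    have h3 : |u| ≤ ‖z - u‖ + ‖z‖ := by
      rw [← Real.norm_eq_abs, ← Complex.norm_real, norm_sub_rev]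
      calc ‖(u : ℂ)‖ = ‖(u - z) + z‖ := by ring_nf
        _ ≤ _ := norm_add_le _ _
    have h4 : |u - 1| ≤ ‖z - u‖ + ‖z - 1‖ := by
      rw [← Real.norm_eq_abs, ← Complex.norm_real, norm_sub_rev]
      calc ‖((u - 1 : ℝ) : ℂ)‖ = ‖(u - z) + (z - 1)‖ := by push_cast; ring_nf
        _ ≤ _ := norm_add_le _ _
    constructor <;> linarith
  have hne : ∀ z ∈ Metric.ball (u : ℂ) ρ, z * (z - 1) ≠ 0 := fun z hz =>
    mul_ne_zero (norm_pos_iff.1 (lt_of_lt_of_le (by linarith) (hlow z hz).1))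
      (norm_pos_iff.1 (lt_of_lt_of_le (by linarith) (hlow z hz).2))
  set B := 4 / (|u| * |u - 1|) with hB
  have hNb : ∀ z ∈ Metric.ball (u : ℂ) ρ, ‖N z‖ ≤ B := by
    intro z hz
    simp only [hN, norm_div, norm_one, norm_mul]
    rw [hB, div_le_div_iff₀ (norm_mul z _ ▸ norm_pos_iff.2 (hne z hz)) (by positivity), one_mul]
    have := mul_le_mul (hlow z hz).1 (hlow z hz).2 (by positivity) (norm_nonneg _)
    linarith
  have hNd : DifferentiableOn ℂ N (Metric.ball (u : ℂ) ρ) := by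
    refine DifferentiableOn.div (by fun_prop) (by fun_prop) hne
  have hsub : Metric.ball (u : ℂ) ρ ⊆ Metric.ball (u : ℂ) r := Metric.ball_subset_ball hρr
  have hsubS : ∀ z ∈ Metric.ball (u : ℂ) ρ, |z.re - u| < r := fun z hz =>
    abs_re_sub_lt_of_mem_ball (hsub hz)
  have hK0 : 0 ≤ K := (norm_nonneg _).trans (h.bound (ε₁ / 2)
    ⟨by linarith [h.eps_pos], by linarith [h.eps_pos]⟩ u (by simpa using h.r_pos))
  have hG1 : deriv G u = k := by
    have := h.iteratedDeriv_eq 1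
    rwa [iteratedDeriv_one, iteratedDeriv_one, hk] at this
  have hα₀d : DifferentiableOn ℂ (fun z => F₀ z * N z) (Metric.ball (u : ℂ) ρ) :=
    (h.diffLim.mono hsub).mul hNd
  obtain ⟨η, C₁, hη, -, hlap⟩ := laplace_expansion (G := G) (u := u) (k := k) (a := a) (K := K * B)
    (C₀ := C * B) (ε₀ := ε₁) (α := fun ε z => amplitude μ X t G ε z * N z)
    (α₀ := fun z => F₀ z * N z) hρ0 ha h.eps_pos (h.diff.mono hsubS) hG1 (h.iteratedDeriv_eq 2)
    (fun ε hε => ((h.diffAmp ε hε).mono hsubS).mul hNd) hα₀d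
    (fun ε hε z hz => by
      rw [norm_mul]
      exact mul_le_mul (h.bound ε hε z (hsubS z hz)) (hNb z hz) (norm_nonneg _) hK0)
    (fun ε hε z hz => by
      rw [← sub_mul, norm_mul, mul_right_comm]
      exact mul_le_mul (h.rate ε hε z (hsub hz)) (hNb z hz) (norm_nonneg _)
        ((norm_nonneg _).trans (h.rate ε hε z (hsub hz))))
  have hℓ : ∀ x : ℝ, |x - u| < r →
      ((Real.exp (Λ₁ x) * (1 / (x * (x - 1))) : ℝ) : ℂ) = F₀ x * N x := by
    intro x hx
    rw [h.limit_real hx]; simp only [hN]; push_cast; ring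
  have hev := eventually_ofReal_iteratedDeriv_eq (G := fun z => F₀ z * N z)
    (f := fun x => Real.exp (Λ₁ x) * (1 / (x * (x - 1)))) (u := u)
    (hα₀d.analyticAt (Metric.ball_mem_nhds _ hρ0)) (by
      filter_upwards [Metric.ball_mem_nhds u h.r_pos] with x hx
      exact hℓ x (by rwa [Metric.mem_ball, Real.dist_eq] at hx))
  have d1 := (hev 1).self_of_nhds
  have d2 := (hev 2).self_of_nhds
  obtain ⟨e1, e2⟩ := derivs_exp_div h.contDiffAt hu0 hu1
  rw [iteratedDeriv_one, iteratedDeriv_one, e1] at d1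
  rw [e2] at d2
  have huu : |u - u| < r := by simpa using h.r_pos
  set ℓ := Real.exp (Λ₁ u) * (1 / (u * (u - 1))) with hℓu
  have d0 : F₀ u * N u = (ℓ : ℂ) := (hℓ u huu).symm
  obtain ⟨C₂, hC₂⟩ := h.pointwise u huu
  refine ⟨η, C₁ + √(2 * Real.pi / a) * (C₂ * B), hη, ?_⟩
  filter_upwards [hC₂, Ioo_mem_nhdsGT h.eps_pos] with ε hptw hε
  have hε0 : 0 < ε := hε.1
  have hl := hlap ε hε
  rw [d0, ← d1, ← d2, h.iteratedDeriv_eq 3, h.iteratedDeriv_eq 4] at hl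
  have hΥ := Upsilon_eq (u := u) (a := a) (A := deriv Λ₁ u) (B := iteratedDeriv 2 Λ₁ u)
    (g3 := iteratedDeriv 3 Λ₀ u) (g4 := iteratedDeriv 4 Λ₀ u) (v₂ := Λ₂ u) ha.ne' hu0
    (sub_ne_zero.2 hu1)
  set Υ := Upsilon Λ₀ Λ₁ Λ₂ 1 u with hΥd
  set s := √(2 * Real.pi * ε / a) with hs
  have hs' : s = √(2 * Real.pi / a) * √ε := by
    rw [hs, ← Real.sqrt_mul (by positivity)]; congr 1; ring
  set c₁ : ℝ := ℓ * (Υ - Λ₂ u) with hc₁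
  have hc₁' : (c₁ : ℂ) = -((ℓ * ((deriv Λ₁ u - 1 / u - 1 / (u - 1)) ^ 2
        + iteratedDeriv 2 Λ₁ u + 1 / u ^ 2 + 1 / (u - 1) ^ 2) : ℝ) : ℂ) / (2 * a)
          + 3 * ((iteratedDeriv 4 Λ₀ u : ℝ) / 24 * (ℓ : ℂ) + (iteratedDeriv 3 Λ₀ u : ℝ) / 6 *
            ((ℓ * (deriv Λ₁ u - 1 / u - 1 / (u - 1)) : ℝ) : ℂ)) / a ^ 2
          - 15 * ((iteratedDeriv 3 Λ₀ u : ℝ) : ℂ) ^ 2 / 72 * ℓ / a ^ 3 := by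
    have : c₁ = -(ℓ * ((deriv Λ₁ u - 1 / u - 1 / (u - 1)) ^ 2
        + iteratedDeriv 2 Λ₁ u + 1 / u ^ 2 + 1 / (u - 1) ^ 2)) / (2 * a)
          + 3 * (iteratedDeriv 4 Λ₀ u / 24 * ℓ + iteratedDeriv 3 Λ₀ u / 6 *
            (ℓ * (deriv Λ₁ u - 1 / u - 1 / (u - 1)))) / a ^ 2
          - 15 * (iteratedDeriv 3 Λ₀ u) ^ 2 / 72 * ℓ / a ^ 3 := by
      rw [hc₁, hΥd, Upsilon]
      rw [← hΥ]; ring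
    rw [this]; push_cast; ring
  rw [← hc₁'] at hl
  have hmain : ((s * (ℓ * (1 + Υ * ε)) : ℝ) : ℂ) =
      (s : ℂ) * ((ℓ * (1 + Λ₂ u * ε) : ℝ) + ε * c₁) := by
    rw [hc₁]; push_cast; ring
  have hamp : ‖amplitude μ X t G ε u * N u - ((ℓ * (1 + Λ₂ u * ε) : ℝ) : ℂ)‖ ≤ C₂ * B * ε ^ 2 := by
    have e3 : amplitude μ X t G ε u * N u - ((ℓ * (1 + Λ₂ u * ε) : ℝ) : ℂ) =
        (amplitude μ X t G ε u - (Real.exp (Λ₁ u) + (Real.exp (Λ₁ u) * Λ₂ u : ℝ) * ε)) * N u := by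
      rw [hℓu]; simp only [hN]; push_cast; ring
    rw [e3, norm_mul]
    calc _ ≤ C₂ * ε ^ 2 * B := mul_le_mul hptw (hNb u (by simp [hρ0])) (norm_nonneg _)
          ((norm_nonneg _).trans hptw)
      _ = _ := by ring
  have hJ : (∫ q in (-η)..η, saddleIntegrand μ X t G u k ε q) = ∫ q in (-η)..η,
      Complex.exp ((G (u + q * Complex.I) - G u - k * (q * Complex.I)) / ε) *
          (amplitude μ X t G ε (u + q * Complex.I) * N (u + q * Complex.I)) := rfl
  rw [hJ, hmain]
  refine (norm_sub_le_norm_sub_add_norm_sub _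
    ((s : ℂ) * (amplitude μ X t G ε u * N u + ε * c₁)) _).trans ?_
  have h7 : ‖(s : ℂ) * (amplitude μ X t G ε u * N u + ε * c₁) -
      (s : ℂ) * ((ℓ * (1 + Λ₂ u * ε) : ℝ) + ε * c₁)‖ ≤ √(2 * Real.pi / a) * (C₂ * B) * (ε ^ 2 * √ε) := by
    rw [← mul_sub, norm_mul, Complex.norm_real, Real.norm_of_nonneg (Real.sqrt_nonneg _), ← hs, hs',
      add_sub_add_right_eq_sub]
    calc _ ≤ √(2 * Real.pi / a) * √ε * (C₂ * B * ε ^ 2) := by gcongr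
      _ = _ := by ring
  linarith

/-- The out-of-the-money-type price attached to the line `Re z = u`: the call for `u > 1`, the
covered call for `0 < u < 1`, the put for `u < 0`. -/
def otmPrice (u κ c : ℝ) : ℝ := c - (if u < 1 then 1 else 0) + (if u < 0 then 1 else 0) * Real.exp κ

/-- Second order expansion of out-of-the-money prices. -/
theorem AmplitudeControl.price_expansion [IsProbabilityMeasure μ]
    (h : AmplitudeControl μ X t S Λ₀ Λ₁ Λ₂ u G F₀ r ε₁ K C)
    (hX : ∀ s : ℝ, 0 ≤ s → Measurable (X s)) (ht : 0 ≤ t)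
    (hmean : ∀ τ : ℝ, 0 < τ → ∫ a, Real.exp (fwd X t τ a) ∂μ = 1)
    (hu0 : u ≠ 0) (hu1 : u ≠ 1) {k : ℝ} (hk : deriv Λ₀ u = k) (ha : 0 < iteratedDeriv 2 Λ₀ u) :
    ∃ C' : ℝ, ∀ᶠ ε in 𝓝[>] (0 : ℝ),
      |otmPrice u (k / ε) (fwdCall μ X t (1 / ε) (k / ε)) -
        Real.exp ((k - (u * k - Λ₀ u)) / ε) * √ε * (Real.exp (Λ₁ u) / (u * (u - 1) *
          √(2 * Real.pi * iteratedDeriv 2 Λ₀ u))) * (1 + Upsilon Λ₀ Λ₁ Λ₂ 1 u * ε)| ≤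
      C' * (Real.exp ((k - (u * k - Λ₀ u)) / ε) * √ε * ε ^ 2) := by
  obtain ⟨η, C₁, hη, hloc⟩ := h.local_expansion hu0 hu1 hk ha
  obtain ⟨C₂, htail⟩ := h.tail hu0 hu1 k hη
  have hmin : 0 < min ε₁ 1 := lt_min h.eps_pos one_pos
  refine ⟨1 / (2 * Real.pi) * (C₂ + C₁), ?_⟩
  filter_upwards [hloc, Ioo_mem_nhdsGT hmin] with ε hl hε
  have hε0 : 0 < ε := hε.1
  have hε1 : ε ∈ Set.Ioo 0 ε₁ := ⟨hε.1, hε.2.trans_le (min_le_left _ _)⟩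
  have hεc : (ε : ℂ) ≠ 0 := by exact_mod_cast hε0.ne'
  have huu : |u - u| < r := by simpa using h.r_pos
  have hprice := price_eq_integral (μ := μ) (measurable_fwd hX ht (by positivity : 0 ≤ 1 / ε))
    (hmean (1 / ε) (by positivity)) hu0 hu1 (h.integrable ε hε1 u huu) (k / ε)
  set a := iteratedDeriv 2 Λ₀ u with haD
  set E := Real.exp ((k - (u * k - Λ₀ u)) / ε) with hE
  -- With z = u + iq, the exponent k(1 - z) + G(z) splits into the constant k - (uk - Λ₀(u)), pulled
  -- out as E, and G(z) - G(u) - k iq, which has a critical point at q = 0.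
  have hfac : ∀ q : ℝ, Complex.exp (((k / ε : ℝ) : ℂ) - (u + q * Complex.I) * ((k / ε : ℝ) : ℂ)) *
        complexMGF (fwd X t (1 / ε)) μ (u + q * Complex.I) *
        (1 / ((u + q * Complex.I : ℂ) * (u + q * Complex.I - 1))) =
      (E : ℂ) * saddleIntegrand μ X t G u k ε q := by
    intro q
    have e1 : Complex.exp (((k / ε : ℝ) : ℂ) - (u + q * Complex.I) * ((k / ε : ℝ) : ℂ)) =
        (E : ℂ) * Complex.exp ((G (u + q * Complex.I) - G u - k * (q * Complex.I)) / ε) *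
          Complex.exp (-G (u + q * Complex.I) / ε) := by
      rw [hE, Complex.ofReal_exp, ← Complex.exp_add, ← Complex.exp_add, h.real u huu]
      congr 1
      push_cast
      field_simp
      ring
    rw [e1, saddleIntegrand, amplitude]
    ring
  simp only [hfac] at hprice
  rw [integral_const_mul] at hprice
  have hP : E * √ε * (Real.exp (Λ₁ u) / (u * (u - 1) * √(2 * Real.pi * a))) *
      (1 + Upsilon Λ₀ Λ₁ Λ₂ 1 u * ε) = 1 / (2 * Real.pi) * (E * (√(2 * Real.pi * ε / a) *
        (Real.exp (Λ₁ u) * (1 / (u * (u - 1))) * (1 + Upsilon Λ₀ Λ₁ Λ₂ 1 u * ε)))) := by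
    have e2 : √(2 * Real.pi * ε / a) = 2 * Real.pi * √ε / √(2 * Real.pi * a) := by
      rw [eq_div_iff (by positivity), ← Real.sqrt_mul (by positivity),
        show 2 * Real.pi * ε / a * (2 * Real.pi * a) = (2 * Real.pi) ^ 2 * ε by field_simp,
        Real.sqrt_mul (by positivity), Real.sqrt_sq (by positivity)]
    rw [e2]
    have hu1' : u - 1 ≠ 0 := sub_ne_zero.2 hu1
    field_simp
  rw [otmPrice, fwdCall, hP, ← Real.norm_eq_abs, ← Complex.norm_real, Complex.ofReal_sub, hprice,
    Complex.ofReal_mul, Complex.ofReal_mul E, ← mul_sub, ← mul_sub, norm_mul, norm_mul,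
    Complex.norm_real, Complex.norm_real, Real.norm_of_nonneg (by positivity),
    Real.norm_of_nonneg (Real.exp_pos _).le]
  have h8 := norm_sub_le_norm_sub_add_norm_sub (∫ q, saddleIntegrand μ X t G u k ε q)
    (∫ q in (-η)..η, saddleIntegrand μ X t G u k ε q)
    ((√(2 * Real.pi * ε / a) * (Real.exp (Λ₁ u) * (1 / (u * (u - 1)))
          * (1 + Upsilon Λ₀ Λ₁ Λ₂ 1 u * ε)) : ℝ) : ℂ)
  have h9 := htail ε hε
  calc _ ≤ 1 / (2 * Real.pi) * (E * (C₂ * (ε ^ 2 * √ε) + C₁ * (ε ^ 2 * √ε))) := by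
        gcongr
        linarith
    _ = _ := by ring

end

section

/-! ### The Gaussian distribution function -/

/-- The standard Gaussian density. -/
def gaussPdf (x : ℝ) : ℝ := Real.exp (-(x ^ 2 / 2)) / √(2 * Real.pi)

lemma gaussianPDFReal_zero_one (x : ℝ) : gaussianPDFReal 0 1 x = gaussPdf x := by
  simp only [gaussianPDFReal, gaussPdf, NNReal.coe_one, mul_one, sub_zero]
  rw [neg_div, mul_comm, ← div_eq_mul_inv]

lemma gaussPdf_pos (x : ℝ) : 0 < gaussPdf x := by
  unfold gaussPdf; positivity

lemma continuous_gaussPdf : Continuous gaussPdf := by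
  unfold gaussPdf; fun_prop

lemma gaussPdf_neg (x : ℝ) : gaussPdf (-x) = gaussPdf x := by
  simp [gaussPdf]

lemma integrable_gaussPdf : Integrable gaussPdf := by
  have := integrable_gaussianPDFReal 0 1
  rwa [show gaussianPDFReal 0 1 = gaussPdf from funext gaussianPDFReal_zero_one] at this

lemma hasDerivAt_gaussPdf (x : ℝ) : HasDerivAt gaussPdf (-x * gaussPdf x) x := by
  have h1 : HasDerivAt (fun x : ℝ => -(x ^ 2 / 2)) (-x) x := by
    have := ((hasDerivAt_pow 2 x).div_const 2).fun_neg
    refine this.congr_deriv ?_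
    simp
  refine (h1.exp.div_const _).congr_deriv ?_
  rw [gaussPdf]; ring

lemma gaussCdf_eq_integral (x : ℝ) : gaussCdf x = ∫ y in Set.Iic x, gaussPdf y := by
  rw [gaussCdf, cdf_eq_real, measureReal_def, gaussianReal_apply_eq_integral 0 one_ne_zero,
    ENNReal.toReal_ofReal (integral_nonneg fun y => gaussianPDFReal_nonneg _ _ _)]
  simp only [gaussianPDFReal_zero_one]

lemma hasDerivAt_gaussCdf (x : ℝ) : HasDerivAt gaussCdf (gaussPdf x) x := by
  have h : gaussCdf = fun x => gaussCdf 0 + ∫ y in (0 : ℝ)..x, gaussPdf y := by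
    funext x
    rw [← intervalIntegral.integral_Iic_sub_Iic integrable_gaussPdf.integrableOn
      integrable_gaussPdf.integrableOn, gaussCdf_eq_integral x, gaussCdf_eq_integral 0]
    ring
  rw [h]
  exact (intervalIntegral.integral_hasDerivAt_right (continuous_gaussPdf.intervalIntegrable _ _)
    (continuous_gaussPdf.stronglyMeasurableAtFilter _ _) continuous_gaussPdf.continuousAt).const_add _

lemma gaussCdf_add_gaussCdf_neg (x : ℝ) : gaussCdf x + gaussCdf (-x) = 1 := by
  have h1 : gaussCdf (-x) = ∫ y in Set.Ioi x, gaussPdf y := by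
    rw [gaussCdf_eq_integral, ← integral_comp_neg_Ioi]
    simp only [gaussPdf_neg]
  have h2 : ∫ y, gaussPdf y = 1 := by
    rw [← integral_gaussianPDFReal_eq_one 0 one_ne_zero]
    simp only [gaussianPDFReal_zero_one]
  rw [h1, gaussCdf_eq_integral, ← h2, ← Set.compl_Iic]
  exact integral_add_compl measurableSet_Iic integrable_gaussPdf

lemma nonneg_of_deriv_nonpos_of_tendsto {f f' : ℝ → ℝ} (hf : ∀ x, 0 < x → HasDerivAt f (f' x) x)
    (hf' : ∀ x, 0 < x → f' x ≤ 0) (hlim : Tendsto f atTop (𝓝 0)) {x : ℝ} (hx : 0 < x) :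
    0 ≤ f x := by
  have hanti : AntitoneOn f (Set.Ioi 0) :=
    antitoneOn_of_deriv_nonpos (convex_Ioi 0)
      (fun y hy => (hf y hy).continuousAt.continuousWithinAt)
      (fun y hy => (hf y (by simpa using hy)).differentiableAt.differentiableWithinAt)
      (fun y hy => by
        have hy' : 0 < y := by simpa using hy
        rw [(hf y hy').deriv]; exact hf' y hy')
  refine le_of_tendsto hlim ?_
  filter_upwards [eventually_ge_atTop x] with y hy
  exact hanti hx (hx.trans_le hy) hy

lemma tendsto_gaussPdf_mul_inv_pow (n : ℕ) :
    Tendsto (fun x : ℝ => gaussPdf x * (x ^ (n + 1))⁻¹) atTop (𝓝 0) := by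
  have h1 : Tendsto (fun x : ℝ => (x ^ (n + 1))⁻¹) atTop (𝓝 0) :=
    tendsto_inv_atTop_zero.comp (tendsto_pow_atTop (by simp))
  refine squeeze_zero_norm' ?_ h1
  filter_upwards [eventually_gt_atTop 0] with x hx
  rw [Real.norm_of_nonneg (mul_nonneg (gaussPdf_pos x).le (by positivity))]
  refine mul_le_of_le_one_left (by positivity) ?_
  rw [gaussPdf]
  refine div_le_one_of_le₀ ?_ (Real.sqrt_nonneg _)
  have h2 : Real.exp (-(x ^ 2 / 2)) ≤ 1 := Real.exp_le_one_iff.2 (by nlinarith [sq_nonneg x])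
  have h3 : (1 : ℝ) ≤ √(2 * Real.pi) := by
    rw [Real.one_le_sqrt]; nlinarith [Real.pi_gt_three]
  exact h2.trans h3

lemma tendsto_gaussCdf_neg : Tendsto (fun x => gaussCdf (-x)) atTop (𝓝 0) :=
  (tendsto_cdf_atBot (gaussianReal 0 1)).comp tendsto_neg_atTop_atBot

lemma hasDerivAt_gaussPdf_mul_inv_pow (n : ℕ) {x : ℝ} (hx : 0 < x) :
    HasDerivAt (fun x : ℝ => gaussPdf x * (x ^ (n + 1))⁻¹)
      (-(gaussPdf x * ((x ^ n)⁻¹ + (n + 1) * (x ^ (n + 2))⁻¹))) x := by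
  have h := (hasDerivAt_gaussPdf x).mul ((hasDerivAt_pow (n + 1) x).fun_inv (by positivity))
  refine h.congr_deriv ?_
  push_cast
  field_simp
  ring

lemma hasDerivAt_gaussCdf_neg (x : ℝ) : HasDerivAt (fun x => gaussCdf (-x)) (-gaussPdf x) x := by
  have := (hasDerivAt_gaussCdf (-x)).comp x (hasDerivAt_neg x)
  refine this.congr_deriv ?_
  rw [gaussPdf_neg]; ring

/-- Asymptotic bounds for the Mills ratio. -/
lemma abs_gaussCdf_neg_sub_le {x : ℝ} (hx : 0 < x) :
    |gaussCdf (-x) - gaussPdf x * (x⁻¹ - (x ^ 3)⁻¹)| ≤ gaussPdf x * (3 * (x ^ 5)⁻¹) := by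
  -- The errors of the Mills series truncated after two and three terms, suitably signed, have
  -- derivatives -3φ/x^4 and -15φ/x^6. They decrease to 0 at infinity, so both are nonnegative.
  have hl : ∀ x : ℝ, 0 < x → HasDerivAt (fun x => gaussCdf (-x) - (gaussPdf x * (x ^ (0 + 1))⁻¹ -
      gaussPdf x * (x ^ (2 + 1))⁻¹)) (-(gaussPdf x * (3 * (x ^ 4)⁻¹))) x := fun x hx => by
    refine ((hasDerivAt_gaussCdf_neg x).sub ((hasDerivAt_gaussPdf_mul_inv_pow 0 hx).sub
      (hasDerivAt_gaussPdf_mul_inv_pow 2 hx))).congr_deriv ?_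
    norm_num
    ring
  have hr : ∀ x : ℝ, 0 < x → HasDerivAt (fun x => (gaussPdf x * (x ^ (0 + 1))⁻¹ -
      gaussPdf x * (x ^ (2 + 1))⁻¹) + 3 * (gaussPdf x * (x ^ (4 + 1))⁻¹) - gaussCdf (-x))
      (-(gaussPdf x * (15 * (x ^ 6)⁻¹))) x := fun x hx => by
    refine ((((hasDerivAt_gaussPdf_mul_inv_pow 0 hx).sub
      (hasDerivAt_gaussPdf_mul_inv_pow 2 hx)).add
      ((hasDerivAt_gaussPdf_mul_inv_pow 4 hx).const_mul 3)).sub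
      (hasDerivAt_gaussCdf_neg x)).congr_deriv ?_
    norm_num
    ring
  have t0 := tendsto_gaussPdf_mul_inv_pow 0
  have t2 := tendsto_gaussPdf_mul_inv_pow 2
  have t4 := tendsto_gaussPdf_mul_inv_pow 4
  have h1 := nonneg_of_deriv_nonpos_of_tendsto hl (fun x hx => by
    have := gaussPdf_pos x
    rw [neg_nonpos]; positivity) (by simpa using tendsto_gaussCdf_neg.sub (t0.sub t2)) hx
  have h2 := nonneg_of_deriv_nonpos_of_tendsto hr (fun x hx => by
    have := gaussPdf_pos x
    rw [neg_nonpos]; positivity)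
    (by simpa using ((t0.sub t2).add (t4.const_mul 3)).sub tendsto_gaussCdf_neg) hx
  have hp := gaussPdf_pos x
  norm_num at h1 h2
  rw [abs_le]
  constructor
  · have : 0 ≤ gaussPdf x * (3 * (x ^ 5)⁻¹) := by positivity
    linarith
  · linarith

/-- The signed Gaussian tail, an odd-type extension of `x ↦ P(N > x)`. -/
def gaussTail (x : ℝ) : ℝ := gaussCdf (-x) - if x < 0 then 1 else 0

lemma abs_gaussTail_sub_le {x : ℝ} (hx : x ≠ 0) :
    |gaussTail x - gaussPdf x * (x⁻¹ - (x ^ 3)⁻¹)| ≤ gaussPdf x * (3 * (|x| ^ 5)⁻¹) := by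
  rcases hx.lt_or_gt with h | h
  · have h1 := abs_gaussCdf_neg_sub_le (neg_pos.2 h)
    have h2 := gaussCdf_add_gaussCdf_neg x
    rw [gaussTail, if_pos h, abs_of_neg h]
    rw [gaussPdf_neg, neg_neg] at h1
    rw [abs_sub_comm]
    convert h1 using 2
    rw [← h2, Odd.neg_pow (by decide)]
    simp only [inv_neg]
    ring
  · rw [gaussTail, if_neg h.le.not_gt, abs_of_pos h, sub_zero]
    exact abs_gaussCdf_neg_sub_le h

/-! ### The Black-Scholes-Merton price -/

/-- This identity between the densities at d₋ and d₊ simplifies the vega and puts both terms of the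
price on the same exponential scale. -/
lemma exp_mul_gaussPdf (κ : ℝ) {y : ℝ} (hy : y ≠ 0) :
    Real.exp κ * gaussPdf (-κ / y - y / 2) = gaussPdf (-κ / y + y / 2) := by
  simp only [gaussPdf]
  rw [← mul_div_assoc, ← Real.exp_add]
  congr 2
  field_simp
  ring

lemma hasDerivAt_bsCall {τ : ℝ} (hτ : 0 < τ) (κ : ℝ) {s : ℝ} (hs : 0 < s) :
    HasDerivAt (bsCall τ κ) (gaussPdf (-κ / (s * √τ) + s * √τ / 2) * √τ) s := by
  have hq : 0 < √τ := Real.sqrt_pos.2 hτ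
  have hy : HasDerivAt (fun s : ℝ => s * √τ) √τ s := by
    simpa using (hasDerivAt_id s).mul_const √τ
  have h1 : HasDerivAt (fun s : ℝ => -κ / (s * √τ)) (κ * √τ / (s * √τ) ^ 2) s := by
    refine ((hasDerivAt_const s (-κ)).fun_div hy (by positivity)).congr_deriv ?_
    ring
  have h2 := hy.div_const 2
  have hp := (hasDerivAt_gaussCdf _).comp s (h1.fun_add h2)
  have hm := (hasDerivAt_gaussCdf _).comp s (h1.fun_sub h2)
  refine (hp.sub (hm.const_mul (Real.exp κ))).congr_deriv ?_
  rw [← mul_assoc, exp_mul_gaussPdf κ (by positivity)]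
  ring

lemma strictMonoOn_bsCall {τ : ℝ} (hτ : 0 < τ) (κ : ℝ) :
    StrictMonoOn (bsCall τ κ) (Set.Ioi 0) := by
  refine strictMonoOn_of_deriv_pos (convex_Ioi 0)
    (fun s hs => (hasDerivAt_bsCall hτ κ hs).continuousAt.continuousWithinAt) fun s hs => ?_
  have hs' : 0 < s := by simpa using hs
  rw [(hasDerivAt_bsCall hτ κ hs').deriv]
  exact mul_pos (gaussPdf_pos _) (Real.sqrt_pos.2 hτ)

lemma continuousOn_bsCall {τ : ℝ} (hτ : 0 < τ) (κ : ℝ) : ContinuousOn (bsCall τ κ) (Set.Ioi 0) :=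
  fun _ hs => (hasDerivAt_bsCall hτ κ hs).continuousAt.continuousWithinAt

/-- The exponential rate of Black-Scholes-Merton prices with total variance `v τ` and
log-strike `k τ`. -/
def bsRate (k v : ℝ) : ℝ := (v - 2 * k) ^ 2 / (8 * v)

/-- The leading coefficient of Black-Scholes-Merton prices. -/
def bsLead (k v : ℝ) : ℝ := 4 * (v * √v) / (4 * k ^ 2 - v ^ 2)

/-- The first relative correction of Black-Scholes-Merton prices. -/
def bsCorr (k v : ℝ) : ℝ := 4 * v * (12 * k ^ 2 + v ^ 2) / (4 * k ^ 2 - v ^ 2) ^ 2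

/-- The constant of the error of the second order expansion of Black-Scholes-Merton prices. -/
def bsErr (k v : ℝ) : ℝ := 96 * (v ^ 2 * √v) * ((|2 * k - v| ^ 5)⁻¹ + (|2 * k + v| ^ 5)⁻¹)

lemma otmPrice_bsCall_expansion {u k v ε : ℝ} (hv : 0 < v) (hε : 0 < ε) (h1 : u < 1 ↔ 2 * k < v)
    (h2 : u < 0 ↔ v < -(2 * k)) (hk1 : 2 * k - v ≠ 0) (hk2 : 2 * k + v ≠ 0) :
    |otmPrice u (k / ε) (bsCall (1 / ε) (k / ε) √v) -
      Real.exp (-bsRate k v / ε) / √(2 * Real.pi) * √ε * (bsLead k v * (1 - bsCorr k v * ε))| ≤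
    Real.exp (-bsRate k v / ε) / √(2 * Real.pi) * √ε * (bsErr k v * ε ^ 2) := by
  obtain ⟨m, hm, hmv, hm2⟩ : ∃ m : ℝ, 0 < m ∧ √v = m ∧ v = m ^ 2 :=
    ⟨√v, Real.sqrt_pos.2 hv, rfl, (Real.sq_sqrt hv.le).symm⟩
  obtain ⟨e, he, hev, he2⟩ : ∃ e : ℝ, 0 < e ∧ √ε = e ∧ ε = e ^ 2 :=
    ⟨√ε, Real.sqrt_pos.2 hε, rfl, (Real.sq_sqrt hε.le).symm⟩
  set xp := (2 * k - v) / (2 * (m * e)) with hxp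
  set xm := (2 * k + v) / (2 * (m * e)) with hxm
  have hme : 0 < 2 * (m * e) := by positivity
  have hxp0 : xp ≠ 0 := div_ne_zero hk1 hme.ne'
  have hxm0 : xm ≠ 0 := div_ne_zero hk2 hme.ne'
  have hy : √v * √(1 / ε) = m / e := by
    rw [Real.sqrt_div zero_le_one, Real.sqrt_one, hmv, hev]; ring
  have hdp : -(k / ε) / (m / e) + m / e / 2 = -xp := by
    rw [hxp, hm2, he2]; field_simp; ring
  have hdm : -(k / ε) / (m / e) - m / e / 2 = -xm := by
    rw [hxm, hm2, he2]; field_simp; ring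
  have hsp : xp < 0 ↔ u < 1 := by
    rw [h1, hxp, div_lt_iff₀ hme, zero_mul, sub_neg]
  have hsm : xm < 0 ↔ u < 0 := by
    rw [h2, hxm, div_lt_iff₀ hme, zero_mul]
    constructor <;> intro h <;> linarith
  have hexp : Real.exp (k / ε) * gaussPdf xm = gaussPdf xp := by
    have := exp_mul_gaussPdf (k / ε) (y := m / e) (by positivity)
    rwa [hdp, hdm, gaussPdf_neg, gaussPdf_neg] at this
  -- The position of u relative to 0 and 1 matches the signs of xm and xp, so the parity terms of
  -- `otmPrice` are exactly the indicators inside `gaussTail`.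
  have hprice : otmPrice u (k / ε) (bsCall (1 / ε) (k / ε) √v) =
      gaussTail xp - Real.exp (k / ε) * gaussTail xm := by
    rw [otmPrice, bsCall, hy, hdp, hdm, gaussTail, gaussTail]
    simp only [hsp, hsm]
    ring
  have hphi : gaussPdf xp = Real.exp (-bsRate k v / ε) / √(2 * Real.pi) := by
    rw [gaussPdf]
    congr 2
    rw [bsRate, hxp, hm2, he2]
    field_simp
    ring
  have hkk : 4 * k ^ 2 - v ^ 2 ≠ 0 := by
    rw [show 4 * k ^ 2 - v ^ 2 = (2 * k - v) * (2 * k + v) by ring]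
    exact mul_ne_zero hk1 hk2
  have hmain : √ε * (bsLead k v * (1 - bsCorr k v * ε)) =
      (xp⁻¹ - (xp ^ 3)⁻¹) - (xm⁻¹ - (xm ^ 3)⁻¹) := by
    have hf : 4 * k ^ 2 - v ^ 2 = (2 * k - v) * (2 * k + v) := by ring
    rw [bsLead, bsCorr, hmv, hev, he2, hf, hxp, hxm]
    obtain ⟨p, hp⟩ : ∃ p, p = 2 * k - v := ⟨_, rfl⟩
    obtain ⟨q, hq⟩ : ∃ q, q = 2 * k + v := ⟨_, rfl⟩
    rw [← hp] at hk1
    rw [← hq] at hk2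
    have hkv : k = (p + m ^ 2) / 2 := by rw [hp, hm2]; ring
    have hqp : q = p + 2 * m ^ 2 := by rw [hq, hp, hm2]; ring
    rw [← hp, ← hq, hm2, hkv]
    field_simp
    rw [hqp]
    ring
  have hbd : √ε * (bsErr k v * ε ^ 2) = 3 * (|xp| ^ 5)⁻¹ + 3 * (|xm| ^ 5)⁻¹ := by
    have e1 : |xp| = |2 * k - v| / (2 * (m * e)) := by rw [hxp, abs_div, abs_of_pos hme]
    have e2 : |xm| = |2 * k + v| / (2 * (m * e)) := by rw [hxm, abs_div, abs_of_pos hme]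
    rw [bsErr, hmv, hev, e1, e2, he2]
    have p1 : |2 * k - v| ≠ 0 := abs_ne_zero.2 hk1
    have p2 : |2 * k + v| ≠ 0 := abs_ne_zero.2 hk2
    generalize |2 * k - v| = a at *
    generalize |2 * k + v| = b at *
    rw [hm2]
    field_simp
    ring
  have b1 := abs_gaussTail_sub_le hxp0
  have b2 := abs_gaussTail_sub_le hxm0
  rw [hprice, ← hphi, mul_assoc, mul_assoc, hmain, hbd]
  have hsplit : gaussTail xp - Real.exp (k / ε) * gaussTail xm -
      gaussPdf xp * (xp⁻¹ - (xp ^ 3)⁻¹ - (xm⁻¹ - (xm ^ 3)⁻¹)) =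
      (gaussTail xp - gaussPdf xp * (xp⁻¹ - (xp ^ 3)⁻¹)) -
        Real.exp (k / ε) * (gaussTail xm - gaussPdf xm * (xm⁻¹ - (xm ^ 3)⁻¹)) := by
    rw [← hexp]; ring
  rw [hsplit]
  refine (abs_sub _ _).trans ?_
  rw [abs_mul, abs_of_pos (Real.exp_pos _)]
  calc _ ≤ gaussPdf xp * (3 * (|xp| ^ 5)⁻¹) +
        Real.exp (k / ε) * (gaussPdf xm * (3 * (|xm| ^ 5)⁻¹)) := by gcongr
    _ = gaussPdf xp * (3 * (|xp| ^ 5)⁻¹) +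
        (Real.exp (k / ε) * gaussPdf xm) * (3 * (|xm| ^ 5)⁻¹) := by ring
    _ = _ := by rw [hexp]; ring

end

section

/-! ### The leading order of the smile -/

/-- With L = A² and L - k = B², the two candidates for v₀ become 2(A ± B)², and every comparison
with ±2k = ±2(A² - B²) is polynomial. -/
lemma sqrt_mul_sqrt_identities {L k : ℝ} (hL : 0 < L) (hLk : 0 < L - k) :
    ∃ A B : ℝ, 0 < A ∧ 0 < B ∧ L = A ^ 2 ∧ k = A ^ 2 - B ^ 2 ∧ √(L * (L - k)) = A * B := by
  refine ⟨√L, √(L - k), Real.sqrt_pos.2 hL, Real.sqrt_pos.2 hLk, (Real.sq_sqrt hL.le).symm, ?_,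
    Real.sqrt_mul hL.le _⟩
  rw [Real.sq_sqrt hL.le, Real.sq_sqrt hLk.le]; ring

/-- The position of `v₀` relative to `±2k` and the matching of the exponential rates. -/
structure LeadingOrder (k L u v : ℝ) : Prop where
  pos : 0 < v
  rate : bsRate k v = L - k
  lt_one_iff : u < 1 ↔ 2 * k < v
  neg_iff : u < 0 ↔ v < -(2 * k)
  sub_ne : 2 * k - v ≠ 0
  add_ne : 2 * k + v ≠ 0

/-- The saddlepoint and Black–Scholes leading coefficients carry the signs of u(u - 1) and 4k² - v²
respectively; they have to agree for the prices to be matched. -/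
lemma LeadingOrder.mul_pos {k L u v : ℝ} (h : LeadingOrder k L u v) (hu0 : u ≠ 0) (hu1 : u ≠ 1) :
    0 < u * (u - 1) * (4 * k ^ 2 - v ^ 2) := by
  have e : u * (u - 1) * (4 * k ^ 2 - v ^ 2) = (u * (2 * k + v)) * ((u - 1) * (2 * k - v)) := by
    ring
  rw [e]
  refine _root_.mul_pos ?_ ?_
  · rcases hu0.lt_or_gt with hu | hu
    · have := h.neg_iff.1 hu
      exact mul_pos_of_neg_of_neg hu (by linarith)
    · have h1 : ¬ v < -(2 * k) := fun hh => absurd (h.neg_iff.2 hh) hu.not_gt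
      have h2 : 0 < 2 * k + v := lt_of_le_of_ne (by linarith) h.add_ne.symm
      exact _root_.mul_pos hu h2
  · rcases hu1.lt_or_gt with hu | hu
    · have := h.lt_one_iff.1 hu
      exact mul_pos_of_neg_of_neg (by linarith) (by linarith)
    · have h1 : ¬ 2 * k < v := fun hh => absurd (h.lt_one_iff.2 hh) hu.not_gt
      have h2 : 0 < 2 * k - v := lt_of_le_of_ne (by linarith) h.sub_ne.symm
      exact _root_.mul_pos (by linarith) h2

lemma bsRate_add_sq {A B : ℝ} (h : A + B ≠ 0) :
    bsRate (A ^ 2 - B ^ 2) (2 * (A + B) ^ 2) = B ^ 2 := by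
  rw [bsRate]
  field_simp
  ring

lemma bsRate_sub_sq {A B : ℝ} (h : A - B ≠ 0) :
    bsRate (A ^ 2 - B ^ 2) (2 * (A - B) ^ 2) = B ^ 2 := by
  have := bsRate_add_sq (A := A) (B := -B) (by rwa [← sub_eq_add_neg])
  simpa [← sub_eq_add_neg] using this

/-- The tangent at u, evaluated at 0 and at 1 where f vanishes, gives L > 0 and L - k > 0.
Monotonicity of f' converts the position of k into that of u. Both square root branches have rate L
- k; the sign in `v0` selects the one lying on the correct side of ±2k. -/
lemma leadingOrder_of_saddlePoint {S : Set ℝ} {f : ℝ → ℝ} (hf : StrictConvexOn ℝ S f)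
    (hd : ∀ x ∈ S, DifferentiableAt ℝ f x) (h0 : (0 : ℝ) ∈ S) (h1 : (1 : ℝ) ∈ S) (hf0 : f 0 = 0)
    (hf1 : f 1 = 0) {k u : ℝ} (hu : IsSaddlePoint S f k u) (hk0 : k ≠ deriv f 0)
    (hk1 : k ≠ deriv f 1) :
    u ≠ 0 ∧ u ≠ 1 ∧ LeadingOrder k (legendre S f k) u (v0 S f k) := by
  obtain ⟨huS, huk⟩ := hu
  have hu0 : u ≠ 0 := by rintro rfl; exact hk0 huk.symm
  have hu1 : u ≠ 1 := by rintro rfl; exact hk1 huk.symm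
  have hmono := hf.strictMonoOn_deriv hd
  have hlt0 := tangent_lt hf huS h0 (hd u huS) hu0.symm
  have hlt1 := tangent_lt hf huS h1 (hd u huS) hu1.symm
  have hd1 : 0 < deriv f 1 := by
    have := tangent_lt hf h1 h0 (hd 1 h1) zero_ne_one
    rw [hf0, hf1] at this; linarith
  have hd0 : deriv f 0 < 0 := by
    have := tangent_lt hf h0 h1 (hd 0 h0) one_ne_zero
    rw [hf0, hf1] at this; linarith
  rw [huk] at hlt0 hlt1
  rw [hf0] at hlt0
  rw [hf1] at hlt1
  have hleg := legendre_eq hf ⟨huS, huk⟩ (hd u huS)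
  refine ⟨hu0, hu1, ?_⟩
  have hv : v0 S f k = if deriv f 0 < k ∧ k < deriv f 1 then
      2 * (2 * legendre S f k - k + 2 * √(legendre S f k * (legendre S f k - k))) else
      2 * (2 * legendre S f k - k - 2 * √(legendre S f k * (legendre S f k - k))) := rfl
  rw [hv]
  set L := legendre S f k with hLdef
  have hL : 0 < L := by rw [hleg]; linarith
  have hLk : 0 < L - k := by rw [hleg]; linarith
  obtain ⟨A, B, hA, hB, hLA, hkAB, hsq⟩ := sqrt_mul_sqrt_identities hL hLk
  have hi0 : deriv f 0 < k ↔ 0 < u := by rw [← huk]; exact hmono.lt_iff_lt h0 huS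
  have hi1 : k < deriv f 1 ↔ u < 1 := by rw [← huk]; exact hmono.lt_iff_lt huS h1
  have hLkB : L - k = B ^ 2 := by rw [hLA, hkAB]; ring
  simp only [hsq, hi0, hi1]
  split_ifs with hc
  · have hval : 2 * (2 * L - k + 2 * (A * B)) = 2 * (A + B) ^ 2 := by rw [hLA, hkAB]; ring
    have e1 : 2 * k < 2 * (A + B) ^ 2 := by rw [hkAB]; nlinarith [mul_pos hA hB]
    have e2 : -(2 * k) < 2 * (A + B) ^ 2 := by rw [hkAB]; nlinarith [mul_pos hA hB]
    rw [hval]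
    exact ⟨by positivity, by rw [hLkB, hkAB]; exact bsRate_add_sq (by positivity),
      ⟨fun _ => e1, fun _ => hc.2⟩, ⟨fun h => absurd h hc.1.not_gt, fun h => absurd h e2.not_gt⟩,
      by linarith, by linarith⟩
  · have hval : 2 * (2 * L - k - 2 * (A * B)) = 2 * (A - B) ^ 2 := by rw [hLA, hkAB]; ring
    rw [hval]
    rcases hu0.lt_or_gt with hneg | hpos
    · have hk : k < 0 := by
        rw [← huk]; exact (hmono huS h0 hneg).trans hd0
      have hAB : A < B := by
        rw [hkAB] at hk; nlinarith
      have e1 : 2 * k < 2 * (A - B) ^ 2 := by nlinarith [sq_nonneg (A - B)]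
      have e2 : 2 * (A - B) ^ 2 < -(2 * k) := by rw [hkAB]; nlinarith
      have hne : A - B ≠ 0 := by linarith
      exact ⟨by positivity, by rw [hLkB, hkAB]; exact bsRate_sub_sq hne,
        ⟨fun _ => e1, fun _ => by linarith⟩, ⟨fun _ => e2, fun _ => hneg⟩,
        by linarith, by linarith⟩
    · have hgt : 1 < u := lt_of_le_of_ne (not_lt.1 fun h => hc ⟨hpos, h⟩) hu1.symm
      have hk : 0 < k := by
        rw [← huk]; exact hd1.trans (hmono h1 huS hgt)
      have hAB : B < A := by
        rw [hkAB] at hk; nlinarith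
      have e1 : 2 * (A - B) ^ 2 < 2 * k := by rw [hkAB]; nlinarith
      have e2 : -(2 * k) < 2 * (A - B) ^ 2 := by nlinarith [sq_nonneg (A - B)]
      have hne : A - B ≠ 0 := by linarith
      exact ⟨by positivity, by rw [hLkB, hkAB]; exact bsRate_sub_sq hne,
        ⟨fun h => absurd h hgt.not_gt, fun h => absurd h e1.not_gt⟩,
        ⟨fun h => absurd h hpos.not_gt, fun h => absurd h e2.not_gt⟩,
        by linarith, by linarith⟩

/-! ### The equations determining the coefficients -/

/-- The coefficient of ε in the smile equation: ρ'(v) v₁ = log B(v) - log A, where ρ'(v) = 1/8 -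
k²/(2v²), B is `bsLead` and A is the saddlepoint coefficient. -/
lemma v1_equation {k u v Λ a : ℝ} (hv : 0 < v) (ha : 0 < a) (hu0 : u ≠ 0) (hu1 : u ≠ 1)
    (hkv : 4 * k ^ 2 - v ^ 2 ≠ 0) :
    (1 / 8 - k ^ 2 / (2 * v * v)) * (8 * v ^ 2 / (4 * k ^ 2 - v ^ 2) *
      (Λ + Real.log ((4 * k ^ 2 - v ^ 2) / (4 * (u - 1) * u * v ^ (3 / 2 : ℝ) * √a)))) =
    Real.log (bsLead k v) - Real.log (Real.exp Λ / (u * (u - 1) * √a)) := by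
  have hu1' : u - 1 ≠ 0 := sub_ne_zero.2 hu1
  have hsa : √a ≠ 0 := (Real.sqrt_pos.2 ha).ne'
  have hsv : √v ≠ 0 := (Real.sqrt_pos.2 hv).ne'
  have hrp : v ^ (3 / 2 : ℝ) = v * √v := by
    rw [show (3 / 2 : ℝ) = 1 + 1 / 2 by norm_num, Real.rpow_add hv, Real.rpow_one,
      Real.sqrt_eq_rpow]
  -- `bsLead k v` and u(u - 1) may be negative; `Real.log` ignores signs, so the rules for quotients
  -- and inverses need only nonzero arguments.
  have hlog : Real.log ((4 * k ^ 2 - v ^ 2) / (4 * (u - 1) * u * (v * √v) * √a)) =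
      -(Real.log (bsLead k v) - Real.log (1 / (u * (u - 1) * √a))) := by
    have hB : bsLead k v ≠ 0 := by
      rw [bsLead]; positivity
    rw [← Real.log_div hB (by positivity), ← Real.log_inv]
    congr 1
    rw [bsLead]
    field_simp
  have hA : Real.log (Real.exp Λ / (u * (u - 1) * √a)) =
      Λ + Real.log (1 / (u * (u - 1) * √a)) := by
    rw [← Real.log_exp Λ, ← Real.log_mul (Real.exp_pos _).ne' (by positivity), Real.log_exp,
      mul_one_div]
  rw [hrp, hlog, hA, sub_add_eq_sub_sub_swap]
  generalize Real.log (bsLead k v) - Real.log (1 / (u * (u - 1) * √a)) = ℓ at *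
  obtain ⟨D, hD⟩ : ∃ D, D = 4 * k ^ 2 - v ^ 2 := ⟨_, rfl⟩
  have hk2 : k ^ 2 = (D + v ^ 2) / 4 := by rw [hD]; ring
  rw [← hD] at hkv ⊢
  rw [hk2]
  field_simp
  ring

/-- The coefficient of ε² in the smile equation, with w = v₁: ρ'(v) v₂ + ρ''(v) w² / 2 - (log B)'(v)
w + c(v) + Υ = 0, where B is `bsLead` and c is `bsCorr`. -/
lemma v2_equation {k v w Υ : ℝ} (hv : 0 < v) (hkv : 4 * k ^ 2 - v ^ 2 ≠ 0) :
    (1 / 8 - k ^ 2 / (2 * v * v)) * (4 / (v * (v ^ 2 - 4 * k ^ 2) ^ 3) *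
      (8 * k ^ 4 * w * v ^ 2 * (w + 6) - 16 * k ^ 6 * w ^ 2
      - 2 * Υ * v ^ 3 * (v ^ 2 - 4 * k ^ 2) ^ 2
      - k ^ 2 * v ^ 4 * (96 + w ^ 2 + 8 * w) - v ^ 6 * (w + 8)))
      + k ^ 2 / (2 * v * v ^ 2) * w ^ 2 - (3 / (2 * v) + 2 * v / (4 * k ^ 2 - v ^ 2)) * w
      + (bsCorr k v + Υ) = 0 := by
  obtain ⟨D, hD⟩ : ∃ D, D = 4 * k ^ 2 - v ^ 2 := ⟨_, rfl⟩
  have hk2 : k ^ 2 = (D + v ^ 2) / 4 := by rw [hD]; ring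
  have hk4 : k ^ 4 = ((D + v ^ 2) / 4) ^ 2 := by rw [← hk2]; ring
  have hk6 : k ^ 6 = ((D + v ^ 2) / 4) ^ 3 := by rw [← hk2]; ring
  have hD' : v ^ 2 - 4 * k ^ 2 = -D := by rw [hD]; ring
  rw [← hD] at hkv
  rw [bsCorr, hD', ← hD, hk2, hk4, hk6]
  field_simp
  ring

/-- An exact difference quotient: expanding it to first order expands the rate to second order, and
its value at w = v is the derivative that must not vanish for the inversion. -/
lemma bsRate_sub_bsRate {k v w : ℝ} (hv : v ≠ 0) (hw : w ≠ 0) :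
    bsRate k w - bsRate k v = (w - v) * (1 / 8 - k ^ 2 / (2 * v * w)) := by
  rw [bsRate, bsRate]
  field_simp
  ring

/-! ### Regularity of the coefficients in the variance -/

/-- The square makes the formula insensitive to the sign of 4k² - v², so regularity in v is proved
for all cases at once. -/
lemma log_bsLead {k v : ℝ} (hv : 0 < v) (hkv : 4 * k ^ 2 - v ^ 2 ≠ 0) :
    Real.log (bsLead k v) =
      Real.log 4 + 3 / 2 * Real.log v - 1 / 2 * Real.log ((4 * k ^ 2 - v ^ 2) ^ 2) := by
  have hsv : √v ≠ 0 := (Real.sqrt_pos.2 hv).ne'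
  rw [bsLead, Real.log_div (by positivity) hkv, Real.log_mul (by norm_num) (by positivity),
    Real.log_mul hv.ne' hsv, Real.log_sqrt hv.le, Real.log_pow]
  push_cast
  ring

lemma eventually_pos_and_ne {k v : ℝ} (hv : 0 < v) (hkv : 4 * k ^ 2 - v ^ 2 ≠ 0) :
    ∀ᶠ w in 𝓝 v, 0 < w ∧ 4 * k ^ 2 - w ^ 2 ≠ 0 := by
  have hc : ContinuousAt (fun w : ℝ => 4 * k ^ 2 - w ^ 2) v := by fun_prop
  exact (lt_mem_nhds hv).and (hc.eventually_ne hkv)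

lemma analyticAt_log_bsLead {k v : ℝ} (hv : 0 < v) (hkv : 4 * k ^ 2 - v ^ 2 ≠ 0) :
    AnalyticAt ℝ (fun v => Real.log (bsLead k v)) v := by
  have h1 : AnalyticAt ℝ (fun w : ℝ => Real.log w) v := analyticAt_id.log hv
  have h2 : AnalyticAt ℝ (fun w : ℝ => Real.log ((4 * k ^ 2 - w ^ 2) ^ 2)) v :=
    ((analyticAt_const.sub (analyticAt_id.pow 2)).pow 2).log
      (lt_of_le_of_ne (sq_nonneg _) (pow_ne_zero 2 hkv).symm)
  have h3 : AnalyticAt ℝ (fun w : ℝ => Real.log 4 + 3 / 2 * Real.log w -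
      1 / 2 * Real.log ((4 * k ^ 2 - w ^ 2) ^ 2)) v :=
    (analyticAt_const.add (analyticAt_const.mul h1)).sub (analyticAt_const.mul h2)
  refine h3.congr ?_
  filter_upwards [eventually_pos_and_ne hv hkv] with w hw
  exact (log_bsLead hw.1 hw.2).symm

lemma hasDerivAt_log_bsLead {k v : ℝ} (hv : 0 < v) (hkv : 4 * k ^ 2 - v ^ 2 ≠ 0) :
    HasDerivAt (fun v => Real.log (bsLead k v))
      (3 / (2 * v) + 2 * v / (4 * k ^ 2 - v ^ 2)) v := by
  have h2 : HasDerivAt (fun w : ℝ => Real.log ((4 * k ^ 2 - w ^ 2) ^ 2)) _ v :=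
    ((((hasDerivAt_pow 2 v).const_sub (4 * k ^ 2))).fun_pow 2).log (pow_ne_zero 2 hkv)
  have h3 := (((Real.hasDerivAt_log hv.ne').const_mul (3 / 2)).const_add (Real.log 4)).fun_sub
    (h2.const_mul (1 / 2))
  refine (h3.congr_of_eventuallyEq ?_).congr_deriv ?_
  · filter_upwards [eventually_pos_and_ne hv hkv] with w hw
    exact log_bsLead hw.1 hw.2
  · push_cast
    obtain ⟨D, hD⟩ : ∃ D, D = 4 * k ^ 2 - v ^ 2 := ⟨_, rfl⟩
    rw [← hD] at hkv ⊢
    field_simp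
    ring

lemma analyticAt_bsCorr {k v : ℝ} (hkv : 4 * k ^ 2 - v ^ 2 ≠ 0) : AnalyticAt ℝ (bsCorr k) v := by
  refine AnalyticAt.div ?_ ?_ (pow_ne_zero 2 hkv)
  · exact (analyticAt_const.mul analyticAt_id).mul (analyticAt_const.add (analyticAt_id.pow 2))
  · exact (analyticAt_const.sub (analyticAt_id.pow 2)).pow 2

/-- First order Taylor expansion of an analytic function. -/
lemma AnalyticAt.isBigO_sub_linear {f : ℝ → ℝ} {f' a : ℝ} (hf : AnalyticAt ℝ f a)
    (hf' : HasDerivAt f f' a) :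
    (fun h => f (a + h) - f a - f' * h) =O[𝓝 0] fun h => h ^ 2 := by
  obtain ⟨p, hp⟩ := hf
  have h1 := hp.isBigO_sub_partialSum_pow 2
  have h2 : ∀ y : ℝ, p.partialSum 2 y = f a + f' * y := by
    intro y
    rw [FormalMultilinearSeries.partialSum, Finset.sum_range_succ, Finset.sum_range_one,
      hp.coeff_zero, ← hf'.deriv, hp.deriv, mul_comm]
    congr 1
    simp
  refine (h1.congr_left fun y => ?_).trans (IsBigO.of_norm_left ?_)
  · rw [h2]; ring
  · simpa using (isBigO_refl _ _)

end

section

/-! ### Inversion of the Black-Scholes-Merton price -/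

/-- The defect of `w` in the equation for the implied variance at scale `ε`. -/
def smileDefect (k v ℓ Υ ε w : ℝ) : ℝ :=
  bsRate k w - bsRate k v - ε * (Real.log (bsLead k w) - ℓ) + ε ^ 2 * (bsCorr k w + Υ)

lemma isBigO_pow_nhdsGT {m n : ℕ} (h : m ≤ n) :
    (fun ε : ℝ => ε ^ n) =O[𝓝[>] 0] fun ε => ε ^ m := by
  obtain ⟨j, rfl⟩ := Nat.exists_eq_add_of_le h
  refine IsBigO.of_bound 1 ?_
  filter_upwards [Ioo_mem_nhdsGT (zero_lt_one' ℝ)] with ε hε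
  rw [pow_add, norm_mul, mul_comm, one_mul]
  refine mul_le_of_le_one_left (norm_nonneg _) ?_
  rw [norm_pow, Real.norm_of_nonneg hε.1.le]
  exact pow_le_one₀ hε.1.le hε.2.le

/-- The rate is expanded to second order, log `bsLead` to first and `bsCorr` to zeroth. The order ε
then cancels by `e1`, the order ε² by `e2`. -/
lemma smileDefect_expansion {k v v₁ v₂ Υ ℓ : ℝ} (hv : 0 < v) (hkv : 4 * k ^ 2 - v ^ 2 ≠ 0)
    (e1 : (1 / 8 - k ^ 2 / (2 * v * v)) * v₁ = Real.log (bsLead k v) - ℓ)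
    (e2 : (1 / 8 - k ^ 2 / (2 * v * v)) * v₂ + k ^ 2 / (2 * v * v ^ 2) * v₁ ^ 2 -
      (3 / (2 * v) + 2 * v / (4 * k ^ 2 - v ^ 2)) * v₁ + (bsCorr k v + Υ) = 0) :
    (fun ε => smileDefect k v ℓ Υ ε (v + v₁ * ε + v₂ * ε ^ 2)) =O[𝓝[>] (0 : ℝ)]
      fun ε => ε ^ 3 := by
  set h : ℝ → ℝ := fun ε => v₁ * ε + v₂ * ε ^ 2 with hh
  have p1 : (fun ε : ℝ => ε) =O[𝓝[>] 0] fun ε => ε ^ 1 := by simpa using isBigO_refl _ _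
  have hO : h =O[𝓝[>] 0] fun ε => ε ^ 1 :=
    (p1.const_mul_left v₁).add ((isBigO_pow_nhdsGT one_le_two).const_mul_left v₂)
  have hlim : Tendsto h (𝓝[>] 0) (𝓝 0) := by
    have : Tendsto h (𝓝 0) (𝓝 (h 0)) := Continuous.tendsto (by rw [hh]; fun_prop) 0
    rw [show h 0 = 0 by simp [hh]] at this
    exact this.mono_left nhdsWithin_le_nhds
  have hO2 : (fun ε => h ε ^ 2) =O[𝓝[>] 0] fun ε => ε ^ 2 := by
    simpa using hO.pow 2
  set g : ℝ → ℝ := fun w => 1 / 8 - k ^ 2 / (2 * v * w) with hg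
  have hgd : HasDerivAt g (k ^ 2 / (2 * v * v ^ 2)) v := by
    have := (((hasDerivAt_id v).const_mul (2 * v)).fun_inv (by positivity)).const_mul (k ^ 2)
    refine (this.const_sub (1 / 8)).congr_deriv ?_
    simp only [id]
    field_simp
  have hga : AnalyticAt ℝ g v :=
    analyticAt_const.sub (analyticAt_const.div (analyticAt_const.mul analyticAt_id) (by positivity))
  have r1 := ((AnalyticAt.isBigO_sub_linear hga hgd).comp_tendsto hlim).trans hO2
  have r2 := ((AnalyticAt.isBigO_sub_linear (analyticAt_log_bsLead hv hkv)
    (hasDerivAt_log_bsLead hv hkv)).comp_tendsto hlim).trans hO2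
  have r3 : (fun ε => bsCorr k (v + h ε) - bsCorr k v) =O[𝓝[>] 0] fun ε => ε ^ 1 := by
    have hlim' : Tendsto (fun ε => v + h ε) (𝓝[>] 0) (𝓝 v) := by
      simpa using hlim.const_add v
    have := ((analyticAt_bsCorr hkv).differentiableAt.isBigO_sub).comp_tendsto hlim'
    refine this.trans ?_
    simpa [Function.comp_def] using hO
  have t1 : (fun ε => h ε * (g (v + h ε) - g v - k ^ 2 / (2 * v * v ^ 2) * h ε)) =O[𝓝[>] 0]
      fun ε => ε ^ 3 := (hO.mul r1).congr_right fun ε => by ring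
  have t2 : (fun ε => ε * (Real.log (bsLead k (v + h ε)) - Real.log (bsLead k v) -
      (3 / (2 * v) + 2 * v / (4 * k ^ 2 - v ^ 2)) * h ε)) =O[𝓝[>] 0] fun ε => ε ^ 3 :=
    (p1.mul r2).congr_right fun ε => by ring
  have t3 : (fun ε => ε ^ 2 * (bsCorr k (v + h ε) - bsCorr k v)) =O[𝓝[>] 0] fun ε => ε ^ 3 :=
    ((isBigO_refl (fun ε : ℝ => ε ^ 2) _).mul r3).congr_right fun ε => by ring
  have t4 : (fun ε : ℝ => ε ^ 3 * (2 * (k ^ 2 / (2 * v * v ^ 2)) * v₁ * v₂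
      - (3 / (2 * v) + 2 * v / (4 * k ^ 2 - v ^ 2)) * v₂)
      + (k ^ 2 / (2 * v * v ^ 2)) * v₂ ^ 2 * ε ^ 4) =O[𝓝[>] 0] fun ε => ε ^ 3 :=
    (((isBigO_refl (fun ε : ℝ => ε ^ 3) _).const_mul_left _).congr_left fun ε => mul_comm _ _).add
      ((isBigO_pow_nhdsGT (by norm_num)).const_mul_left _)
  refine (((t1.sub t2).add t3).add t4).congr' ?_ EventuallyEq.rfl
  have hne : ∀ᶠ ε in 𝓝[>] 0, v + h ε ≠ 0 := by
    have hlim' : Tendsto (fun ε => v + h ε) (𝓝[>] 0) (𝓝 v) := by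
      simpa using hlim.const_add v
    exact hlim'.eventually_ne hv.ne'
  filter_upwards [hne] with ε hε
  have hrate := bsRate_sub_bsRate (k := k) hv.ne' hε
  have hassoc : v + v₁ * ε + v₂ * ε ^ 2 = v + h ε := by rw [hh]; ring
  rw [smileDefect, hassoc, hrate]
  simp only [hg, hh]
  have e1' : Real.log (bsLead k v) = ℓ + (1 / 8 - k ^ 2 / (2 * v * v)) * v₁ := by rw [e1]; ring
  rw [e1']
  linear_combination (-ε ^ 2) * e2

/-- Stability of the smile equation: near v the rate has difference quotients at least c / 2 in
modulus, while the other terms are Lipschitz with constant O(ε), eventually below c / 4. This leaves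
c / 4, hence the factor 4 / c. -/
lemma isBigO_sub_of_smileDefect {k v Υ ℓ : ℝ} (hv : 0 < v) (hkv : 4 * k ^ 2 - v ^ 2 ≠ 0)
    {V W : ℝ → ℝ} (hV : Tendsto V (𝓝[>] 0) (𝓝 v)) (hW : Tendsto W (𝓝[>] 0) (𝓝 v)) :
    (fun ε => V ε - W ε) =O[𝓝[>] 0]
      fun ε => smileDefect k v ℓ Υ ε (V ε) - smileDefect k v ℓ Υ ε (W ε) := by
  obtain ⟨K₁, s₁, hs₁, hK₁⟩ :=
    (analyticAt_log_bsLead hv hkv).contDiffAt.exists_lipschitzOnWith (𝕂 := ℝ)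
  obtain ⟨K₂, s₂, hs₂, hK₂⟩ :=
    (analyticAt_bsCorr hkv).contDiffAt.exists_lipschitzOnWith (𝕂 := ℝ)
  set c : ℝ := |1 / 8 - k ^ 2 / (2 * v * v)| with hc
  have hc0 : 0 < c := by
    refine abs_pos.2 fun h0 => hkv ?_
    field_simp at h0
    linarith
  have hlim : Tendsto (fun ε => |1 / 8 - k ^ 2 / (2 * W ε * V ε)|) (𝓝[>] 0) (𝓝 c) :=
    (tendsto_const_nhds.sub (tendsto_const_nhds.div ((hW.const_mul 2).mul hV)
      (by positivity))).abs
  have hsmall : Tendsto (fun ε : ℝ => ε * K₁ + ε ^ 2 * K₂) (𝓝[>] 0) (𝓝 0) := by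
    have : Tendsto (fun ε : ℝ => ε * K₁ + ε ^ 2 * K₂) (𝓝 0) (𝓝 (0 * K₁ + 0 ^ 2 * K₂)) :=
      Continuous.tendsto (by fun_prop) 0
    simp only [zero_mul, add_zero, ne_eq, OfNat.ofNat_ne_zero, not_false_eq_true, zero_pow] at this
    exact this.mono_left nhdsWithin_le_nhds
  refine IsBigO.of_bound (4 / c) ?_
  filter_upwards [hlim.eventually (lt_mem_nhds (half_lt_self hc0)),
    hsmall.eventually (gt_mem_nhds (show 0 < c / 4 by positivity)), hV.eventually hs₁,
    hV.eventually hs₂, hW.eventually hs₁, hW.eventually hs₂, self_mem_nhdsWithin,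
    hV.eventually_ne hv.ne', hW.eventually_ne hv.ne'] with ε h1 h2 a1 a2 b1 b2 hε hV0 hW0
  have hε0 : 0 < ε := hε
  have hrate := bsRate_sub_bsRate (k := k) hW0 hV0
  have l1 := hK₁.dist_le_mul _ a1 _ b1
  have l2 := hK₂.dist_le_mul _ a2 _ b2
  simp only [Real.dist_eq] at l1 l2
  simp only [Real.norm_eq_abs]
  set d := |V ε - W ε| with hd
  have hd0 : 0 ≤ d := abs_nonneg _
  have hsplit : (V ε - W ε) * (1 / 8 - k ^ 2 / (2 * W ε * V ε)) =
      (smileDefect k v ℓ Υ ε (V ε) - smileDefect k v ℓ Υ ε (W ε)) +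
      ε * (Real.log (bsLead k (V ε)) - Real.log (bsLead k (W ε))) -
      ε ^ 2 * (bsCorr k (V ε) - bsCorr k (W ε)) := by
    rw [← hrate, smileDefect, smileDefect]; ring
  have habs : d * |1 / 8 - k ^ 2 / (2 * W ε * V ε)| ≤
      |smileDefect k v ℓ Υ ε (V ε) - smileDefect k v ℓ Υ ε (W ε)| +
      ε * (K₁ * d) + ε ^ 2 * (K₂ * d) := by
    rw [hd, ← abs_mul, hsplit]
    refine (abs_sub _ _).trans ?_
    rw [abs_mul (ε ^ 2), abs_of_pos (pow_pos hε0 2)]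
    gcongr
    refine (abs_add_le _ _).trans ?_
    rw [abs_mul ε, abs_of_pos hε0]
    gcongr
  rw [div_mul_eq_mul_div, le_div_iff₀ hc0]
  nlinarith

lemma isBigO_log_one_add_sub {f y : ℝ → ℝ} {l : Filter ℝ} (hl : Tendsto (fun ε : ℝ => ε) l (𝓝 0))
    (hf : (fun ε => f ε - (1 + y ε)) =O[l] fun ε => ε ^ 2) (hy : y =O[l] fun ε => ε) :
    (fun ε => Real.log (f ε) - y ε) =O[l] fun ε => ε ^ 2 := by
  have h1 : (fun ε : ℝ => ε ^ 2) =O[l] fun ε => ε := by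
    have := (hl.isBigO_one ℝ).mul (isBigO_refl (fun ε : ℝ => ε) l)
    simpa [sq] using this
  have h2 : (fun ε => f ε - 1) =O[l] fun ε => ε :=
    ((hf.trans h1).add hy).congr_left fun ε => by ring
  have h3 : Tendsto (fun ε => f ε - 1) l (𝓝 0) := h2.trans_tendsto hl
  have h4 := (AnalyticAt.isBigO_sub_linear (analyticAt_log one_pos)
    (Real.hasDerivAt_log one_ne_zero)).comp_tendsto h3
  have h5 : (fun ε => (f ε - 1) ^ 2) =O[l] fun ε => ε ^ 2 := h2.pow 2
  refine ((h4.trans h5).add hf).congr_left fun ε => ?_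
  simp only [Function.comp_apply, Real.log_one, inv_one, add_sub_cancel]
  ring

/-- The scale `exp (-ρ / ε) √(ε / 2π)` of out-of-the-money prices with exponential rate `ρ`. -/
def priceScale (ρ ε : ℝ) : ℝ := Real.exp (-ρ / ε) / √(2 * Real.pi) * √ε

lemma priceScale_pos (ρ : ℝ) {ε : ℝ} (hε : 0 < ε) : 0 < priceScale ρ ε := by
  unfold priceScale
  have := Real.sqrt_pos.2 hε
  positivity

/-- The smaller exponential rate wins, whatever the convergent prefactors. -/
lemma priceScale_mul_lt {α β a b : ℝ} (hαβ : α < β) (ha : 0 < a) {x y : ℝ → ℝ}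
    (hx : Tendsto x (𝓝[>] 0) (𝓝 a)) (hy : Tendsto y (𝓝[>] 0) (𝓝 b)) :
    ∀ᶠ ε in 𝓝[>] 0, priceScale β ε * y ε < priceScale α ε * x ε := by
  have h1 : Tendsto (fun ε : ℝ => Real.exp (-((β - α) * ε⁻¹))) (𝓝[>] 0) (𝓝 0) :=
    Real.tendsto_exp_neg_atTop_nhds_zero.comp
      (tendsto_inv_nhdsGT_zero.const_mul_atTop (sub_pos.2 hαβ))
  have h2 : Tendsto (fun ε : ℝ => Real.exp (-((β - α) * ε⁻¹)) * y ε) (𝓝[>] 0) (𝓝 0) := by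
    simpa using h1.mul hy
  filter_upwards [h2.eventually_lt hx ha, self_mem_nhdsWithin] with ε h3 h4
  have e : priceScale β ε = priceScale α ε * Real.exp (-((β - α) * ε⁻¹)) := by
    have : Real.exp (-β / ε) = Real.exp (-α / ε) * Real.exp (-((β - α) * ε⁻¹)) := by
      rw [← Real.exp_add]; congr 1; ring
    rw [priceScale, priceScale, this]; ring
  rw [e, mul_assoc]
  exact mul_lt_mul_of_pos_left h3 (priceScale_pos α h4)

lemma otmPrice_lt_otmPrice_iff {u κ c d : ℝ} : otmPrice u κ c < otmPrice u κ d ↔ c < d := by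
  unfold otmPrice; constructor <;> intro h <;> linarith

lemma tendsto_div_of_abs_sub_le {p s q B : ℝ → ℝ} {a b : ℝ} (hs : ∀ᶠ ε in 𝓝[>] 0, 0 < s ε)
    (h : ∀ᶠ ε in 𝓝[>] (0 : ℝ), |p ε - s ε * q ε| ≤ s ε * (B ε * ε ^ 2))
    (hB : Tendsto B (𝓝[>] 0) (𝓝 b)) (hq : Tendsto q (𝓝[>] 0) (𝓝 a)) :
    (fun ε => p ε / s ε - q ε) =O[𝓝[>] 0] (fun ε => ε ^ 2) ∧
      Tendsto (fun ε => p ε / s ε) (𝓝[>] 0) (𝓝 a) := by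
  have h1 : (fun ε => p ε / s ε - q ε) =O[𝓝[>] 0] (fun ε => B ε * ε ^ 2) := by
    refine IsBigO.of_bound 1 ?_
    filter_upwards [hs, h] with ε h2 h3
    have e : p ε / s ε - q ε = (p ε - s ε * q ε) / s ε := by field_simp
    rw [e, one_mul, norm_div, Real.norm_of_nonneg h2.le, div_le_iff₀ h2, Real.norm_eq_abs]
    refine h3.trans ?_
    rw [mul_comm]
    gcongr
    exact Real.le_norm_self _
  have h2 : (fun ε => p ε / s ε - q ε) =O[𝓝[>] 0] (fun ε => ε ^ 2) := by
    simpa using h1.trans ((hB.isBigO_one ℝ).mul (isBigO_refl (fun ε : ℝ => ε ^ 2) _))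
  refine ⟨h2, ?_⟩
  have h3 := h2.trans_tendsto (by simpa using tendsto_mul_pow_nhdsGT 1 two_ne_zero)
  simpa using h3.add hq

/-- The strict positions relative to ±2k are open conditions, so the same parity terms serve for all
variances near v. -/
lemma LeadingOrder.eventually_nhds {k L u v : ℝ} (h : LeadingOrder k L u v) :
    ∀ᶠ w in 𝓝 v, 0 < w ∧ (u < 1 ↔ 2 * k < w) ∧ (u < 0 ↔ w < -(2 * k)) ∧ 2 * k - w ≠ 0 ∧
      2 * k + w ≠ 0 := by
  have h1 : ∀ᶠ w in 𝓝 v, (u < 1 ↔ 2 * k < w) := by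
    rcases lt_or_ge (2 * k) v with hlt | hge
    · filter_upwards [lt_mem_nhds hlt] with w hw
      exact iff_of_true (h.lt_one_iff.2 hlt) hw
    · have hlt : v < 2 * k := lt_of_le_of_ne hge fun e => h.sub_ne (by linarith)
      filter_upwards [gt_mem_nhds hlt] with w hw
      exact iff_of_false (fun hu => hge.not_gt (h.lt_one_iff.1 hu)) hw.not_gt
  have h2 : ∀ᶠ w in 𝓝 v, (u < 0 ↔ w < -(2 * k)) := by
    rcases lt_or_ge v (-(2 * k)) with hlt | hge
    · filter_upwards [gt_mem_nhds hlt] with w hw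
      exact iff_of_true (h.neg_iff.2 hlt) hw
    · have hlt : -(2 * k) < v := lt_of_le_of_ne hge fun e => h.add_ne (by linarith)
      filter_upwards [lt_mem_nhds hlt] with w hw
      exact iff_of_false (fun hu => hge.not_gt (h.neg_iff.1 hu)) hw.not_gt
  have c1 : ContinuousAt (fun w => 2 * k - w) v := by fun_prop
  have c2 : ContinuousAt (fun w => 2 * k + w) v := by fun_prop
  filter_upwards [lt_mem_nhds h.pos, h1, h2, c1.eventually_ne h.sub_ne,
    c2.eventually_ne h.add_ne] with w a b c d e
  exact ⟨a, b, c, d, e⟩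

lemma LeadingOrder.four_mul_sq_sub_ne {k L u v : ℝ} (h : LeadingOrder k L u v) :
    4 * k ^ 2 - v ^ 2 ≠ 0 := by
  rw [show 4 * k ^ 2 - v ^ 2 = (2 * k - v) * (2 * k + v) by ring]
  exact mul_ne_zero h.sub_ne h.add_ne

lemma continuousAt_bsLead {k v : ℝ} (hkv : 4 * k ^ 2 - v ^ 2 ≠ 0) : ContinuousAt (bsLead k) v := by
  unfold bsLead
  exact ContinuousAt.div (by fun_prop) (by fun_prop) hkv

lemma continuousAt_bsErr {k v : ℝ} (h1 : 2 * k - v ≠ 0) (h2 : 2 * k + v ≠ 0) :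
    ContinuousAt (bsErr k) v := by
  unfold bsErr
  refine ContinuousAt.mul (by fun_prop) (ContinuousAt.add ?_ ?_)
  · exact ContinuousAt.inv₀ (by fun_prop) (pow_ne_zero _ (abs_ne_zero.2 h1))
  · exact ContinuousAt.inv₀ (by fun_prop) (pow_ne_zero _ (abs_ne_zero.2 h2))

/-- Normalised Black-Scholes-Merton prices along a convergent variance. -/
lemma LeadingOrder.tendsto_bsCall {k L u v : ℝ} (h : LeadingOrder k L u v) {V : ℝ → ℝ}
    (hV : Tendsto V (𝓝[>] 0) (𝓝 v)) :
    (fun ε => otmPrice u (k / ε) (bsCall (1 / ε) (k / ε) √(V ε)) / priceScale (bsRate k (V ε)) ε -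
      bsLead k (V ε) * (1 - bsCorr k (V ε) * ε)) =O[𝓝[>] 0] (fun ε => ε ^ 2) ∧
    Tendsto (fun ε => otmPrice u (k / ε) (bsCall (1 / ε) (k / ε) √(V ε)) /
      priceScale (bsRate k (V ε)) ε) (𝓝[>] 0) (𝓝 (bsLead k v)) := by
  have hkv := h.four_mul_sq_sub_ne
  have hid : Tendsto (fun ε : ℝ => ε) (𝓝[>] 0) (𝓝 0) := tendsto_nhdsWithin_of_tendsto_nhds tendsto_id
  refine tendsto_div_of_abs_sub_le (B := fun ε => bsErr k (V ε)) (b := bsErr k v) ?_ ?_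
    ((continuousAt_bsErr h.sub_ne h.add_ne).tendsto.comp hV) ?_
  · filter_upwards [self_mem_nhdsWithin] with ε hε
    exact priceScale_pos _ hε
  · filter_upwards [self_mem_nhdsWithin, hV.eventually h.eventually_nhds] with ε hε hw
    exact otmPrice_bsCall_expansion hw.1 hε hw.2.1 hw.2.2.1 hw.2.2.2.1 hw.2.2.2.2
  · have h1 := (continuousAt_bsLead hkv).tendsto.comp hV
    have h2 := (analyticAt_bsCorr hkv).continuousAt.tendsto.comp hV
    simpa using h1.mul ((tendsto_const_nhds (x := (1 : ℝ))).sub (h2.mul hid))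

end

/-! ### Existence, convergence and expansion of the implied variance -/

section

lemma tendsto_id_nhdsGT : Tendsto (fun ε : ℝ => ε) (𝓝[>] 0) (𝓝 0) :=
  tendsto_nhdsWithin_of_tendsto_nhds tendsto_id

/-- Second order expansion, at the scale of out-of-the-money prices, of a family of call prices
`p`, with `priceScale`-normalised limit `A`. -/
structure PriceExpansion (k u v A Υ : ℝ) (p : ℝ → ℝ) : Prop where
  isBigO : (fun ε => otmPrice u (k / ε) (p ε) / priceScale (bsRate k v) ε - A * (1 + Υ * ε))
    =O[𝓝[>] 0] fun ε => ε ^ 2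
  tendsto : Tendsto (fun ε => otmPrice u (k / ε) (p ε) / priceScale (bsRate k v) ε) (𝓝[>] 0) (𝓝 A)

variable {k L u v A Υ : ℝ} {p : ℝ → ℝ}

/-- For w ≠ v the rates differ, so the prices differ exponentially. If A > 0 the rate decreases in
the variance and a larger w gives a larger price. If A < 0 (the covered call case) the rate
increases but the adjusted prices are negative, and the order is the same. -/
lemma LeadingOrder.bracket (h : LeadingOrder k L u v) (hA : 0 < A * bsLead k v)
    (hp : PriceExpansion k u v A Υ p) :
    ∀ᶠ w in 𝓝 v,
      (w < v → ∀ᶠ ε in 𝓝[>] 0, bsCall (1 / ε) (k / ε) √w < p ε) ∧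
      (v < w → ∀ᶠ ε in 𝓝[>] 0, p ε < bsCall (1 / ε) (k / ε) √w) := by
  have hkv := h.four_mul_sq_sub_ne
  set g : ℝ → ℝ := fun w => 1 / 8 - k ^ 2 / (2 * v * w) with hg
  have hv := h.pos
  -- g v is the derivative of the rate at v; its sign is opposite to that of 4k² - v², hence to
  -- those of `bsLead k v` and A.
  have hgA : A * g v < 0 := by
    have e : A * g v = -(A * bsLead k v) * ((4 * k ^ 2 - v ^ 2) ^ 2 / (32 * v ^ 2 * (v * √v))) := by
      have hsv : √v ≠ 0 := (Real.sqrt_pos.2 hv).ne'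
      obtain ⟨D, hD⟩ : ∃ D, D = 4 * k ^ 2 - v ^ 2 := ⟨_, rfl⟩
      have hk2 : k ^ 2 = (D + v ^ 2) / 4 := by rw [hD]; ring
      rw [bsLead]
      simp only [hg]
      rw [← hD] at hkv ⊢
      rw [hk2]
      field_simp
      ring
    have hsv : 0 < √v := Real.sqrt_pos.2 hv
    rw [e, neg_mul, neg_lt_zero]
    positivity
  have hgc : ContinuousAt g v :=
    continuousAt_const.sub (continuousAt_const.div (by fun_prop) (by positivity))
  have hAg : ∀ᶠ w in 𝓝 v, A * g w < 0 :=
    (continuousAt_const.mul hgc).eventually (gt_mem_nhds hgA)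
  have hAb : ∀ᶠ w in 𝓝 v, 0 < A * bsLead k w :=
    (continuousAt_const.mul (continuousAt_bsLead hkv)).eventually (lt_mem_nhds hA)
  filter_upwards [h.eventually_nhds, hAg, hAb] with w hw hgw hbw
  -- The second parameter is chosen to make the rate condition trivial; only the position of w
  -- relative to ±2k matters.
  have hw' : LeadingOrder k (bsRate k w + k) u w :=
    ⟨hw.1, by ring, hw.2.1, hw.2.2.1, hw.2.2.2.1, hw.2.2.2.2⟩
  have hb := (hw'.tendsto_bsCall (V := fun _ => w) tendsto_const_nhds).2
  have hrate := bsRate_sub_bsRate (k := k) hv.ne' hw.1.ne'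
  have hscale : ∀ ρ : ℝ, ∀ c : ℝ → ℝ, ∀ᶠ ε in 𝓝[>] 0,
      priceScale ρ ε * (otmPrice u (k / ε) (c ε) / priceScale ρ ε) = otmPrice u (k / ε) (c ε) := by
    intro ρ c
    filter_upwards [self_mem_nhdsWithin] with ε hε
    exact mul_div_cancel₀ _ (priceScale_pos ρ hε).ne'
  have s1 := hscale (bsRate k v) p
  have s2 := hscale (bsRate k w) fun ε => bsCall (1 / ε) (k / ε) √w
  have hA0 : A ≠ 0 := by rintro rfl; simp at hA
  rcases hA0.lt_or_gt with hneg | hpos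
  · have hb0 : bsLead k w < 0 := by
      by_contra hcon
      exact hbw.not_ge (mul_nonpos_of_nonpos_of_nonneg hneg.le (not_lt.1 hcon))
    have hg0 : 0 < g w := by
      by_contra hcon
      exact hgw.not_ge (mul_nonneg_of_nonpos_of_nonpos hneg.le (not_lt.1 hcon))
    refine ⟨fun hlt => ?_, fun hlt => ?_⟩
    · have hr : bsRate k w < bsRate k v := by
        have := mul_neg_of_neg_of_pos (sub_neg.2 hlt) hg0
        rw [← hrate] at this; linarith
      filter_upwards [priceScale_mul_lt hr (neg_pos.2 hb0) hb.neg hp.tendsto.neg, s1, s2]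
        with ε q1 q2 q3
      rw [mul_neg, mul_neg, q2, q3, neg_lt_neg_iff] at q1
      exact otmPrice_lt_otmPrice_iff.1 q1
    · have hr : bsRate k v < bsRate k w := by
        have := _root_.mul_pos (sub_pos.2 hlt) hg0
        rw [← hrate] at this; linarith
      filter_upwards [priceScale_mul_lt hr (neg_pos.2 hneg) hp.tendsto.neg hb.neg, s1, s2]
        with ε q1 q2 q3
      rw [mul_neg, mul_neg, q2, q3, neg_lt_neg_iff] at q1
      exact otmPrice_lt_otmPrice_iff.1 q1
  · have hb0 : 0 < bsLead k w := (pos_iff_pos_of_mul_pos hbw).1 hpos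
    have hg0 : g w < 0 := by
      by_contra hcon
      exact hgw.not_ge (mul_nonneg hpos.le (not_lt.1 hcon))
    refine ⟨fun hlt => ?_, fun hlt => ?_⟩
    · have hr : bsRate k v < bsRate k w := by
        have := mul_pos_of_neg_of_neg (sub_neg.2 hlt) hg0
        rw [← hrate] at this; linarith
      filter_upwards [priceScale_mul_lt hr hpos hp.tendsto hb, s1, s2] with ε q1 q2 q3
      rw [q2, q3] at q1
      exact otmPrice_lt_otmPrice_iff.1 q1
    · have hr : bsRate k w < bsRate k v := by
        have := mul_neg_of_pos_of_neg (sub_pos.2 hlt) hg0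
        rw [← hrate] at this; linarith
      filter_upwards [priceScale_mul_lt hr hb0 hb hp.tendsto, s1, s2] with ε q1 q2 q3
      rw [q2, q3] at q1
      exact otmPrice_lt_otmPrice_iff.1 q1

lemma LeadingOrder.exists_lower (h : LeadingOrder k L u v) (hA : 0 < A * bsLead k v)
    (hp : PriceExpansion k u v A Υ p) {a : ℝ} (ha : a < v) :
    ∃ w, a < w ∧ 0 < w ∧ w < v ∧ ∀ᶠ ε in 𝓝[>] 0, bsCall (1 / ε) (k / ε) √w < p ε := by
  obtain ⟨w, ⟨hw1, hw2⟩, hw3⟩ := (((h.bracket hA hp).and (lt_mem_nhds h.pos)).filter_mono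
    (nhdsWithin_le_nhds (s := Set.Iio v))).and (Ioo_mem_nhdsLT ha) |>.exists
  exact ⟨w, hw3.1, hw2, hw3.2, hw1.1 hw3.2⟩

lemma LeadingOrder.exists_upper (h : LeadingOrder k L u v) (hA : 0 < A * bsLead k v)
    (hp : PriceExpansion k u v A Υ p) {b : ℝ} (hb : v < b) :
    ∃ w, w < b ∧ v < w ∧ ∀ᶠ ε in 𝓝[>] 0, p ε < bsCall (1 / ε) (k / ε) √w := by
  obtain ⟨w, hw1, hw3⟩ := ((h.bracket hA hp).filter_mono
    (nhdsWithin_le_nhds (s := Set.Ioi v))).and (Ioo_mem_nhdsGT hb) |>.exists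
  exact ⟨w, hw3.2, hw3.1, hw1.2 hw3.1⟩

/-- Existence and uniqueness of the implied volatility. -/
lemma LeadingOrder.existsUnique (h : LeadingOrder k L u v) (hA : 0 < A * bsLead k v)
    (hp : PriceExpansion k u v A Υ p) :
    ∀ᶠ ε in 𝓝[>] 0, ∃! s : ℝ, 0 < s ∧ bsCall (1 / ε) (k / ε) s = p ε := by
  obtain ⟨w₁, -, hw1, hlt1, hlow⟩ := h.exists_lower hA hp (sub_one_lt v)
  obtain ⟨w₂, -, hlt2, hup⟩ := h.exists_upper hA hp (lt_add_one v)
  filter_upwards [hlow, hup, self_mem_nhdsWithin] with ε h1 h2 hε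
  have hτ : 0 < 1 / ε := one_div_pos.2 hε
  have hs1 : 0 < √w₁ := Real.sqrt_pos.2 hw1
  have hle : √w₁ ≤ √w₂ := Real.sqrt_le_sqrt (hlt1.trans hlt2).le
  have hsub : Set.Icc √w₁ √w₂ ⊆ Set.Ioi 0 := fun s hs => hs1.trans_le hs.1
  obtain ⟨s, hs, hsp⟩ := intermediate_value_Icc hle
    ((continuousOn_bsCall hτ (k / ε)).mono hsub) ⟨h1.le, h2.le⟩
  exact ⟨s, ⟨hsub hs, hsp⟩, fun y hy =>
    (strictMonoOn_bsCall hτ (k / ε)).injOn hy.1 (hsub hs) (hy.2.trans hsp.symm)⟩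

/-- The implied variance converges to the leading order. -/
lemma LeadingOrder.tendsto_variance (h : LeadingOrder k L u v) (hA : 0 < A * bsLead k v)
    (hp : PriceExpansion k u v A Υ p) {σ : ℝ → ℝ}
    (hσ : ∀ᶠ ε in 𝓝[>] 0, 0 < σ ε ∧ bsCall (1 / ε) (k / ε) (σ ε) = p ε) :
    Tendsto (fun ε => σ ε ^ 2) (𝓝[>] 0) (𝓝 v) := by
  refine tendsto_order.2 ⟨fun a ha => ?_, fun b hb => ?_⟩
  · obtain ⟨w, haw, hw, -, hlow⟩ := h.exists_lower hA hp ha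
    filter_upwards [hlow, hσ, self_mem_nhdsWithin] with ε h1 h2 hε
    have hτ : 0 < 1 / ε := one_div_pos.2 hε
    rw [← h2.2, (strictMonoOn_bsCall hτ (k / ε)).lt_iff_lt (Real.sqrt_pos.2 hw) h2.1,
      Real.sqrt_lt' h2.1] at h1
    exact haw.trans h1
  · obtain ⟨w, hwb, hw, hup⟩ := h.exists_upper hA hp hb
    filter_upwards [hup, hσ, self_mem_nhdsWithin] with ε h1 h2 hε
    have hτ : 0 < 1 / ε := one_div_pos.2 hε
    rw [← h2.2, (strictMonoOn_bsCall hτ (k / ε)).lt_iff_lt h2.1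
      (Real.sqrt_pos.2 (h.pos.trans hw)), Real.lt_sqrt h2.1.le] at h1
    exact h1.trans hwb

/-- The implied variance satisfies the approximate smile equation. -/
lemma LeadingOrder.isBigO_smileDefect (h : LeadingOrder k L u v) (hA : 0 < A * bsLead k v)
    (hp : PriceExpansion k u v A Υ p) {σ : ℝ → ℝ}
    (hσ : ∀ᶠ ε in 𝓝[>] 0, 0 < σ ε ∧ bsCall (1 / ε) (k / ε) (σ ε) = p ε) :
    (fun ε => smileDefect k v (Real.log A) Υ ε (σ ε ^ 2)) =O[𝓝[>] 0] fun ε => ε ^ 3 := by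
  have hkv := h.four_mul_sq_sub_ne
  have hA0 : A ≠ 0 := by rintro rfl; simp at hA
  have hB0 : bsLead k v ≠ 0 := by intro h0; simp [h0] at hA
  have hV := h.tendsto_variance hA hp hσ
  set V : ℝ → ℝ := fun ε => σ ε ^ 2 with hVdef
  obtain ⟨hb1, hb2⟩ := h.tendsto_bsCall hV
  set y : ℝ → ℝ := fun ε => otmPrice u (k / ε) (bsCall (1 / ε) (k / ε) √(V ε)) /
    priceScale (bsRate k (V ε)) ε with hy
  set x : ℝ → ℝ := fun ε => otmPrice u (k / ε) (p ε) / priceScale (bsRate k v) ε with hx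
  have hLead : Tendsto (fun ε => bsLead k (V ε)) (𝓝[>] 0) (𝓝 (bsLead k v)) :=
    (continuousAt_bsLead hkv).tendsto.comp hV
  have hCorr : Tendsto (fun ε => bsCorr k (V ε)) (𝓝[>] 0) (𝓝 (bsCorr k v)) :=
    (analyticAt_bsCorr hkv).continuousAt.tendsto.comp hV
  have hLne : ∀ᶠ ε in 𝓝[>] 0, bsLead k (V ε) ≠ 0 := hLead.eventually_ne hB0
  have hp1 : (fun ε : ℝ => ε) =O[𝓝[>] 0] fun ε => ε := isBigO_refl _ _
  -- Dividing by A, which may be negative, gives a quantity tending to 1, so the logarithm can be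
  -- expanded there.
  have lx : (fun ε => Real.log (x ε / A) - Υ * ε) =O[𝓝[>] 0] fun ε => ε ^ 2 := by
    refine isBigO_log_one_add_sub tendsto_id_nhdsGT ?_ (hp1.const_mul_left Υ)
    refine (hp.isBigO.const_mul_left A⁻¹).congr_left fun ε => ?_
    field_simp
    rfl
  have ly : (fun ε => Real.log (y ε / bsLead k (V ε)) - -(bsCorr k (V ε) * ε)) =O[𝓝[>] 0]
      fun ε => ε ^ 2 := by
    refine isBigO_log_one_add_sub tendsto_id_nhdsGT ?_ ?_
    · have h1 : (fun ε => (bsLead k (V ε))⁻¹) =O[𝓝[>] 0] fun _ => (1 : ℝ) :=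
        (hLead.inv₀ hB0).isBigO_one ℝ
      refine (h1.mul hb1).congr' ?_ (Eventually.of_forall fun ε => one_mul _)
      filter_upwards [hLne] with ε hε
      field_simp
      ring
    · have := (hCorr.isBigO_one ℝ).mul hp1
      simpa using this.neg_left
  have hx0 : ∀ᶠ ε in 𝓝[>] 0, x ε ≠ 0 := hp.tendsto.eventually_ne hA0
  have hy0 : ∀ᶠ ε in 𝓝[>] 0, y ε ≠ 0 := hb2.eventually_ne hB0
  have key := (hp1.mul (ly.sub lx)).congr_right (g₂ := fun ε : ℝ => ε ^ 3) fun ε => by ring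
  refine key.congr' ?_ EventuallyEq.rfl
  filter_upwards [hσ, hx0, hy0, hLne, self_mem_nhdsWithin] with ε hs hxε hyε hLε hε
  have hε0 : 0 < ε := hε
  have heq : x ε * priceScale (bsRate k v) ε = y ε * priceScale (bsRate k (V ε)) ε := by
    simp only [hx, hy, hVdef]
    rw [div_mul_cancel₀ _ (priceScale_pos _ hε0).ne', div_mul_cancel₀ _ (priceScale_pos _ hε0).ne',
      Real.sqrt_sq hs.1.le, hs.2]
  have hexp : x ε * Real.exp (-bsRate k v / ε) = y ε * Real.exp (-bsRate k (V ε) / ε) := by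
    have hsq : √ε ≠ 0 := (Real.sqrt_pos.2 hε0).ne'
    have hpi : √(2 * Real.pi) ≠ 0 := by positivity
    simp only [priceScale] at heq
    field_simp at heq
    simpa only [neg_div] using heq
  -- Logarithms of the equal prices, multiplied by ε, give ρ(V) - ρ(v) = ε (log y - log x). The
  -- defect is then ε times the difference of the two O(ε²) remainders.
  have hlog := congrArg Real.log hexp
  rw [Real.log_mul hxε (Real.exp_pos _).ne', Real.log_mul hyε (Real.exp_pos _).ne', Real.log_exp,
    Real.log_exp] at hlog
  rw [Real.log_div hxε hA0, Real.log_div hyε hLε, smileDefect]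
  have hmul : ε * Real.log (x ε) - bsRate k v = ε * Real.log (y ε) - bsRate k (V ε) := by
    have := congrArg (ε * ·) hlog
    simp only [mul_add] at this
    rw [mul_div_cancel₀ _ hε0.ne', mul_div_cancel₀ _ hε0.ne'] at this
    linarith
  linear_combination (-1 : ℝ) * hmul

/-- Second order expansion of the implied variance. -/
theorem LeadingOrder.variance_expansion (h : LeadingOrder k L u v) (hA : 0 < A * bsLead k v)
    (hp : PriceExpansion k u v A Υ p) {v₁ v₂ : ℝ}
    (e1 : (1 / 8 - k ^ 2 / (2 * v * v)) * v₁ = Real.log (bsLead k v) - Real.log A)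
    (e2 : (1 / 8 - k ^ 2 / (2 * v * v)) * v₂ + k ^ 2 / (2 * v * v ^ 2) * v₁ ^ 2 -
      (3 / (2 * v) + 2 * v / (4 * k ^ 2 - v ^ 2)) * v₁ + (bsCorr k v + Υ) = 0) {σ : ℝ → ℝ}
    (hσ : ∀ᶠ ε in 𝓝[>] 0, 0 < σ ε ∧ bsCall (1 / ε) (k / ε) (σ ε) = p ε) :
    (fun ε => σ ε ^ 2 - (v + v₁ * ε + v₂ * ε ^ 2)) =O[𝓝[>] 0] fun ε => ε ^ 3 := by
  have hkv := h.four_mul_sq_sub_ne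
  have hW : Tendsto (fun ε : ℝ => v + v₁ * ε + v₂ * ε ^ 2) (𝓝[>] 0) (𝓝 v) := by
    have : Tendsto (fun ε : ℝ => v + v₁ * ε + v₂ * ε ^ 2) (𝓝 0)
        (𝓝 (v + v₁ * 0 + v₂ * 0 ^ 2)) := Continuous.tendsto (by fun_prop) 0
    simp only [mul_zero, add_zero, ne_eq, OfNat.ofNat_ne_zero, not_false_eq_true, zero_pow] at this
    exact this.mono_left nhdsWithin_le_nhds
  exact (isBigO_sub_of_smileDefect h.pos hkv (h.tendsto_variance hA hp hσ) hW).trans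
    ((h.isBigO_smileDefect hA hp hσ).sub (smileDefect_expansion h.pos hkv e1 e2))

/-- `Λ₀` vanishes at the origin. -/
lemma StandingAssumption.limit_zero {Ω : Type*} [MeasurableSpace Ω] {μ : Measure Ω}
    [IsProbabilityMeasure μ] {Y : ℝ → Ω → ℝ} {D₀ : Set ℝ} {Λ₀ Λ₁ Λ₂ : ℝ → ℝ}
    (hΛ : StandingAssumption μ Y D₀ Λ₀ Λ₁ Λ₂) : Λ₀ 0 = 0 := by
  have h1 := hΛ.expansion 0 hΛ.zero_mem
  have h2 : ∀ ε : ℝ, lmgf μ Y ε 0 = 0 := fun ε => by simp [lmgf]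
  simp only [h2, zero_sub] at h1
  have h3 : Tendsto (fun ε : ℝ => ε ^ 3) (𝓝[>] 0) (𝓝 0) := by
    simpa using tendsto_mul_pow_nhdsGT 1 three_ne_zero
  have h4 := h1.trans_tendsto h3
  have h5 : Tendsto (fun ε : ℝ => -(Λ₀ 0 + Λ₁ 0 * ε + Λ₂ 0 * ε ^ 2)) (𝓝[>] 0) (𝓝 (-Λ₀ 0)) := by
    have : Tendsto (fun ε : ℝ => -(Λ₀ 0 + Λ₁ 0 * ε + Λ₂ 0 * ε ^ 2)) (𝓝 0)
        (𝓝 (-(Λ₀ 0 + Λ₁ 0 * 0 + Λ₂ 0 * 0 ^ 2))) := Continuous.tendsto (by fun_prop) 0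
    simp only [mul_zero, add_zero, ne_eq, OfNat.ofNat_ne_zero, not_false_eq_true, zero_pow] at this
    exact this.mono_left nhdsWithin_le_nhds
  simpa using (tendsto_nhds_unique h5 h4)

end

end FwdSmile

end

/-! ### Main theorem -/

open FwdSmile in
theorem proposition2p13 {Ω : Type*} [MeasurableSpace Ω] (μ : Measure Ω) [IsProbabilityMeasure μ]
    (X : ℝ → Ω → ℝ) (hX : ∀ s : ℝ, 0 ≤ s → Measurable (X s)) (t : ℝ) (ht : 0 ≤ t)
    (hmean : ∀ τ : ℝ, 0 < τ → ∫ a, Real.exp (FwdSmile.fwd X t τ a) ∂μ = 1)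
    (D₀ : Set ℝ) (Λ₀ Λ₁ Λ₂ : ℝ → ℝ)
    (hΛ : FwdSmile.StandingAssumption μ (FwdSmile.largeMaturityFamily X t) D₀ Λ₀ Λ₁ Λ₂)
    (h1 : (1 : ℝ) ∈ interior D₀) (hΛ1 : Λ₀ 1 = 0)
    (k u : ℝ) (hu : FwdSmile.IsSaddlePoint (interior D₀) Λ₀ k u)
    (hk0 : k ≠ deriv Λ₀ 0) (hk1 : k ≠ deriv Λ₀ 1) :
    (∀ᶠ τ in atTop, ∃! s : ℝ, FwdSmile.IsFwdImpliedVol μ X t τ (k * τ) s) ∧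
    ∀ σ : ℝ → ℝ, (∀ᶠ τ in atTop, FwdSmile.IsFwdImpliedVol μ X t τ (k * τ) (σ τ)) →
      (fun τ : ℝ => σ τ ^ 2 -
        (FwdSmile.v0 (interior D₀) Λ₀ k
          + FwdSmile.v1 (interior D₀) Λ₀ Λ₁ k u / τ
          + FwdSmile.v2 (interior D₀) Λ₀ Λ₁ Λ₂ k u / τ ^ 2))
        =O[atTop] (fun τ : ℝ => 1 / τ ^ 3) := by
  have hdiff := hΛ.essentiallySmooth.differentiable
  obtain ⟨hu0, hu1, hlead⟩ := leadingOrder_of_saddlePoint hΛ.strictConvex hdiff hΛ.zero_mem h1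
    hΛ.limit_zero hΛ1 hu hk0 hk1
  obtain ⟨G, F₀, r, ε₁, K, C, hamp⟩ := exists_amplitudeControl hΛ hu.1 hu0
  have ha := hamp.second_deriv_pos hΛ.strictConvex (hdiff u hu.1)
  obtain ⟨C', hC'⟩ := hamp.price_expansion hX ht hmean hu0 hu1 hu.2 ha
  have hleg := legendre_eq hΛ.strictConvex hu (hdiff u hu.1)
  set a := iteratedDeriv 2 Λ₀ u with haD
  set v := v0 (interior D₀) Λ₀ k with hv
  set A := Real.exp (Λ₁ u) / (u * (u - 1) * √a) with hA
  have hkv := hlead.four_mul_sq_sub_ne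
  have hsa : 0 < √a := Real.sqrt_pos.2 ha
  have hsv : 0 < √v := Real.sqrt_pos.2 hlead.pos
  have hvp := hlead.pos
  have hu1' : u - 1 ≠ 0 := sub_ne_zero.2 hu1
  -- Both coefficients have the same sign, negative exactly when 0 < u < 1.
  have hApos : 0 < A * bsLead k v := by
    have e : A * bsLead k v = Real.exp (Λ₁ u) * (4 * (v * √v)) / √a /
        (u * (u - 1) * (4 * k ^ 2 - v ^ 2)) := by
      rw [hA, bsLead]; field_simp
    rw [e]
    have := hlead.mul_pos hu0 hu1
    positivity
  have hscale : ∀ᶠ ε in 𝓝[>] (0 : ℝ), 0 < priceScale (bsRate k v) ε := by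
    filter_upwards [self_mem_nhdsWithin] with ε hε
    exact priceScale_pos _ hε
  have hpe : PriceExpansion k u v A (Upsilon Λ₀ Λ₁ Λ₂ 1 u)
      (fun ε => fwdCall μ X t (1 / ε) (k / ε)) := by
    have hpi : √(2 * Real.pi) ≠ 0 := by positivity
    have := tendsto_div_of_abs_sub_le (s := priceScale (bsRate k v))
      (p := fun ε => otmPrice u (k / ε) (fwdCall μ X t (1 / ε) (k / ε)))
      (q := fun ε => A * (1 + Upsilon Λ₀ Λ₁ Λ₂ 1 u * ε)) (B := fun _ => C' * √(2 * Real.pi))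
      (b := C' * √(2 * Real.pi)) (a := A) hscale ?_ tendsto_const_nhds ?_
    · exact ⟨this.1, this.2⟩
    · filter_upwards [hC'] with ε hε
      have e : (k - (u * k - Λ₀ u)) / ε = -bsRate k v / ε := by
        rw [hlead.rate, hleg]; ring
      rw [e] at hε
      convert hε using 1
      · congr 2
        rw [priceScale, hA, Real.sqrt_mul (by positivity : 0 ≤ 2 * Real.pi) a]
        field_simp
      · rw [priceScale]
        field_simp
    · have := (tendsto_const_nhds (x := (1 : ℝ))).add (tendsto_id_nhdsGT.const_mul
        (Upsilon Λ₀ Λ₁ Λ₂ 1 u))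
      simpa using this.const_mul A
  have hinv : Tendsto (fun τ : ℝ => τ⁻¹) atTop (𝓝[>] 0) := tendsto_inv_atTop_nhdsGT_zero
  refine ⟨?_, fun σ hσ => ?_⟩
  · filter_upwards [hinv.eventually (hlead.existsUnique hApos hpe), eventually_gt_atTop 0]
      with τ hτ hτ0
    simpa [IsFwdImpliedVol] using hτ
  -- The small parameter is ε = 1/τ; the expansion obtained for ε ↦ σ(1/ε) is pulled back along τ ↦
  -- 1/τ.
  · have hσ' : ∀ᶠ ε in 𝓝[>] (0 : ℝ), 0 < σ ε⁻¹ ∧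
        bsCall (1 / ε) (k / ε) (σ ε⁻¹) = fwdCall μ X t (1 / ε) (k / ε) := by
      filter_upwards [tendsto_inv_nhdsGT_zero.eventually hσ] with ε hε
      simpa [IsFwdImpliedVol, div_eq_mul_inv] using hε
    have hexp := (hlead.variance_expansion hApos hpe (v1_equation hlead.pos ha hu0 hu1 hkv)
      (v2_equation hlead.pos hkv) hσ').comp_tendsto hinv
    refine hexp.congr (fun τ => ?_) fun τ => ?_
    · simp only [Function.comp_apply, inv_inv, inv_pow, ← div_eq_mul_inv]
      rfl
    · simp
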